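/- **Setting.** Let $(X,\mathsf d,\mathfrak m)$ be a metric measure space: $(X,\mathsf d)$ is a complete separable metric space and $\mathfrak m$ is a nonzero nonnegative Borel measure that is finite on bounded sets. Balls $B_r(x)$ are open. Assume the following. (a) *Strong rectifiability.* There is $d\in\mathbb N$ such that for every $\varepsilon>0$ there is an $\varepsilon$-atlas of dimension $d$, that is, a countable family $(U_i,\varphi_i)_{i\in\mathbb N}$ of pairwise disjoint Borel sets $U_i\subset X$ covering $X$ up to an $\mathfrak m$-null set and maps $\varphi_i:U_i\to\mathbb R^d$ with $(1+\varepsilon)^{-1}\mathsf d(x,y)\le|\varphi_i(x)-\varphi_i(y)|\le(1+\varepsilon)\mathsf d(x,y)$ on $U_i$ and, for some $c_i>0$, $c_i\,\mathcal L^d|_{\varphi_i(U_i)}\le(\varphi_i)_*(\mathfrak m|_{U_i})\le(1+\varepsilon)c_i\,\mathcal L^d|_{\varphi_i(U_i)}$. (b) *Uniform local doubling.* For every $R>0$ there is a constant $\mathsf{Doub}(R)>0$ with $\mathfrak m(B_{2r}(x))\le\mathsf{Doub}(R)\,\mathfrak m(B_r(x))$ for all $x\in X$, $r\in(0,R)$.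 (c) *Poincaré inequality.* For every $R>0$ there are constants $C,\lambda>0$ such that for every Lipschitz $f:X\to\mathbb R$, every $x\in X$ and $r\in(0,R)$, writing $B=B_r(x)$, $\lambda B=B_{\lambda r}(x)$ and $f_B=\frac1{\mathfrak m(B)}\int_B f\,d\mathfrak m$, $$\frac1{\mathfrak m(B)}\int_B|f-f_B|\,d\mathfrak m\le C\,r\,\frac1{\mathfrak m(\lambda B)}\int_{\lambda B}\operatorname{lip}f\,d\mathfrak m,\qquad \operatorname{lip}f(x)=\limsup_{y\to x,\,y\ne x}\frac{|f(y)-f(x)|}{\mathsf d(x,y)}$$ (with $\operatorname{lip} f(x)=0$ at isolated points). Let $(Y,\mathsf d_Y,\bar y)$ be a pointed complete metric space and $p\in(1,\infty)$. Let $L^p(X,Y_{\bar y})$ be the set of ($\mathfrak m$-a.e. classes of) Borel maps $u:X\to Y$ with separable range and $\int\mathsf d_Y(u,\bar y)^p\,d\mathfrak m<\infty$. For $u\in L^p(X,Y_{\bar y})$ and $r>0$ put $$\mathsf{ks}_{p,r}[u](x)=\Big(\frac1{\mathfrak m(B_r(x))}\int_{B_r(x)}\frac{\mathsf d_Y(u(x),u(y))^p}{r^p}\,d\mathfrak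 m(y)\Big)^{1/p},\qquad \mathsf E_p(u)=\liminf_{r\downarrow0}\int\mathsf{ks}_{p,r}[u]^p\,d\mathfrak m\in[0,\infty],$$ and let $KS^{1,p}(X,Y_{\bar y})$ be the set of $u\in L^p(X,Y_{\bar y})$ with $\mathsf E_p(u)<\infty$. For a sequence $\varepsilon_n\downarrow0$ of positive numbers, a family of $\varepsilon_n$-atlases $\mathcal A^n=(U^n_i,\varphi^n_i)_i$ of dimension $d$ is called *aligned* if $\varphi^n_i-\varphi^k_j$ is $(\varepsilon_n+\varepsilon_k)$-Lipschitz on $U^n_i\cap U^k_j$ for all $n,k,i,j$. A point $x$ is a density point of $E$ if $\mathfrak m(B_r(x)\cap E)/\mathfrak m(B_r(x))\to1$ as $r\downarrow0$ (similarly in $\mathbb R^d$ with $\mathcal L^d$). For a density point $x$ of $U$ and $f\ge0$ on $U$, $\operatorname{ap-limsup}_{y\to x,\,y\in U}f(y)$ is the infimum of the $t\in[0,\infty]$ for which $x$ is a density point of $\{y\in U: f(y)\le t\}$. A map $u:X\to Y$ is approximately metrically differentiable at $x$ relative to $(\mathcal A^n)$, with metric differential the seminorm $\mathsf{md}_x(u)$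 on $\mathbb R^d$, if for every $n$ there is an index $i=i(x,n)$ such that $x\in U^n_i$, $x$ is a density point of $U^n_i$ and $\varphi^n_i(x)$ is a density point of $\varphi^n_i(U^n_i)$, and $$\limsup_{n\to\infty}\ \operatorname*{ap-limsup}_{y\to x,\ y\in U^n_{i}}\frac{\big|\mathsf d_Y(u(y),u(x))-\mathsf{md}_x(u)(\varphi^n_{i}(y)-\varphi^n_{i}(x))\big|}{\mathsf d(y,x)}=0 .$$ The $p$-size of a seminorm $\|\cdot\|$ on $\mathbb R^d$ is $S_p(\|\cdot\|)=\big(\frac1{\mathcal L^d(B_1(0))}\int_{B_1(0)}\|w\|^p\,d\mathcal L^d(w)\big)^{1/p}$, where $B_1(0)$ is the Euclidean unit ball. **Theorem (Energy density).** For every $u\in KS^{1,p}(X,Y_{\bar y})$ there is a function $\mathrm e_p[u]\in L^p(X)$ such that the functions $\mathsf{ks}_{p,r}[u]$, which are finite and belong to $L^p(X)$ for every $r>0$, satisfy $$\mathsf{ks}_{p,r}[u]\to\mathrm e_p[u]\qquad\mathfrak m\text{-a.e. and in }L^p(X)\text{ as }r\downarrow0 .$$ Moreover, for every $\varepsilon_n\downarrow0$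 and every aligned family $(\mathcal A^n)$ of $\varepsilon_n$-atlases, $u$ is approximately metrically differentiable relative to $(\mathcal A^n)$ at $\mathfrak m$-a.e. $x$, and $$\mathrm e_p[u](x)=S_p(\mathsf{md}_x(u))\qquad\text{for }\mathfrak m\text{-a.e. }x\in X,$$ whichever metric differential $\mathsf{md}_x(u)$ of $u$ at $x$ is taken. Finally, for every $u\in L^p(X,Y_{\bar y})$ the limit $\lim_{r\downarrow0}\int\mathsf{ks}_{p,r}[u]^p\,d\mathfrak m$ exists in $[0,\infty]$, so that it equals $\mathsf E_p(u)$. -/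

import Mathlib

open MeasureTheory Filter Topology Metric Set
open scoped ENNReal NNReal

noncomputable section

namespace KorevaarSchoen

/-- `m` is an admissible reference measure of a metric measure space:
nonzero, and of finite mass on bounded sets. -/
structure IsReferenceMeasure {X : Type*} [MetricSpace X] [MeasurableSpace X]
    (m : Measure X) : Prop where
  ne_zero : m ≠ 0
  finite_of_isBounded : ∀ s : Set X, Bornology.IsBounded s → m s < ∞

/-- Uniformly locally doubling: for every `R > 0` there is a constant `C` with
`m (B_{2r}(x)) ≤ C m (B_r(x))` for all `x` and all `r ∈ (0, R)`. -/
def UniformlyLocallyDoubling {X : Type*} [MetricSpace X] [MeasurableSpace X]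
    (m : Measure X) : Prop :=
  ∀ R : ℝ, 0 < R → ∃ C : ℝ≥0, ∀ x : X, ∀ r : ℝ, 0 < r → r < R →
    m (ball x (2 * r)) ≤ C * m (ball x r)

/-- The local Lipschitz constant `lip f (x) = limsup_{y → x} |f y - f x| / d (y, x)`
(over `y ≠ x`); it is `0` at isolated points. -/
def localLip {X : Type*} [MetricSpace X] (f : X → ℝ) (x : X) : ℝ≥0∞ :=
  limsup (fun y => edist (f y) (f x) / edist y x) (𝓝[≠] x)

/-- The weak local (1,1)-Poincaré inequality for Lipschitz functions. The left-hand side is the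
mean oscillation of `f` on the ball; `f` is integrable there, being Lipschitz. -/
def SupportsPoincare {X : Type*} [MetricSpace X] [MeasurableSpace X]
    (m : Measure X) : Prop :=
  ∀ R : ℝ, 0 < R → ∃ C lam : ℝ, 0 < C ∧ 0 < lam ∧
    ∀ (f : X → ℝ) (K : ℝ≥0), LipschitzWith K f →
      ∀ x : X, ∀ r : ℝ, 0 < r → r < R →
        ⨍⁻ y in ball x r, ‖f y - ⨍ z in ball x r, f z ∂m‖ₑ ∂m
          ≤ ENNReal.ofReal (C * r) * ⨍⁻ y in ball x (lam * r), localLip f y ∂m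

/-- `ε`-atlas of dimension `d`: the countable family of charts `(U i, φ i)`. Only the values of
`φ i` on `U i` matter. (Some `U i` may be empty, so finite families are included.) Since `φ i` is
Lipschitz on the Borel set `U i`, it is a.e.-measurable for `m.restrict (U i)`, so the push-forward
in `measure` is the genuine one. -/
structure IsAtlas {X : Type*} [MetricSpace X] [MeasurableSpace X] (m : Measure X) (d : ℕ) (ε : ℝ)
    (U : ℕ → Set X) (φ : ℕ → X → EuclideanSpace ℝ (Fin d)) : Prop where
  measurableSet : ∀ i, MeasurableSet (U i)
  disjoint : Pairwise fun i j => Disjoint (U i) (U j)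
  cover : m (⋃ i, U i)ᶜ = 0
  upper : ∀ i, ∀ x ∈ U i, ∀ y ∈ U i, dist (φ i x) (φ i y) ≤ (1 + ε) * dist x y
  lower : ∀ i, ∀ x ∈ U i, ∀ y ∈ U i, dist x y ≤ (1 + ε) * dist (φ i x) (φ i y)
  measure : ∀ i, ∃ c : ℝ, 0 < c ∧
    ENNReal.ofReal c • (volume : Measure (EuclideanSpace ℝ (Fin d))).restrict (φ i '' U i)
      ≤ (m.restrict (U i)).map (φ i) ∧
    (m.restrict (U i)).map (φ i) ≤
      ENNReal.ofReal ((1 + ε) * c) •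
        (volume : Measure (EuclideanSpace ℝ (Fin d))).restrict (φ i '' U i)

/-- Strong rectifiability: for some dimension `d` there are `ε`-atlases for every `ε > 0`. -/
def StronglyRectifiable {X : Type*} [MetricSpace X] [MeasurableSpace X]
    (m : Measure X) : Prop :=
  ∃ d : ℕ, ∀ ε : ℝ, 0 < ε →
    ∃ (U : ℕ → Set X) (φ : ℕ → X → EuclideanSpace ℝ (Fin d)), IsAtlas m d ε U φ

/-- An aligned family of `ε n`-atlases: the difference of two charts of the family is
`(ε n + ε k)`-Lipschitz on the intersection of their domains. -/
structure IsAlignedFamily {X : Type*} [MetricSpace X] [MeasurableSpace X] (m : Measure X) (d : ℕ)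
    (ε : ℕ → ℝ) (U : ℕ → ℕ → Set X) (φ : ℕ → ℕ → X → EuclideanSpace ℝ (Fin d)) : Prop where
  atlas : ∀ n, IsAtlas m d (ε n) (U n) (φ n)
  aligned : ∀ n k i j, ∀ x ∈ U n i ∩ U k j, ∀ y ∈ U n i ∩ U k j,
    ‖(φ n i x - φ k j x) - (φ n i y - φ k j y)‖ ≤ (ε n + ε k) * dist x y

/-- `x` is a density point of `E` for `m`. -/
def IsDensityPoint {X : Type*} [MetricSpace X] [MeasurableSpace X] (m : Measure X)
    (E : Set X) (x : X) : Prop :=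
  Tendsto (fun r : ℝ => m (ball x r ∩ E) / m (ball x r)) (𝓝[>] 0) (𝓝 1)

/-- The approximate `limsup` at `x`, along `U`, of a nonnegative function `f`: the infimum of the
levels `t` for which `x` is a density point of `{y ∈ U | f y ≤ t}`. It is used when `x` is a density
point of `U`. -/
def apLimsup {X : Type*} [MetricSpace X] [MeasurableSpace X] (m : Measure X)
    (U : Set X) (f : X → ℝ≥0∞) (x : X) : ℝ≥0∞ :=
  sInf {t : ℝ≥0∞ | IsDensityPoint m {y ∈ U | f y ≤ t} x}

/-- The seminorm `ν` is an approximate metric differential of `u` at `x` relative to the family of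
atlases `(U n i, φ n i)`; `i n` is the index of the chart of the `n`-th atlas that contains `x`. -/
def IsApproxMetricDifferentialAt {X Y : Type*} [MetricSpace X] [MeasurableSpace X] [MetricSpace Y]
    (m : Measure X) {d : ℕ} (U : ℕ → ℕ → Set X) (φ : ℕ → ℕ → X → EuclideanSpace ℝ (Fin d))
    (u : X → Y) (x : X) (ν : Seminorm ℝ (EuclideanSpace ℝ (Fin d))) : Prop :=
  ∃ i : ℕ → ℕ,
    (∀ n, x ∈ U n (i n) ∧ IsDensityPoint m (U n (i n)) x ∧
      IsDensityPoint volume (φ n (i n) '' U n (i n)) (φ n (i n) x)) ∧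
    limsup (fun n => apLimsup m (U n (i n))
      (fun y => ENNReal.ofReal
        (|dist (u y) (u x) - ν (φ n (i n) y - φ n (i n) x)| / dist y x)) x) atTop = 0

/-- The `p`-size of a seminorm on `ℝ^d`: the `L^p` mean of the seminorm over the Euclidean unit
ball (the integrand is continuous). -/
def pSize {d : ℕ} (p : ℝ) (ν : Seminorm ℝ (EuclideanSpace ℝ (Fin d))) : ℝ :=
  (⨍ w in ball (0 : EuclideanSpace ℝ (Fin d)) 1, ν w ^ p) ^ (1 / p)

/-- Membership of `u` in `L^p(X, Y_ȳ)`: `u` is `m`-a.e. equal to a Borel map with separable range,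
and `d_Y(u, ȳ)^p` is integrable. -/
structure MemLpPointed {X Y : Type*} [MetricSpace X] [MeasurableSpace X] [MetricSpace Y]
    (m : Measure X) (p : ℝ) (ybar : Y) (u : X → Y) : Prop where
  aestronglyMeasurable : AEStronglyMeasurable u m
  lintegral_lt_top : ∫⁻ x, edist (u x) ybar ^ p ∂m < ∞

/-- The Korevaar-Schoen `p`-energy density of `u` at scale `r`. -/
def ksDensity {X Y : Type*} [MetricSpace X] [MeasurableSpace X] [MetricSpace Y]
    (m : Measure X) (p r : ℝ) (u : X → Y) (x : X) : ℝ≥0∞ :=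
  (⨍⁻ y in ball x r, edist (u x) (u y) ^ p / ENNReal.ofReal r ^ p ∂m) ^ (1 / p)

/-- The total energy at scale `r`. -/
def ksEnergyAtScale {X Y : Type*} [MetricSpace X] [MeasurableSpace X] [MetricSpace Y]
    (m : Measure X) (p r : ℝ) (u : X → Y) : ℝ≥0∞ :=
  ∫⁻ x, ksDensity m p r u x ^ p ∂m

/-- The Korevaar-Schoen energy `E_p(u)`, defined through the `liminf` as `r ↓ 0`. -/
def ksEnergy {X Y : Type*} [MetricSpace X] [MeasurableSpace X] [MetricSpace Y]
    (m : Measure X) (p : ℝ) (u : X → Y) : ℝ≥0∞ :=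
  liminf (fun r : ℝ => ksEnergyAtScale m p r u) (𝓝[>] 0)

/-- Membership in the Korevaar-Schoen space `KS^{1,p}(X, Y_ȳ)`. -/
structure MemKS {X Y : Type*} [MetricSpace X] [MeasurableSpace X] [MetricSpace Y]
    (m : Measure X) (p : ℝ) (ybar : Y) (u : X → Y) : Prop where
  memLpPointed : MemLpPointed m p ybar u
  energy_lt_top : ksEnergy m p u < ∞

end KorevaarSchoen

end

open KorevaarSchoen

/-!
The argument rests on one inequality of Hajłasz type: if `u` has finite energy, there is `G ∈ L^p`
with `d(u x, u y) ≤ d(x, y) (G x + G y)` for almost all `x, y` at distance less than `1/4`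
(`exists_hajlasz_bound`). To obtain it, the distances to points of `Y` are regularised at a scale
`s`; the Poincaré inequality, telescoped over shrinking balls, bounds the increments of `u` by the
maximal function of `ks_{p,s}[u]` up to the error `s * ks_{p,s}[u]` (`exists_edist_le_ksDensity`).
Along a sequence of scales with bounded energy these bounds are bounded in `L^p`. The functions
satisfying the inequality with the errors still admitted form a decreasing sequence of
midpoint-convex sets, and the Komlós-type lemma `exists_tendsto_of_midpoint_convex` extracts an
almost everywhere limit `G`.

On the sets `{G ≤ k}` the map `u` is locally Lipschitz. Read in a chart, it is given by countably
many Lipschitz functions on `ℝ^d`, the distances to a dense sequence, and Kirchheim's argument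
(`ae_sup_abs_sub_approx_supFDerivSeminorm`) yields a seminorm approximating the increments of `u`
at almost every point of the chart (`IsChart.ae_exists_hasChartDifferentialAt`). Blowing up the
measure at a density point (`limsup_blowUpAverage_le`, `le_liminf_blowUpAverage`), and using the
Hajłasz bound to discard a set of density zero, one finds that `ks_{p,r}[u]^p` is, as `r ↓ 0`,
comparable to the mean of the `p`-th power of that seminorm up to a constant depending on `d`, `p`
and `ε` which tends to `1` as `ε → 0`. As `ε`-atlases exist for every `ε`, the densities converge
almost everywhere (`ae_exists_tendsto_ksDensity`); no alignment is needed here. The Hajłasz bound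
dominates `ks_{p,r}[u]^p` by `G^p` and its averages over balls of radius `r`, whence convergence
in `L^p` (`tendsto_lintegral_zero_of_le_average`, `MemLpPointed.tendsto_eLpNorm_ksDensity`).

Along an aligned family the chart differentials at a point form a Cauchy sequence of seminorms,
whose limit is a metric differential (`IsAlignedFamily.exists_isApproxMetricDifferentialAt`).
Conversely the directions `φ y - φ x` with `y` near `x` are dense up to small errors, so that
every metric differential is the limit of the chart differentials
(`IsApproxMetricDifferentialAt.eventually_abs_sub_le`). The `p`-size being continuous, the limit
of the densities is its `p`-size (`IsAlignedFamily.ae_eq_pSize`).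

The limit of `∫ ks_{p,r}[u]^p` exists trivially if the lower limit is infinite; otherwise it is a
consequence of the convergence in `L^p`.
-/

noncomputable section

namespace KorevaarSchoen

/-! ### Locally doubling measures, density points and Lebesgue points -/

section Doubling

variable {X : Type*} [MetricSpace X] [MeasurableSpace X] {m : Measure X}

lemma IsReferenceMeasure.measure_ball_lt_top (hm : IsReferenceMeasure m) (x : X) (r : ℝ) :
    m (ball x r) < ∞ := hm.finite_of_isBounded _ isBounded_ball

lemma UniformlyLocallyDoubling.exists_measure_ball_mul_le (hd : UniformlyLocallyDoubling m)
    (Λ R : ℝ) : ∃ C : ℝ≥0, 1 ≤ C ∧ ∀ (x : X) (r : ℝ), 0 < r → r < R →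
      m (ball x (Λ * r)) ≤ C * m (ball x r) := by
  obtain ⟨n, hn⟩ := pow_unbounded_of_one_lt Λ (one_lt_two)
  obtain ⟨C, hC⟩ := hd (2 ^ n * max R 1) (by positivity)
  refine ⟨(max C 1) ^ n, one_le_pow₀ (le_max_right _ _), fun x r hr hrR => ?_⟩
  have key : ∀ k ≤ n, m (ball x (2 ^ k * r)) ≤ ((max C 1) ^ k : ℝ≥0) * m (ball x r) := by
    intro k
    induction k with
    | zero => simp
    | succ k ih =>
      intro hk
      have h1 : (2 : ℝ) ^ k * r < 2 ^ n * max R 1 := by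
        have : (2 : ℝ) ^ k ≤ 2 ^ n := pow_le_pow_right₀ (by norm_num) (by omega)
        calc (2 : ℝ) ^ k * r ≤ 2 ^ n * r := by gcongr
          _ < 2 ^ n * max R 1 := by gcongr; exact lt_of_lt_of_le hrR (le_max_left _ _)
      calc m (ball x (2 ^ (k + 1) * r)) = m (ball x (2 * (2 ^ k * r))) := by ring_nf
        _ ≤ C * m (ball x (2 ^ k * r)) := hC _ _ (by positivity) h1
        _ ≤ (max C 1 : ℝ≥0) * (((max C 1) ^ k : ℝ≥0) * m (ball x r)) := by
            gcongr
            · exact le_max_left _ _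
            · exact ih (by omega)
        _ = _ := by rw [← mul_assoc, pow_succ']; push_cast; rfl
  calc m (ball x (Λ * r)) ≤ m (ball x (2 ^ n * r)) := by
        apply measure_mono; apply ball_subset_ball; gcongr
    _ ≤ _ := key n le_rfl

lemma measure_ball_pos (hm : IsReferenceMeasure m) (hd : UniformlyLocallyDoubling m) (x : X)
    {r : ℝ} (hr : 0 < r) : 0 < m (ball x r) := by
  by_contra! h
  have h0 : m (ball x r) = 0 := le_antisymm h bot_le
  apply hm.ne_zero
  rw [← Measure.measure_univ_eq_zero]
  have : (univ : Set X) = ⋃ n : ℕ, ball x (n * r) := by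
    refine (eq_univ_of_forall fun y => ?_).symm
    obtain ⟨n, hn⟩ := exists_nat_gt (dist y x / r)
    exact mem_iUnion.2 ⟨n, by rwa [mem_ball, ← div_lt_iff₀ hr]⟩
  rw [this]
  refine measure_iUnion_null fun n => ?_
  obtain ⟨C, -, hC⟩ := hd.exists_measure_ball_mul_le n (r + 1)
  exact le_antisymm ((hC x r hr (by linarith)).trans (by simp [h0])) bot_le

lemma UniformlyLocallyDoubling.isUnifLocDoublingMeasure (hd : UniformlyLocallyDoubling m) :
    IsUnifLocDoublingMeasure m := by
  obtain ⟨C, -, hC⟩ := hd.exists_measure_ball_mul_le 3 1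
  refine ⟨C, ?_⟩
  filter_upwards [Ioo_mem_nhdsGT (zero_lt_one' ℝ)] with r hr x
  calc m (closedBall x (2 * r)) ≤ m (ball x (3 * r)) :=
        measure_mono (closedBall_subset_ball (by linarith [hr.1]))
    _ ≤ C * m (ball x r) := hC x r hr.1 hr.2
    _ ≤ C * m (closedBall x r) := by gcongr; exact ball_subset_closedBall

lemma IsReferenceMeasure.isLocallyFiniteMeasure (hm : IsReferenceMeasure m) :
    IsLocallyFiniteMeasure m :=
  ⟨fun x => ⟨ball x 1, ball_mem_nhds x one_pos, hm.measure_ball_lt_top x 1⟩⟩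

/-- `x` is a rarefaction point of `E`: the density of `E` at `x` vanishes. For `m`-measurable `E`
this says that `x` is a density point of the complement of `E`. -/
def IsRarePoint (m : Measure X) (E : Set X) (x : X) : Prop :=
  Tendsto (fun r : ℝ => m (ball x r ∩ E) / m (ball x r)) (𝓝[>] 0) (𝓝 0)

lemma IsRarePoint.mono {E F : Set X} {x : X} (h : IsRarePoint m F x) (hEF : E ⊆ F) :
    IsRarePoint m E x :=
  tendsto_of_tendsto_of_tendsto_of_le_of_le tendsto_const_nhds h (fun _ => bot_le)
    fun r => by dsimp only; gcongr

lemma IsRarePoint.of_eventually {E F : Set X} {x : X} (h : IsRarePoint m F x) {δ : ℝ} (hδ : 0 < δ)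
    (hEF : E ∩ ball x δ ⊆ F) : IsRarePoint m E x := by
  refine tendsto_of_tendsto_of_tendsto_of_le_of_le' tendsto_const_nhds h
    (Eventually.of_forall fun _ => bot_le) ?_
  filter_upwards [Ioo_mem_nhdsGT hδ] with r hr
  gcongr m ?_ / _
  exact fun y hy => ⟨hy.1, hEF ⟨hy.2, ball_subset_ball hr.2.le hy.1⟩⟩

lemma IsRarePoint.union {E F : Set X} {x : X} (hE : IsRarePoint m E x) (hF : IsRarePoint m F x) :
    IsRarePoint m (E ∪ F) x := by
  refine tendsto_of_tendsto_of_tendsto_of_le_of_le tendsto_const_nhds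
    (by simpa using hE.add hF) (fun _ => bot_le) fun r => ?_
  dsimp only
  rw [inter_union_distrib_left, ← ENNReal.add_div]
  gcongr
  exact measure_union_le _ _

lemma IsRarePoint.isDensityPoint (hm : IsReferenceMeasure m) (hd : UniformlyLocallyDoubling m)
    {E : Set X} {x : X} (h : IsRarePoint m Eᶜ x) : IsDensityPoint m E x := by
  have h1 : Tendsto (fun r : ℝ => 1 - m (ball x r ∩ Eᶜ) / m (ball x r)) (𝓝[>] 0) (𝓝 1) := by
    simpa using ENNReal.Tendsto.sub tendsto_const_nhds h (Or.inl ENNReal.one_ne_top)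
  refine tendsto_of_tendsto_of_tendsto_of_le_of_le' h1 tendsto_const_nhds ?_ ?_
  · filter_upwards [self_mem_nhdsWithin] with r hr
    rw [tsub_le_iff_right, ← ENNReal.add_div,
      ENNReal.le_div_iff_mul_le (Or.inl (measure_ball_pos hm hd x hr).ne')
        (Or.inl (hm.measure_ball_lt_top x r).ne), one_mul]
    exact measure_le_inter_add_sdiff m _ E
  · exact Eventually.of_forall fun r =>
      ENNReal.div_le_of_le_mul (by simpa using measure_mono inter_subset_left)

lemma IsDensityPoint.isRarePoint (hm : IsReferenceMeasure m) (hd : UniformlyLocallyDoubling m)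
    {E : Set X} {x : X} (hE : NullMeasurableSet E m)
    (h : IsDensityPoint m E x) : IsRarePoint m Eᶜ x := by
  have h1 : Tendsto (fun r : ℝ => 1 - m (ball x r ∩ E) / m (ball x r)) (𝓝[>] 0) (𝓝 0) := by
    simpa using ENNReal.Tendsto.sub tendsto_const_nhds h (Or.inl ENNReal.one_ne_top)
  refine h1.congr' ?_
  filter_upwards [self_mem_nhdsWithin] with r hr
  have hB := (hm.measure_ball_lt_top x r).ne
  have hB0 := (measure_ball_pos hm hd x hr).ne'
  have hI : m (ball x r ∩ E) ≠ ∞ := measure_ne_top_of_subset inter_subset_left hB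
  have h2 := measure_inter_add_sdiff₀ (ball x r) hE
  rw [sdiff_eq] at h2
  have h3 : m (ball x r ∩ E) / m (ball x r) + m (ball x r ∩ Eᶜ) / m (ball x r) = 1 := by
    rw [← ENNReal.add_div, h2, ENNReal.div_self hB0 hB]
  rw [← h3, ENNReal.add_sub_cancel_left]
  exact ENNReal.div_ne_top hI hB0

/-- Smallness of a monotone set function relative to `m` passes from closed balls to open balls. -/
lemma tendsto_div_measure_ball_of_closedBall (hm : IsReferenceMeasure m)
    (hd : UniformlyLocallyDoubling m) {G : Set X → ℝ≥0∞} (hG : Monotone G) {x : X}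
    (h : Tendsto (fun r : ℝ => G (closedBall x r) / m (closedBall x r)) (𝓝[>] 0) (𝓝 0)) :
    Tendsto (fun r : ℝ => G (ball x r) / m (ball x r)) (𝓝[>] 0) (𝓝 0) := by
  obtain ⟨C, -, hC⟩ := hd.exists_measure_ball_mul_le 2 1
  have h1 : Tendsto (fun r : ℝ => C * (G (closedBall x r) / m (closedBall x r))) (𝓝[>] 0)
      (𝓝 0) := by
    simpa using ENNReal.Tendsto.const_mul h (Or.inr ENNReal.coe_ne_top) (a := (C : ℝ≥0∞))
  refine tendsto_of_tendsto_of_tendsto_of_le_of_le' tendsto_const_nhds h1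
    (Eventually.of_forall fun _ => bot_le) ?_
  filter_upwards [Ioo_mem_nhdsGT (zero_lt_one' ℝ)] with r hr
  have h2 : m (closedBall x r) ≤ C * m (ball x r) :=
    (measure_mono (closedBall_subset_ball (by linarith [hr.1]))).trans (hC x r hr.1 hr.2)
  have hpos := (measure_ball_pos hm hd x hr.1)
  have hpos' : 0 < m (closedBall x r) := hpos.trans_le (measure_mono ball_subset_closedBall)
  have hfin : m (closedBall x r) ≠ ∞ := (hm.finite_of_isBounded _ isBounded_closedBall).ne
  refine ENNReal.div_le_of_le_mul ?_
  calc G (ball x r) ≤ G (closedBall x r) := hG ball_subset_closedBall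
    _ = G (closedBall x r) / m (closedBall x r) * m (closedBall x r) :=
        (ENNReal.div_mul_cancel hpos'.ne' hfin).symm
    _ ≤ G (closedBall x r) / m (closedBall x r) * (C * m (ball x r)) := by gcongr
    _ = _ := by ring

lemma tendsto_closedBall_vitaliFamily [IsUnifLocDoublingMeasure m]
    [SecondCountableTopology X] [BorelSpace X] [IsLocallyFiniteMeasure m]
    (x : X) : Tendsto (fun r : ℝ => closedBall x r) (𝓝[>] 0)
      ((IsUnifLocDoublingMeasure.vitaliFamily m 1).filterAt x) := by
  refine IsUnifLocDoublingMeasure.tendsto_closedBall_filterAt m (fun _ => x) id tendsto_id ?_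
  filter_upwards [self_mem_nhdsWithin] with r hr
  exact mem_closedBall_self (by simpa using le_of_lt hr)

variable [BorelSpace X] [SecondCountableTopology X]

/-- Lebesgue differentiation theorem along open balls. -/
lemma ae_tendsto_lintegral_enorm_sub_ball (hm : IsReferenceMeasure m)
    (hd : UniformlyLocallyDoubling m) {f : X → ℝ} (hf : LocallyIntegrable f m) :
    ∀ᵐ x ∂m, Tendsto (fun r : ℝ => (∫⁻ y in ball x r, ‖f y - f x‖ₑ ∂m) / m (ball x r))
      (𝓝[>] 0) (𝓝 0) := by
  have := hd.isUnifLocDoublingMeasure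
  have := hm.isLocallyFiniteMeasure
  filter_upwards [(IsUnifLocDoublingMeasure.vitaliFamily m 1).ae_tendsto_lintegral_enorm_sub_div hf]
    with x hx
  exact tendsto_div_measure_ball_of_closedBall hm hd
    (G := fun s => ∫⁻ y in s, ‖f y - f x‖ₑ ∂m) (fun s t hst => lintegral_mono_set hst)
    (hx.comp (tendsto_closedBall_vitaliFamily x))

/-- Lebesgue density theorem along open balls. -/
lemma ae_isRarePoint_compl (hm : IsReferenceMeasure m) (hd : UniformlyLocallyDoubling m)
    {E : Set X} (hE : MeasurableSet E) : ∀ᵐ x ∂m, x ∈ E → IsRarePoint m Eᶜ x := by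
  have := hd.isUnifLocDoublingMeasure
  have := hm.isLocallyFiniteMeasure
  filter_upwards [(IsUnifLocDoublingMeasure.vitaliFamily m
    1).ae_tendsto_measure_inter_div_of_measurableSet hE.compl] with x hx hxE
  have h0 : (Eᶜ.indicator (1 : X → ℝ≥0∞) x) = 0 := by simp [hxE]
  rw [h0] at hx
  have h1 := hx.comp (tendsto_closedBall_vitaliFamily x)
  have h2 := tendsto_div_measure_ball_of_closedBall hm hd (x := x)
    (G := fun s => m (Eᶜ ∩ s)) (fun s t hst => measure_mono (by gcongr)) h1
  simpa [IsRarePoint, inter_comm] using h2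

end Doubling

section Euclidean

variable {d : ℕ}

lemma isReferenceMeasure_volume :
    IsReferenceMeasure (volume : Measure (EuclideanSpace ℝ (Fin d))) :=
  ⟨NeZero.ne _, fun _ hs => hs.measure_lt_top⟩

lemma uniformlyLocallyDoubling_volume :
    UniformlyLocallyDoubling (volume : Measure (EuclideanSpace ℝ (Fin d))) := by
  intro R _
  refine ⟨2 ^ d, fun x r hr _ => ?_⟩
  rw [Measure.addHaar_ball_mul_of_pos volume x (by norm_num : (0 : ℝ) < 2) r]
  rw [← Measure.addHaar_ball_center volume x r]
  simp

end Euclidean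

/-! ### Metric differentiability of countable families of Lipschitz functions -/

section MetricDifferential

/-- On the line the increments of countably many `L`-Lipschitz functions are bounded, uniformly in
the function, by the integral of the supremum `a` of their derivatives; at a Lebesgue point of `a`
this is the stated bound. -/
lemma ae_sub_le_iSup_deriv {h : ℕ → ℝ → ℝ} {L : ℝ≥0} (hh : ∀ k, LipschitzWith L (h k)) :
    ∀ᵐ s : ℝ, ∀ η > 0, ∃ δ > 0, ∀ t : ℝ, 0 < t → t < δ → ∀ k,
      |h k (s + t) - h k s| ≤ t * ((⨆ j, |deriv (h j) s|) + η) := by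
  set a : ℝ → ℝ := fun s => ⨆ j, |deriv (h j) s| with ha
  have hbd : ∀ s j, |deriv (h j) s| ≤ L := fun s j => norm_deriv_le_of_lipschitz (hh j)
  have hbdd : ∀ s, BddAbove (range fun j => |deriv (h j) s|) := fun s =>
    ⟨L, by rintro _ ⟨j, rfl⟩; exact hbd s j⟩
  have ha0 : ∀ s, 0 ≤ a s := fun s => Real.iSup_nonneg fun j => abs_nonneg _
  have haL : ∀ s, a s ≤ L := fun s => ciSup_le (hbd s)
  have hmeas : Measurable a :=
    Measurable.iSup fun j => (measurable_deriv (h j)).abs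
  have hloc : LocallyIntegrable a := by
    refine (memLp_top_of_bound hmeas.aestronglyMeasurable L (.of_forall fun s => ?_)
      : MemLp a ∞ volume).locallyIntegrable le_top
    rw [Real.norm_eq_abs, abs_of_nonneg (ha0 s)]
    exact haL s
  have hint : ∀ x y : ℝ, IntervalIntegrable a volume x y := fun x y =>
    intervalIntegrable_iff.mpr
      ((hloc.integrableOn_isCompact isCompact_uIcc).mono_set uIoc_subset_uIcc)
  filter_upwards [LocallyIntegrable.ae_hasDerivAt_integral hloc] with s hs η hη
  have h1 := (hasDerivAt_iff_isLittleO_nhds_zero.1 (hs s)).def hη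
  obtain ⟨δ, hδ, hδ'⟩ := Metric.eventually_nhds_iff.1 h1
  refine ⟨δ, hδ, fun t ht htδ k => ?_⟩
  have h2 := hδ' (y := t) (by simpa [abs_of_pos ht] using htδ)
  simp only [intervalIntegral.integral_same, sub_zero, smul_eq_mul, Real.norm_eq_abs,
    abs_of_pos ht] at h2
  have hac : AbsolutelyContinuousOnInterval (h k) s (s + t) :=
    ((hh k).lipschitzOnWith).absolutelyContinuousOnInterval
  calc |h k (s + t) - h k s| = ‖∫ x in s..(s + t), deriv (h k) x‖ := by
        rw [hac.integral_deriv_eq_sub, Real.norm_eq_abs]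
    _ ≤ ∫ x in s..(s + t), a x :=
        intervalIntegral.norm_integral_le_of_norm_le (by linarith)
          (.of_forall fun x _ => le_ciSup (hbdd x) k) (hint _ _)
    _ ≤ t * (a s + η) := by linarith [(abs_le.1 h2).2]

variable {E : Type*} [NormedAddCommGroup E] [NormedSpace ℝ E] {f : ℕ → E → ℝ} {L : ℝ≥0}

variable [MeasurableSpace E] [BorelSpace E] [FiniteDimensional ℝ E]
  (μ : Measure E) [μ.IsAddHaarMeasure]

/-- In a fixed direction, the increments of a countable family of equi-Lipschitz functions are
almost everywhere controlled, uniformly in the family, by the supremum of the derivatives. -/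
lemma ae_sub_le_iSup_lineDeriv (hf : ∀ k, LipschitzWith L (f k)) (w : E) :
    ∀ᵐ x ∂μ, ∀ η > 0, ∃ δ > 0, ∀ t : ℝ, 0 < t → t < δ → ∀ k,
      |f k (x + t • w) - f k x| ≤ t * ((⨆ j, |lineDeriv ℝ (f j) x w|) + η) := by
  set a : E → ℝ := fun x => ⨆ j, |lineDeriv ℝ (f j) x w| with ha
  have hmeas : Measurable a :=
    Measurable.iSup fun j => (measurable_lineDeriv (hf j).continuous).abs
  -- a measurable form of the claim, with rational increments only
  set Z : Set E := ⋂ n : ℕ, ⋃ l : ℕ, ⋂ q : ℚ, ⋂ _ : (q : ℝ) ∈ Ioo (0 : ℝ) (1 / (l + 1)), ⋂ k : ℕ,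
    {x | |f k (x + (q : ℝ) • w) - f k x| ≤ q * (a x + 1 / (n + 1))} with hZ
  have hZm : MeasurableSet Z := by
    refine .iInter fun n => .iUnion fun l => .iInter fun q => .iInter fun _ => .iInter fun k => ?_
    have hc : Continuous fun x => |f k (x + (q : ℝ) • w) - f k x| := by
      have := (hf k).continuous
      fun_prop
    exact measurableSet_le hc.measurable ((hmeas.add_const _).const_mul _)
  have hLip : LipschitzWith ‖w‖₊ fun t : ℝ => t • w := by
    refine LipschitzWith.of_dist_le_mul fun s t => ?_
    rw [dist_eq_norm, dist_eq_norm, ← sub_smul, norm_smul, mul_comm, coe_nnnorm]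
  suffices H : ∀ᵐ x ∂μ, x ∈ Z by
    filter_upwards [H] with x hx η hη
    obtain ⟨n, hn⟩ := exists_nat_one_div_lt hη
    obtain ⟨l, hl⟩ := mem_iUnion.1 (mem_iInter.1 hx n)
    refine ⟨1 / (l + 1), by positivity, fun t ht htl k => ?_⟩
    have hcl : IsClosed {t : ℝ | |f k (x + t • w) - f k x| ≤ t * (a x + 1 / (n + 1))} := by
      have := (hf k).continuous
      exact isClosed_le (by fun_prop) (by fun_prop)
    have hsub : Ioo (0 : ℝ) (1 / (l + 1)) ⊆
        {t : ℝ | |f k (x + t • w) - f k x| ≤ t * (a x + 1 / (n + 1))} := by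
      refine (Rat.denseRange_cast.open_subset_closure_inter isOpen_Ioo).trans
        (closure_minimal ?_ hcl)
      rintro _ ⟨hq, q, rfl⟩
      exact mem_iInter.1 (mem_iInter.1 (mem_iInter.1 hl q) hq) k
    refine (hsub ⟨ht, htl⟩).trans ?_
    gcongr
  have A : ∀ p : E, ∀ᵐ s : ℝ, p + s • w ∈ Z := by
    intro p
    have hh : ∀ k, LipschitzWith (L * ‖w‖₊) (fun s : ℝ => f k (p + s • w)) := fun k => by
      simpa [Function.comp_def] using (hf k).comp ((LipschitzWith.const p).add hLip)
    filter_upwards [ae_sub_le_iSup_deriv hh] with s hs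
    have hder : ∀ j, deriv (fun s : ℝ => f j (p + s • w)) s = lineDeriv ℝ (f j) (p + s • w) w := by
      intro j
      rw [lineDeriv]
      have : (fun t : ℝ => f j (p + s • w + t • w)) = fun t => f j (p + (s + t) • w) := by
        ext t; rw [add_smul, add_assoc]
      rw [this, deriv_comp_const_add (f := fun s : ℝ => f j (p + s • w)), add_zero]
    simp only [hder] at hs
    refine mem_iInter.2 fun n => ?_
    obtain ⟨δ, hδ, H⟩ := hs (1 / (n + 1)) (by positivity)
    obtain ⟨l, hl⟩ := exists_nat_one_div_lt hδ
    refine mem_iUnion.2 ⟨l, mem_iInter.2 fun q => mem_iInter.2 fun hq => mem_iInter.2 fun k => ?_⟩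
    have := H q hq.1 (hq.2.trans hl) k
    simpa [add_smul, add_assoc] using this
  exact ae_mem_of_ae_add_linearMap_mem
    ((1 : ℝ →L[ℝ] ℝ).smulRight w).toLinearMap volume μ hZm (by simpa using A)

omit [MeasurableSpace E] [BorelSpace E] [FiniteDimensional ℝ E] in
lemma bddAbove_range_abs_fderiv (hf : ∀ k, LipschitzWith L (f k)) (x w : E) :
    BddAbove (range fun k => |fderiv ℝ (f k) x w|) := by
  refine ⟨L * ‖w‖, ?_⟩
  rintro _ ⟨k, rfl⟩
  exact ((fderiv ℝ (f k) x).le_opNorm w).trans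
    (by gcongr; exact norm_fderiv_le_of_lipschitz ℝ (hf k))

/-- The metric differential at `x` of the map with coordinates `f k`, seen as a map into `ℓ^∞`:
the supremum of the absolute values of the differentials of the coordinates. -/
def supFDerivSeminorm (hf : ∀ k, LipschitzWith L (f k)) (x : E) : Seminorm ℝ E :=
  Seminorm.of (fun w => ⨆ k, |fderiv ℝ (f k) x w|)
    (fun v w => ciSup_le fun k => by
      rw [map_add]
      exact (abs_add_le _ _).trans (add_le_add (le_ciSup (bddAbove_range_abs_fderiv hf x v) k)
        (le_ciSup (bddAbove_range_abs_fderiv hf x w) k)))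
    (fun c w => by
      simp only [map_smul, smul_eq_mul, abs_mul, Real.norm_eq_abs]
      rw [Real.mul_iSup_of_nonneg (abs_nonneg c)])

omit [MeasurableSpace E] [BorelSpace E] [FiniteDimensional ℝ E] in
lemma supFDerivSeminorm_le (hf : ∀ k, LipschitzWith L (f k)) (x w : E) :
    supFDerivSeminorm hf x w ≤ L * ‖w‖ :=
  ciSup_le fun k => ((fderiv ℝ (f k) x).le_opNorm w).trans
    (by gcongr; exact norm_fderiv_le_of_lipschitz ℝ (hf k))

/-- **Metric differentiability** (Kirchheim): almost everywhere, the pseudo-distance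
`⨆ k, |f k y - f k x|` is approximated to first order as `y → x` by a seminorm of `y - x`. -/
theorem ae_sup_abs_sub_approx_supFDerivSeminorm (hf : ∀ k, LipschitzWith L (f k)) :
    ∀ᵐ x ∂μ, ∀ η > 0, ∃ δ > 0, ∀ y, ‖y - x‖ < δ →
      (∀ k, |f k y - f k x| ≤ supFDerivSeminorm hf x (y - x) + η * ‖y - x‖) ∧
      ∃ k, supFDerivSeminorm hf x (y - x) - η * ‖y - x‖ ≤ |f k y - f k x| := by
  have H1 : ∀ᵐ x ∂μ, ∀ k, DifferentiableAt ℝ (f k) x :=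
    ae_all_iff.2 fun k => (hf k).ae_differentiableAt
  have H2 : ∀ᵐ x ∂μ, ∀ n : ℕ, ∀ η > 0, ∃ δ > 0, ∀ t : ℝ, 0 < t → t < δ → ∀ k,
      |f k (x + t • TopologicalSpace.denseSeq E n) - f k x|
        ≤ t * ((⨆ j, |lineDeriv ℝ (f j) x (TopologicalSpace.denseSeq E n)|) + η) :=
    ae_all_iff.2 fun n => ae_sub_le_iSup_lineDeriv μ hf _
  filter_upwards [H1, H2] with x hx1 hx2 η hη
  set ν := supFDerivSeminorm hf x with hν
  obtain ⟨δ₀, hδ₀, hLδ₀⟩ : ∃ δ₀ > 0, L * δ₀ ≤ η / 4 := by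
    refine ⟨η / (4 * (L + 1)), by positivity, ?_⟩
    rw [mul_div_assoc', div_le_div_iff₀ (by positivity) (by positivity)]
    nlinarith [L.coe_nonneg]
  -- first order control along the dense directions
  have key : ∀ n : ℕ, ∀ᶠ t in 𝓝[>] (0 : ℝ),
      (∀ k, |f k (x + t • TopologicalSpace.denseSeq E n) - f k x|
        ≤ t * (ν (TopologicalSpace.denseSeq E n) + η / 4)) ∧
      ∃ k, t * (ν (TopologicalSpace.denseSeq E n) - η / 2)
        ≤ |f k (x + t • TopologicalSpace.denseSeq E n) - f k x| := by
    intro n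
    set v := TopologicalSpace.denseSeq E n
    have e1 : (⨆ j, |lineDeriv ℝ (f j) x v|) = ν v := by
      change _ = ⨆ k, |fderiv ℝ (f k) x v|
      congr 1; ext j
      rw [(hx1 j).lineDeriv_eq_fderiv]
    obtain ⟨δ, hδ, hδ'⟩ := hx2 n (η / 4) (by positivity)
    rw [e1] at hδ'
    obtain ⟨k, hk⟩ : ∃ k, ν v - η / 4 < |fderiv ℝ (f k) x v| :=
      exists_lt_of_lt_ciSup (show ν v - η / 4 < ⨆ k, |fderiv ℝ (f k) x v| from by
        change ν v - η / 4 < ν v; linarith)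
    have e2 := (hasLineDerivAt_iff_isLittleO_nhds_zero.1 ((hx1 k).hasFDerivAt.hasLineDerivAt v)).def
      (show 0 < η / 4 by positivity)
    filter_upwards [Ioo_mem_nhdsGT hδ, nhdsWithin_le_nhds e2] with t ht ht2
    refine ⟨hδ' t ht.1 ht.2, k, ?_⟩
    simp only [smul_eq_mul, Real.norm_eq_abs, abs_of_pos ht.1] at ht2
    have h3 : |t * fderiv ℝ (f k) x v| - |f k (x + t • v) - f k x| ≤ η / 4 * t := by
      refine (abs_sub_abs_le_abs_sub _ _).trans ?_
      rw [abs_sub_comm]; exact ht2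
    rw [abs_mul, abs_of_pos ht.1] at h3
    nlinarith [ht.1]
  obtain ⟨q, q_fin, hq⟩ : ∃ q : Set ℕ, q.Finite ∧
      sphere (0 : E) 1 ⊆ ⋃ n ∈ q, ball (TopologicalSpace.denseSeq E n) δ₀ := by
    obtain ⟨q, -, hqf, hq⟩ := (isCompact_sphere (0 : E) 1).elim_finite_subcover_image
      (b := univ) (c := fun n => ball (TopologicalSpace.denseSeq E n) δ₀)
      (fun _ _ => isOpen_ball) (fun z _ => by
        obtain ⟨n, hn⟩ := (TopologicalSpace.denseRange_denseSeq E).exists_dist_lt z hδ₀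
        exact mem_biUnion (mem_univ n) hn)
    exact ⟨q, hqf, hq⟩
  obtain ⟨δ, hδ, hδ'⟩ := mem_nhdsGT_iff_exists_Ioo_subset.1
    ((Filter.eventually_all_finite q_fin).2 fun n _ => key n)
  refine ⟨δ, hδ, fun y hy => ?_⟩
  rcases eq_or_ne y x with rfl | hyx
  · simp
  set ρ := ‖y - x‖ with hρ
  have ρpos : 0 < ρ := norm_pos_iff.2 (sub_ne_zero.2 hyx)
  set w := ρ⁻¹ • (y - x) with hw
  have hyw : y = x + ρ • w := by rw [hw, smul_inv_smul₀ ρpos.ne']; abel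
  obtain ⟨n, hn, hwn⟩ : ∃ n ∈ q, dist w (TopologicalSpace.denseSeq E n) < δ₀ := by
    have : w ∈ sphere (0 : E) 1 := by
      rw [mem_sphere_zero_iff_norm, hw, norm_smul, norm_inv, norm_norm, inv_mul_cancel₀ ρpos.ne']
    simpa using hq this
  set v := TopologicalSpace.denseSeq E n
  have hνw : ν (y - x) = ρ * ν w := by
    rw [hyw, add_sub_cancel_left, map_smul_eq_mul, Real.norm_eq_abs, abs_of_pos ρpos]
  have hvw : |ν v - ν w| ≤ η / 4 := by
    refine (abs_sub_map_le_sub ν v w).trans ((supFDerivSeminorm_le hf x _).trans ?_)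
    rw [← dist_eq_norm, dist_comm]
    exact (mul_le_mul_of_nonneg_left hwn.le L.coe_nonneg).trans hLδ₀
  have hfv : ∀ k, |f k y - f k (x + ρ • v)| ≤ ρ * (η / 4) := by
    intro k
    have := (hf k).dist_le_mul y (x + ρ • v)
    rw [hyw, dist_add_left, dist_smul₀, Real.norm_eq_abs, abs_of_pos ρpos] at this
    rw [hyw]
    refine this.trans ?_
    calc (L : ℝ) * (ρ * dist w v) ≤ L * (ρ * δ₀) := by gcongr
      _ = ρ * (L * δ₀) := by ring
      _ ≤ _ := by gcongr
  obtain ⟨hA, k, hB⟩ := hδ' ⟨ρpos, hy⟩ n hn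
  have hvw' := abs_le.1 hvw
  rw [hνw]
  refine ⟨fun k => ?_, k, ?_⟩
  · have h1 : |f k y - f k x| ≤ |f k y - f k (x + ρ • v)| + |f k (x + ρ • v) - f k x| :=
      abs_sub_le _ _ _
    have := hfv k
    have := hA k
    nlinarith
  · have h1 : |f k (x + ρ • v) - f k x| ≤ |f k (x + ρ • v) - f k y| + |f k y - f k x| :=
      abs_sub_le _ _ _
    rw [abs_sub_comm _ (f k y)] at h1
    have := hfv k
    nlinarith

end MetricDifferential

/-! ### The local maximal function -/

section MaximalFunction

variable {X : Type*} [MetricSpace X] [MeasurableSpace X] {m : Measure X}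

/-- The uncentred Hardy–Littlewood maximal function over the balls of radius less than `R`.
Being uncentred makes its superlevel sets open. -/
def maximalFunction (m : Measure X) (R : ℝ) (g : X → ℝ≥0∞) (x : X) : ℝ≥0∞ :=
  ⨆ (z : X) (ρ : ℝ) (_ : ρ < R) (_ : x ∈ ball z ρ), (∫⁻ y in ball z ρ, g y ∂m) / m (ball z ρ)

lemma div_le_maximalFunction {R : ℝ} (g : X → ℝ≥0∞) {x z : X} {ρ : ℝ} (hρ : ρ < R)
    (hx : x ∈ ball z ρ) :
    (∫⁻ y in ball z ρ, g y ∂m) / m (ball z ρ) ≤ maximalFunction m R g x :=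
  le_iSup₂_of_le z ρ (le_iSup₂_of_le hρ hx le_rfl)

lemma lt_maximalFunction_iff {R : ℝ} {g : X → ℝ≥0∞} {x : X} {t : ℝ≥0∞} :
    t < maximalFunction m R g x ↔ ∃ z ρ, ρ < R ∧ x ∈ ball z ρ ∧
      t < (∫⁻ y in ball z ρ, g y ∂m) / m (ball z ρ) := by
  simp only [maximalFunction, lt_iSup_iff, exists_prop]

lemma measurable_maximalFunction [OpensMeasurableSpace X] (R : ℝ) (g : X → ℝ≥0∞) :
    Measurable (maximalFunction m R g) := by
  refine measurable_of_Ioi fun t => IsOpen.measurableSet ?_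
  have : maximalFunction m R g ⁻¹' Ioi t = ⋃ (z : X) (ρ : ℝ) (_ : ρ < R ∧
      t < (∫⁻ y in ball z ρ, g y ∂m) / m (ball z ρ)), ball z ρ := by
    ext x
    simp only [mem_preimage, mem_Ioi, lt_maximalFunction_iff, mem_iUnion, exists_prop]
    constructor
    · rintro ⟨z, ρ, h1, h2, h3⟩; exact ⟨z, ρ, ⟨h1, h3⟩, h2⟩
    · rintro ⟨z, ρ, ⟨h1, h3⟩, h2⟩; exact ⟨z, ρ, h1, h2, h3⟩
  rw [this]
  exact isOpen_iUnion fun _ => isOpen_iUnion fun _ => isOpen_iUnion fun _ => isOpen_ball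

lemma maximalFunction_congr {R : ℝ} {g h : X → ℝ≥0∞} (hgh : g =ᵐ[m] h) :
    maximalFunction m R g = maximalFunction m R h := by
  ext x
  simp only [maximalFunction, lintegral_congr_ae (ae_restrict_of_ae hgh)]

variable [OpensMeasurableSpace X] [TopologicalSpace.SeparableSpace X]

/-- The weak-type (1,1) inequality, from the Vitali covering lemma. -/
lemma exists_mul_measure_lt_maximalFunction_le (hm : IsReferenceMeasure m)
    (hd : UniformlyLocallyDoubling m) (R : ℝ) : ∃ C : ℝ≥0, ∀ (g : X → ℝ≥0∞) (t : ℝ≥0∞),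
      t * m {x | t < maximalFunction m R g x} ≤ C * ∫⁻ x, g x ∂m := by
  obtain ⟨C, -, hC⟩ := hd.exists_measure_ball_mul_le 4 R
  refine ⟨C, fun g t => ?_⟩
  set S : Set (X × ℝ) := {a | 0 < a.2 ∧ a.2 < R ∧
    t < (∫⁻ y in ball a.1 a.2, g y ∂m) / m (ball a.1 a.2)} with hS
  obtain ⟨u, huS, hdisj, hcov⟩ := Vitali.exists_disjoint_subfamily_covering_enlargement_ball S
    Prod.fst Prod.snd R (fun a ha => ha.2.1.le) 4 (by norm_num)
  have hu : u.Countable := hdisj.countable_of_isOpen (fun a _ => isOpen_ball)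
    fun a ha => nonempty_ball.2 (huS ha).1
  have hsub : {x | t < maximalFunction m R g x} ⊆ ⋃ a ∈ u, ball a.1 (4 * a.2) := by
    intro x hx
    obtain ⟨z, ρ, h1, h2, h3⟩ := lt_maximalFunction_iff.1 hx
    obtain ⟨b, hb, hsub⟩ := hcov (z, ρ) ⟨pos_of_mem_ball h2, h1, h3⟩
    exact mem_biUnion hb (hsub h2)
  have hball : ∀ a ∈ u, t * m (ball a.1 a.2) ≤ ∫⁻ y in ball a.1 a.2, g y ∂m := fun a ha => by
    have h := (huS ha).2.2.le
    rwa [ENNReal.le_div_iff_mul_le (Or.inl (measure_ball_pos hm hd _ (huS ha).1).ne')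
      (Or.inl (hm.measure_ball_lt_top _ _).ne)] at h
  calc t * m {x | t < maximalFunction m R g x}
      ≤ t * ∑' a : u, m (ball a.1.1 (4 * a.1.2)) := by
        gcongr
        exact (measure_mono hsub).trans (measure_biUnion_le m hu _)
    _ ≤ t * ∑' a : u, C * m (ball a.1.1 a.1.2) := by
        gcongr with a
        exact hC _ _ (huS a.2).1 (huS a.2).2.1
    _ = C * ∑' a : u, t * m (ball a.1.1 a.1.2) := by
        rw [ENNReal.tsum_mul_left, ENNReal.tsum_mul_left]; ring
    _ ≤ C * ∑' a : u, ∫⁻ y in ball a.1.1 a.1.2, g y ∂m := by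
        gcongr with a
        exact hball a a.2
    _ = C * ∫⁻ y in ⋃ a ∈ u, ball a.1 a.2, g y ∂m := by
        rw [lintegral_biUnion hu (fun a _ => measurableSet_ball) hdisj]
    _ ≤ C * ∫⁻ y, g y ∂m := mul_le_mul' le_rfl (setLIntegral_le_lintegral _ _)

omit [OpensMeasurableSpace X] [TopologicalSpace.SeparableSpace X] in
/-- Truncation at height `s`, by which the weak type bound is applied only to the part of `g` above
`s` when the maximal function is estimated in `L^p`. -/
lemma maximalFunction_le_add_indicator (hm : IsReferenceMeasure m)
    (hd : UniformlyLocallyDoubling m) {R : ℝ} {g : X → ℝ≥0∞} (hg : Measurable g) (s : ℝ≥0∞)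
    (x : X) :
    maximalFunction m R g x ≤ s + maximalFunction m R ({y | s < g y}.indicator g) x := by
  refine iSup₂_le fun z ρ => iSup₂_le fun hρ hx => ?_
  have hpos := measure_ball_pos hm hd z (pos_of_mem_ball hx)
  have hms : MeasurableSet {y | s < g y} := measurableSet_lt measurable_const hg
  calc (∫⁻ y in ball z ρ, g y ∂m) / m (ball z ρ)
      ≤ (∫⁻ y in ball z ρ, (s + {y | s < g y}.indicator g y) ∂m) / m (ball z ρ) := by
        gcongr with y
        by_cases hy : s < g y
        · rw [indicator_of_mem (by exact hy)]; exact le_add_self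
        · exact (not_lt.1 hy).trans le_self_add
    _ = s + (∫⁻ y in ball z ρ, {y | s < g y}.indicator g y ∂m) / m (ball z ρ) := by
        rw [lintegral_add_left measurable_const, ENNReal.add_div, lintegral_const,
          Measure.restrict_apply_univ, mul_div_assoc,
          ENNReal.div_self hpos.ne' (hm.measure_ball_lt_top _ _).ne, mul_one]
    _ ≤ _ := by gcongr; exact div_le_maximalFunction _ hρ hx

/-- The integral over the height in the layer cake formula for the `L^p` bound; it converges at `0`
because `1 < p`. -/
lemma lintegral_indicator_rpow_le {p : ℝ} (hp : 1 < p) (a : ℝ≥0∞) :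
    ∫⁻ t in Ioi (0 : ℝ), {t : ℝ | ENNReal.ofReal t < a}.indicator
      (fun t => ENNReal.ofReal (t ^ (p - 2))) t ≤ a ^ (p - 1) / ENNReal.ofReal (p - 1) := by
  rcases eq_or_ne a ∞ with rfl | ha
  · rw [ENNReal.top_rpow_of_pos (by linarith), ENNReal.top_div_of_ne_top ENNReal.ofReal_ne_top]
    exact le_top
  lift a to ℝ≥0 using ha
  have hms : MeasurableSet {t : ℝ | ENNReal.ofReal t < a} :=
    measurableSet_lt ENNReal.measurable_ofReal measurable_const
  rw [lintegral_indicator hms, Measure.restrict_restrict hms]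
  have hset : {t : ℝ | ENNReal.ofReal t < a} ∩ Ioi 0 ⊆ Ioc 0 (a : ℝ) := by
    rintro t ⟨ht, ht0⟩
    refine ⟨ht0, ?_⟩
    have := (ENNReal.ofReal_lt_iff_lt_toReal (le_of_lt ht0) ENNReal.coe_ne_top).1 ht
    simpa using this.le
  refine (lintegral_mono_set hset).trans ?_
  have hint : IntervalIntegrable (fun t : ℝ => t ^ (p - 2)) volume 0 a :=
    intervalIntegral.intervalIntegrable_rpow' (by linarith)
  rw [← ofReal_integral_eq_lintegral_ofReal
    ((intervalIntegrable_iff_integrableOn_Ioc_of_le a.coe_nonneg).1 hint)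
    ((ae_restrict_iff' measurableSet_Ioc).2 (.of_forall fun t ht => Real.rpow_nonneg ht.1.le _)),
    ← intervalIntegral.integral_of_le a.coe_nonneg, integral_rpow (Or.inl (by linarith)),
    show p - 2 + 1 = p - 1 by ring, Real.zero_rpow (by linarith), sub_zero,
    ENNReal.ofReal_div_of_pos (by linarith), ← ENNReal.ofReal_rpow_of_nonneg a.coe_nonneg
      (by linarith), ENNReal.ofReal_coe_nnreal]

/-- The strong-type (p,p) inequality for the local maximal function. -/
theorem exists_lintegral_maximalFunction_rpow_le (hm : IsReferenceMeasure m)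
    (hd : UniformlyLocallyDoubling m) {p : ℝ} (hp : 1 < p) (R : ℝ) :
    ∃ C : ℝ≥0, ∀ g : X → ℝ≥0∞, AEMeasurable g m →
      ∫⁻ x, maximalFunction m R g x ^ p ∂m ≤ C * ∫⁻ x, g x ^ p ∂m := by
  obtain ⟨C, hC⟩ := exists_mul_measure_lt_maximalFunction_le hm hd R
  have : IsLocallyFiniteMeasure m := hm.isLocallyFiniteMeasure
  have : SecondCountableTopology X := UniformSpace.secondCountable_of_separable X
  set D : ℝ≥0∞ := ENNReal.ofReal p * (2 * C * (2 ^ (p - 1) / ENNReal.ofReal (p - 1))) with hD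
  have hDtop : D ≠ ∞ := by
    refine ENNReal.mul_ne_top ENNReal.ofReal_ne_top (ENNReal.mul_ne_top
      (ENNReal.mul_ne_top (by norm_num) ENNReal.coe_ne_top) (ENNReal.div_ne_top
        (ENNReal.rpow_ne_top_of_nonneg (by linarith) (by norm_num)) ?_))
    simpa using hp
  refine ⟨D.toNNReal, fun g hg => ?_⟩
  rw [ENNReal.coe_toNNReal hDtop]
  wlog hgm : Measurable g generalizing g
  · have h := this (hg.mk g) hg.measurable_mk.aemeasurable hg.measurable_mk
    have h2 : ∫⁻ x, g x ^ p ∂m = ∫⁻ x, hg.mk g x ^ p ∂m :=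
      lintegral_congr_ae (hg.ae_eq_mk.mono fun x hx => by simp only [hx])
    rwa [← maximalFunction_congr hg.ae_eq_mk, ← h2] at h
  set M := maximalFunction m R g with hM
  have hMm : Measurable M := measurable_maximalFunction R g
  -- weak-type bound for the part of `g` above `t / 2`
  have hweak : ∀ t : ℝ, 0 < t → m {x | ENNReal.ofReal t < M x} * ENNReal.ofReal (t ^ (p - 1)) ≤
      2 * C * ∫⁻ x, g x * {t : ℝ | ENNReal.ofReal t < 2 * g x}.indicator
        (fun t => ENNReal.ofReal (t ^ (p - 2))) t ∂m := by
    intro t ht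
    set s : ℝ≥0∞ := ENNReal.ofReal (t / 2) with hs
    have hts : ENNReal.ofReal t = s + s := by
      rw [hs, ← ENNReal.ofReal_add (by positivity) (by positivity)]; ring_nf
    have hsub : {x | ENNReal.ofReal t < M x} ⊆
        {x | s < maximalFunction m R ({y | s < g y}.indicator g) x} := by
      intro x hx
      have h1 := lt_of_lt_of_le hx (maximalFunction_le_add_indicator hm hd hgm s x)
      rw [hts] at h1
      exact lt_of_add_lt_add_left h1
    have h2 : ENNReal.ofReal (t ^ (p - 1)) = 2 * s * ENNReal.ofReal (t ^ (p - 2)) := by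
      rw [two_mul, ← hts, ← ENNReal.ofReal_mul ht.le]
      congr 1
      rw [show p - 1 = 1 + (p - 2) by ring, Real.rpow_add ht, Real.rpow_one]
    calc m {x | ENNReal.ofReal t < M x} * ENNReal.ofReal (t ^ (p - 1))
        ≤ m {x | s < maximalFunction m R ({y | s < g y}.indicator g) x} *
          (2 * s * ENNReal.ofReal (t ^ (p - 2))) := by
          rw [h2]; gcongr
      _ = 2 * (s * m {x | s < maximalFunction m R ({y | s < g y}.indicator g) x}) *
          ENNReal.ofReal (t ^ (p - 2)) := by ring
      _ ≤ 2 * (C * ∫⁻ x, {y | s < g y}.indicator g x ∂m) * ENNReal.ofReal (t ^ (p - 2)) := by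
          refine mul_le_mul' (mul_le_mul' le_rfl ?_) le_rfl
          exact hC _ _
      _ = 2 * C * ∫⁻ x, {y | s < g y}.indicator g x * ENNReal.ofReal (t ^ (p - 2)) ∂m := by
          rw [lintegral_mul_const _ (hgm.indicator (measurableSet_lt measurable_const hgm))]
          ring
      _ = _ := by
          congr 2; ext x
          have hiff : s < g x ↔ ENNReal.ofReal t < 2 * g x := by
            rw [hts, ← two_mul]
            exact (ENNReal.mul_lt_mul_iff_right (by norm_num) (by norm_num)).symm
          by_cases hx : s < g x
          · rw [indicator_of_mem (by exact hx), indicator_of_mem (by exact hiff.1 hx)]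
          · rw [indicator_of_notMem (by exact hx),
              indicator_of_notMem (by exact fun h => hx (hiff.2 h))]
            simp
  have hjoint : Measurable (Function.uncurry fun (t : ℝ) (x : X) => g x *
      {t : ℝ | ENNReal.ofReal t < 2 * g x}.indicator
        (fun t => ENNReal.ofReal (t ^ (p - 2))) t) := by
    refine (hgm.comp measurable_snd).mul ?_
    have hms : MeasurableSet {z : ℝ × X | ENNReal.ofReal z.1 < 2 * g z.2} :=
      measurableSet_lt (ENNReal.measurable_ofReal.comp measurable_fst)
        ((hgm.comp measurable_snd).const_mul 2)
    have : Measurable fun z : ℝ × X => ENNReal.ofReal (z.1 ^ (p - 2)) :=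
      ENNReal.measurable_ofReal.comp (measurable_fst.pow_const _)
    exact this.indicator hms
  have hlayer : ENNReal.ofReal p *
      ∫⁻ t in Ioi (0 : ℝ), m {x | ENNReal.ofReal t < M x} * ENNReal.ofReal (t ^ (p - 1)) ≤
      D * ∫⁻ x, g x ^ p ∂m := by
    calc ENNReal.ofReal p *
          ∫⁻ t in Ioi (0 : ℝ), m {x | ENNReal.ofReal t < M x} * ENNReal.ofReal (t ^ (p - 1))
        ≤ ENNReal.ofReal p * ∫⁻ t in Ioi (0 : ℝ), 2 * C * ∫⁻ x, g x *
            {t : ℝ | ENNReal.ofReal t < 2 * g x}.indicator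
              (fun t => ENNReal.ofReal (t ^ (p - 2))) t ∂m := by
          refine mul_le_mul' le_rfl ?_
          exact setLIntegral_mono' measurableSet_Ioi fun t ht => hweak t ht
      _ = ENNReal.ofReal p * (2 * C * ∫⁻ x, (∫⁻ t in Ioi (0 : ℝ), g x *
            {t : ℝ | ENNReal.ofReal t < 2 * g x}.indicator
              (fun t => ENNReal.ofReal (t ^ (p - 2))) t) ∂m) := by
          rw [lintegral_const_mul' _ _ (ENNReal.mul_ne_top (by norm_num) ENNReal.coe_ne_top),
            lintegral_lintegral_swap hjoint.aemeasurable]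
      _ ≤ ENNReal.ofReal p *
          (2 * C * ∫⁻ x, (2 ^ (p - 1) / ENNReal.ofReal (p - 1)) * g x ^ p ∂m) := by
          refine mul_le_mul' le_rfl (mul_le_mul' le_rfl (lintegral_mono fun x => ?_))
          have hmx : Measurable fun t : ℝ => {t : ℝ | ENNReal.ofReal t < 2 * g x}.indicator
              (fun t => ENNReal.ofReal (t ^ (p - 2))) t :=
            (ENNReal.measurable_ofReal.comp (measurable_id.pow_const _)).indicator
              (measurableSet_lt ENNReal.measurable_ofReal measurable_const)
          rw [lintegral_const_mul _ hmx]
          calc g x * _ ≤ g x * ((2 * g x) ^ (p - 1) / ENNReal.ofReal (p - 1)) := by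
                gcongr; exact lintegral_indicator_rpow_le hp _
            _ = (2 ^ (p - 1) / ENNReal.ofReal (p - 1)) * (g x ^ (1 : ℝ) * g x ^ (p - 1)) := by
                rw [ENNReal.mul_rpow_of_nonneg _ _ (by linarith), ENNReal.rpow_one]
                simp only [div_eq_mul_inv]; ring
            _ = _ := by
                rw [← ENNReal.rpow_add_of_nonneg _ _ (by norm_num) (by linarith)]
                congr 2; ring
      _ = D * ∫⁻ x, g x ^ p ∂m := by
          rw [lintegral_const_mul _ (hgm.pow_const p), hD]; ring
  -- layer cake for the truncations of `M`
  have htrunc : ∀ N : ℕ, ∫⁻ x, min (M x) N ^ p ∂m ≤ D * ∫⁻ x, g x ^ p ∂m := by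
    intro N
    have hfin : ∀ x, min (M x) N ≠ ∞ := fun x => ((min_le_right _ _).trans_lt (by simp)).ne
    have h1 := lintegral_rpow_eq_lintegral_meas_lt_mul m (f := fun x => (min (M x) N).toReal)
      (.of_forall fun x => ENNReal.toReal_nonneg)
      (hMm.min measurable_const).ennreal_toReal.aemeasurable (zero_lt_one.trans hp)
    have h2 : ∀ x, ENNReal.ofReal ((min (M x) N).toReal ^ p) = min (M x) N ^ p := fun x => by
      rw [← ENNReal.ofReal_rpow_of_nonneg ENNReal.toReal_nonneg (by linarith),
        ENNReal.ofReal_toReal (hfin x)]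
    simp only [h2] at h1
    rw [h1]
    refine le_trans ?_ hlayer
    refine mul_le_mul' le_rfl ?_
    refine setLIntegral_mono' measurableSet_Ioi fun t ht => ?_
    refine mul_le_mul' (measure_mono fun x hx => ?_) le_rfl
    exact lt_of_lt_of_le ((ENNReal.ofReal_lt_iff_lt_toReal (le_of_lt ht) (hfin x)).2 hx)
      (min_le_left _ _)
  have hsup : ∀ x, M x ^ p = ⨆ N : ℕ, min (M x) N ^ p := by
    intro x
    have hmono : Monotone fun N : ℕ => min (M x) N ^ p := fun a b hab => by
      dsimp only; gcongr
    refine (tendsto_nhds_unique (tendsto_atTop_iSup hmono) ?_).symm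
    have : Tendsto (fun N : ℕ => min (M x) N) atTop (𝓝 (min (M x) ∞)) :=
      tendsto_const_nhds.min ENNReal.tendsto_nat_nhds_top
    rw [min_eq_left le_top] at this
    exact (ENNReal.continuous_rpow_const.tendsto _).comp this
  simp only [hsup]
  rw [lintegral_iSup (fun N => (hMm.min measurable_const).pow_const p)
    (fun a b hab x => by dsimp only; gcongr)]
  exact iSup_le htrunc

end MaximalFunction

/-! ### Poincaré inequality and pointwise estimates for Lipschitz functions -/

section Telescoping

lemma enorm_setAverage_sub_le {X : Type*} [MeasurableSpace X] {m : Measure X} {B : Set X}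
    (hB0 : m B ≠ 0) (hB : m B ≠ ∞) {f : X → ℝ}
    (hf : IntegrableOn f B m) (c : ℝ) :
    ‖(⨍ z in B, f z ∂m) - c‖ₑ ≤ (∫⁻ z in B, ‖f z - c‖ₑ ∂m) / m B := by
  have : NeZero (m.restrict B) := ⟨by simpa [Measure.restrict_eq_zero] using hB0⟩
  have : IsFiniteMeasure (m.restrict B) := ⟨by simpa using hB.lt_top⟩
  have h1 : (⨍ z in B, f z ∂m) - c = ⨍ z in B, (f z - c) ∂m := by
    rw [setAverage_eq, setAverage_eq, integral_sub hf (integrable_const _), smul_sub,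
      integral_const, smul_smul]
    simp only [measureReal_restrict_apply_univ, smul_eq_mul]
    rw [inv_mul_cancel₀ (by simp [measureReal_def, ENNReal.toReal_eq_zero_iff, hB0, hB]), one_mul]
  rw [h1, ← setLAverage_eq]
  exact enorm_integral_le_lintegral_enorm _

variable {X : Type*} [MetricSpace X] [MeasurableSpace X] {m : Measure X}

lemma maximalFunction_const_mul_le {R : ℝ} (g : X → ℝ≥0∞) (c : ℝ≥0) (x : X) :
    maximalFunction m R (fun y => c * g y) x ≤ c * maximalFunction m R g x := by
  refine iSup₂_le fun z ρ => iSup₂_le fun hρ hx => ?_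
  rw [lintegral_const_mul' _ _ ENNReal.coe_ne_top, mul_div_assoc]
  exact mul_le_mul' le_rfl (div_le_maximalFunction g hρ hx)

variable [OpensMeasurableSpace X]

lemma integrableOn_ball_of_lipschitzWith (hm : IsReferenceMeasure m) {f : X → ℝ} {K : ℝ≥0}
    (hf : LipschitzWith K f) (x : X) (r : ℝ) : IntegrableOn f (ball x r) m := by
  refine Measure.integrableOn_of_bounded (M := ‖f x‖ + K * r) (hm.measure_ball_lt_top x r).ne
    hf.continuous.aestronglyMeasurable ?_
  refine (ae_restrict_iff' measurableSet_ball).2 (.of_forall fun y hy => ?_)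
  have h1 := hf.dist_le_mul y x
  have h2 : K * dist y x ≤ K * r := by gcongr; exact (mem_ball.1 hy).le
  rw [dist_eq_norm] at h1
  linarith [norm_sub_norm_le (f y) (f x)]

/-- Telescoping the Poincaré inequality along concentric balls of dyadic radii bounds the
increments of a Lipschitz function by the maximal function of its local Lipschitz constant. -/
lemma exists_edist_le_maximalFunction (hm : IsReferenceMeasure m)
    (hd : UniformlyLocallyDoubling m) (hpoinc : SupportsPoincare m) :
    ∃ (C : ℝ≥0) (R : ℝ), ∀ (f : X → ℝ) (K : ℝ≥0), LipschitzWith K f →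
      ∀ g : X → ℝ≥0∞, (∀ x, localLip f x ≤ g x) → ∀ x y, dist x y < 1 / 4 →
        edist (f x) (f y) ≤
          C * edist x y * (maximalFunction m R g x + maximalFunction m R g y) := by
  obtain ⟨C, lam, hC, hlam, hP⟩ := hpoinc 1 one_pos
  obtain ⟨D, hD1, hD⟩ := hd.exists_measure_ball_mul_le 4 1
  refine ⟨6 * D * C.toNNReal, lam, fun f K hf g hg x y hxy => ?_⟩
  set A : X → ℝ → ℝ := fun x r => ⨍ z in ball x r, f z ∂m with hA
  set M := maximalFunction m lam g with hM
  set c : ℝ≥0 := C.toNNReal with hc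
  have hPM : ∀ x r, 0 < r → r < 1 →
      (∫⁻ z in ball x r, ‖f z - A x r‖ₑ ∂m) / m (ball x r) ≤ c * ENNReal.ofReal r * M x := by
    intro x r hr hr1
    rw [← setLAverage_eq]
    refine (hP f K hf x r hr hr1).trans ?_
    rw [ENNReal.ofReal_mul hC.le, setLAverage_eq]
    refine mul_le_mul' le_rfl (le_trans ?_ (div_le_maximalFunction g (z := x) (ρ := lam * r)
      (by nlinarith) (mem_ball_self (by positivity))))
    gcongr with z
    exact hg z
  -- comparison of the averages over nested comparable balls
  have hstep : ∀ x r x' r', 0 < r → r < 1 → 0 < r' → ball x' r' ⊆ ball x r →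
      m (ball x r) ≤ D * m (ball x' r') →
      edist (A x' r') (A x r) ≤ D * (c * ENNReal.ofReal r * M x) := by
    intro x r x' r' hr hr1 hr' hsub hmeas
    have hpos := measure_ball_pos hm hd x' hr'
    have hpos2 := measure_ball_pos hm hd x hr
    rw [edist_eq_enorm_sub]
    refine (enorm_setAverage_sub_le hpos.ne' (hm.measure_ball_lt_top _ _).ne
      (integrableOn_ball_of_lipschitzWith hm hf x' r') (A x r)).trans ?_
    refine le_trans ?_ (mul_le_mul' le_rfl (hPM x r hr hr1))
    refine ENNReal.div_le_of_le_mul ?_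
    set I := ∫⁻ z in ball x r, ‖f z - A x r‖ₑ ∂m
    calc ∫⁻ z in ball x' r', ‖f z - A x r‖ₑ ∂m ≤ I := lintegral_mono_set hsub
      _ = I / m (ball x r) * m (ball x r) :=
          (ENNReal.div_mul_cancel hpos2.ne' (hm.measure_ball_lt_top _ _).ne).symm
      _ ≤ I / m (ball x r) * (D * m (ball x' r')) := by gcongr
      _ = _ := by ring
  have hcenter : ∀ x r, 0 < r → r < 1 →
      edist (A x r) (f x) ≤ 2 * D * (c * ENNReal.ofReal r * M x) := by
    intro x r hr hr1
    have hri : ∀ i : ℕ, 0 < r * 2⁻¹ ^ i := fun i => by positivity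
    have hri1 : ∀ i : ℕ, r * 2⁻¹ ^ i < 1 := fun i =>
      (mul_le_of_le_one_right hr.le (pow_le_one₀ (by norm_num) (by norm_num))).trans_lt hr1
    have h1 : ∀ i : ℕ, edist (A x (r * 2⁻¹ ^ i)) (A x (r * 2⁻¹ ^ (i + 1))) ≤
        D * (c * ENNReal.ofReal r * M x) * 2⁻¹ ^ i := by
      intro i
      rw [edist_comm]
      refine (hstep x (r * 2⁻¹ ^ i) x (r * 2⁻¹ ^ (i + 1)) (hri i) (hri1 i) (hri _)
        (ball_subset_ball ?_) ?_).trans (le_of_eq ?_)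
      · rw [pow_succ, ← mul_assoc]; linarith [hri i]
      · refine le_trans (measure_mono (ball_subset_ball ?_)) (hD x _ (hri (i + 1)) (hri1 (i + 1)))
        rw [pow_succ, ← mul_assoc]; linarith [hri i]
      · rw [ENNReal.ofReal_mul hr.le, ENNReal.ofReal_pow (by norm_num),
          ENNReal.ofReal_inv_of_pos (by norm_num), ENNReal.ofReal_ofNat]
        ring
    have hpow : Tendsto (fun i : ℕ => r * (2⁻¹ : ℝ) ^ i) atTop (𝓝 0) := by
      simpa using (tendsto_pow_atTop_nhds_zero_of_lt_one (r := (2⁻¹ : ℝ)) (by norm_num)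
        (by norm_num)).const_mul r
    have h2 : Tendsto (fun i : ℕ => A x (r * 2⁻¹ ^ i)) atTop (𝓝 (f x)) := by
      rw [tendsto_iff_edist_tendsto_0]
      have h3 : Tendsto (fun i : ℕ => (K : ℝ≥0∞) * ENNReal.ofReal (r * 2⁻¹ ^ i)) atTop (𝓝 0) := by
        have := ENNReal.Tendsto.const_mul (ENNReal.tendsto_ofReal hpow) (a := (K : ℝ≥0∞))
          (Or.inr ENNReal.coe_ne_top)
        simpa using this
      refine tendsto_of_tendsto_of_tendsto_of_le_of_le tendsto_const_nhds h3 (fun _ => bot_le)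
        fun i => ?_
      have hpos := measure_ball_pos hm hd x (hri i)
      dsimp only
      rw [edist_eq_enorm_sub]
      refine (enorm_setAverage_sub_le hpos.ne' (hm.measure_ball_lt_top _ _).ne
        (integrableOn_ball_of_lipschitzWith hm hf _ _) (f x)).trans ?_
      refine ENNReal.div_le_of_le_mul ?_
      rw [← setLIntegral_const]
      refine setLIntegral_mono measurable_const fun z hz => ?_
      rw [← edist_eq_enorm_sub]
      refine (hf z x).trans ?_
      rw [edist_dist]
      gcongr
      exact (mem_ball.1 hz).le
    have h4 := edist_le_tsum_of_edist_le_of_tendsto₀ _ h1 h2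
    simp only [pow_zero, mul_one] at h4
    refine h4.trans (le_of_eq ?_)
    rw [ENNReal.tsum_mul_left, ENNReal.tsum_geometric, ENNReal.one_sub_inv_two, inv_inv]
    ring
  rcases eq_or_ne x y with rfl | hne
  · simp
  set r := dist x y with hr
  have hrpos : 0 < r := dist_pos.2 hne
  have e1 := hcenter x (2 * r) (by positivity) (by linarith)
  have e2 := hcenter y r hrpos (by linarith)
  have e3 := hstep x (2 * r) y r (by positivity) (by linarith) hrpos
    (ball_subset_ball' (by rw [dist_comm y x, ← hr]; linarith)) (le_trans (measure_mono
      (ball_subset_ball' (by rw [← hr]; linarith))) (hD y r hrpos (by linarith)))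
  have h2r : ENNReal.ofReal (2 * r) = 2 * ENNReal.ofReal r := by
    rw [ENNReal.ofReal_mul (by norm_num), ENNReal.ofReal_ofNat]
  rw [h2r] at e1 e3
  rw [edist_dist x y, ← hr]
  calc edist (f x) (f y) ≤ edist (f x) (A x (2 * r)) + edist (A x (2 * r)) (A y r) +
        edist (A y r) (f y) := edist_triangle4 _ _ _ _
    _ ≤ 2 * D * (c * (2 * ENNReal.ofReal r) * M x) + D * (c * (2 * ENNReal.ofReal r) * M x) +
        2 * D * (c * ENNReal.ofReal r * M y) := by
        rw [edist_comm (f x), edist_comm (A x (2 * r)) (A y r)]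
        exact add_le_add (add_le_add e1 e3) e2
    _ = (6 * D * c : ℝ≥0∞) * ENNReal.ofReal r * M x +
        (2 * D * c : ℝ≥0∞) * ENNReal.ofReal r * M y := by ring
    _ ≤ (6 * D * c : ℝ≥0∞) * ENNReal.ofReal r * M x +
        (6 * D * c : ℝ≥0∞) * ENNReal.ofReal r * M y := by
        gcongr; norm_num
    _ = _ := by push_cast; ring

end Telescoping

/-! ### Regularisation at a positive scale -/

section Cutoff

variable {X : Type*} [MetricSpace X]

/-- The cutoff `y ↦ cutoff r x y`, equal to `1` on `B_r(x)` and to `0` off `B_{2r}(x)`. -/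
def cutoff (r : ℝ) (x y : X) : ℝ := max 0 (min 1 (2 - dist y x / r))

lemma cutoff_nonneg (r : ℝ) (x y : X) : 0 ≤ cutoff r x y := le_max_left _ _

lemma cutoff_le_one (r : ℝ) (x y : X) : cutoff r x y ≤ 1 :=
  max_le zero_le_one (min_le_left _ _)

lemma cutoff_eq_one {r : ℝ} (hr : 0 < r) {x y : X} (h : y ∈ ball x r) : cutoff r x y = 1 := by
  have : dist y x / r ≤ 1 := (div_le_one hr).2 (mem_ball.1 h).le
  rw [cutoff, min_eq_left (by linarith), max_eq_right zero_le_one]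

lemma cutoff_eq_zero {r : ℝ} (hr : 0 < r) {x y : X} (h : y ∉ ball x (2 * r)) :
    cutoff r x y = 0 := by
  have : 2 ≤ dist y x / r := (le_div_iff₀ hr).2 (by simpa using h)
  exact max_eq_left ((min_le_right _ _).trans (by linarith))

lemma abs_clip_sub_le (a b : ℝ) : |max 0 (min 1 a) - max 0 (min 1 b)| ≤ |a - b| := by
  grind

lemma abs_cutoff_sub_le {r : ℝ} (hr : 0 < r) (x x' y : X) :
    |cutoff r x' y - cutoff r x y| ≤ dist x' x / r := by
  refine (abs_clip_sub_le _ _).trans ?_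
  rw [show (2 - dist y x' / r) - (2 - dist y x / r) = (dist y x - dist y x') / r by ring,
    abs_div, abs_of_pos hr]
  gcongr
  rw [dist_comm x' x]
  rw [dist_comm y x, dist_comm y x']
  exact abs_dist_sub_le x x' y

lemma continuous_cutoff (r : ℝ) (x : X) : Continuous (cutoff r x) := by
  unfold cutoff; fun_prop

end Cutoff

section Smoothing

variable {X : Type*} [MetricSpace X] [MeasurableSpace X] {m : Measure X}
variable {Y : Type*} [MetricSpace Y]

lemma ksDensity_eq {p : ℝ} (hp : 0 < p) {s : ℝ} (hs : 0 < s) (u : X → Y) (x : X) :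
    ksDensity m p s u x =
      ((∫⁻ y in ball x s, edist (u x) (u y) ^ p ∂m) / m (ball x s)) ^ (1 / p) /
        ENNReal.ofReal s := by
  have h0 : ENNReal.ofReal s ^ p ≠ 0 := by simp [hs]
  have h1 : ENNReal.ofReal s ^ p ≠ ∞ := by simp [hp.le]
  rw [ksDensity, setLAverage_eq]
  simp only [div_eq_mul_inv _ (ENNReal.ofReal s ^ p)]
  rw [lintegral_mul_const' _ _ (ENNReal.inv_ne_top.2 h0)]
  simp only [div_eq_mul_inv, one_mul]
  rw [mul_right_comm, ENNReal.mul_rpow_of_nonneg _ _ (by positivity),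
    ENNReal.inv_rpow, ← ENNReal.rpow_mul, mul_inv_cancel₀ hp.ne', ENNReal.rpow_one]

lemma ksDensity_rpow {p : ℝ} (hp : 0 < p) (s : ℝ) (u : X → Y) (x : X) :
    ksDensity m p s u x ^ p =
      (∫⁻ y in ball x s, (edist (u x) (u y) / ENNReal.ofReal s) ^ p ∂m) / m (ball x s) := by
  rw [ksDensity, ← ENNReal.rpow_mul, one_div, inv_mul_cancel₀ hp.ne', ENNReal.rpow_one,
    setLAverage_eq]
  simp only [ENNReal.div_rpow_of_nonneg _ _ hp.le]

/-- Jensen's inequality: the mean oscillation is controlled by the density at the same scale. -/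
lemma lintegral_edist_div_le_ksDensity (hm : IsReferenceMeasure m) (hd : UniformlyLocallyDoubling m)
    {p : ℝ} (hp : 1 < p) {s : ℝ} (hs : 0 < s) {u : X → Y} (hu : AEStronglyMeasurable u m) (x : X) :
    (∫⁻ y in ball x s, edist (u x) (u y) ∂m) / m (ball x s) ≤
      ENNReal.ofReal s * ksDensity m p s u x := by
  have hp0 : 0 < p := by linarith
  have hpos := (measure_ball_pos hm hd x hs).ne'
  have hfin := (hm.measure_ball_lt_top x s).ne
  have hs0 : ENNReal.ofReal s ≠ 0 := by simpa using hs
  rw [ksDensity_eq hp0 hs, ENNReal.mul_div_cancel hs0 ENNReal.ofReal_ne_top]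
  have hmeas : AEMeasurable (fun y => edist (u x) (u y)) (m.restrict (ball x s)) :=
    (aestronglyMeasurable_const.edist hu).restrict
  have hpq := Real.HolderConjugate.conjExponent hp
  have H := ENNReal.lintegral_mul_le_Lp_mul_Lq (m.restrict (ball x s)) hpq hmeas
    (aemeasurable_const (b := (1 : ℝ≥0∞)))
  simp only [Pi.mul_apply, mul_one, ENNReal.one_rpow, lintegral_const,
    Measure.restrict_apply_univ, one_mul] at H
  refine ENNReal.div_le_of_le_mul (H.trans (le_of_eq ?_))
  have h1 : (1 : ℝ) / p.conjExponent = 1 - 1 / p := by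
    have := hpq.inv_add_inv_eq_one
    rw [one_div, one_div]; linarith
  rw [ENNReal.div_rpow_of_nonneg _ _ (by positivity), h1,
    ENNReal.rpow_sub _ _ hpos hfin, ENNReal.rpow_one]
  simp only [div_eq_mul_inv]
  ring

/-- The regularisation of `F` at scale `r`: its mean with respect to the weights `cutoff r x`. -/
def smoothing (m : Measure X) (r : ℝ) (F : X → ℝ) (x : X) : ℝ :=
  (∫ y, cutoff r x y * F y ∂m) / ∫ y, cutoff r x y ∂m

variable [OpensMeasurableSpace X]

omit [OpensMeasurableSpace X] in
lemma integrableOn_ball_of_bounded (hm : IsReferenceMeasure m) {F : X → ℝ}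
    (hF : AEStronglyMeasurable F m) {N : ℝ} (hN : ∀ y, |F y| ≤ N) (x : X) (s : ℝ) :
    IntegrableOn F (ball x s) m :=
  Measure.integrableOn_of_bounded (hm.measure_ball_lt_top x s).ne hF (.of_forall hN)

lemma smoothing_sub_eq (hm : IsReferenceMeasure m) {r : ℝ} (hr : 0 < r) {F : X → ℝ}
    (hF : AEStronglyMeasurable F m) {N : ℝ} (hN : ∀ y, |F y| ≤ N) {x x' : X} (hxx : dist x' x < r)
    (hW : 0 < ∫ y, cutoff r x' y ∂m) (c : ℝ) :
    smoothing m r F x' - c =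
      (∫ y in ball x (3 * r), cutoff r x' y * (F y - c) ∂m) / ∫ y, cutoff r x' y ∂m := by
  have hz : ∀ y, y ∉ ball x (3 * r) → cutoff r x' y = 0 := fun y hy =>
    cutoff_eq_zero hr fun h => hy (ball_subset_ball' (by linarith) h)
  have hcb : ∀ y, ‖cutoff r x' y‖ ≤ 1 := fun y => by
    rw [Real.norm_eq_abs, abs_of_nonneg (cutoff_nonneg _ _ _)]; exact cutoff_le_one _ _ _
  have hcI : IntegrableOn (cutoff r x') (ball x (3 * r)) m :=
    integrableOn_ball_of_bounded hm (continuous_cutoff r x').aestronglyMeasurable hcb x _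
  have hcF : IntegrableOn (fun y => cutoff r x' y * F y) (ball x (3 * r)) m :=
    integrableOn_ball_of_bounded hm ((continuous_cutoff r x').aestronglyMeasurable.mul hF)
      (N := N) (fun y => by
        rw [Pi.mul_apply, abs_mul]
        exact (mul_le_mul (hcb y) (hN y) (abs_nonneg _) zero_le_one).trans_eq (one_mul N)) x _
  have e1 : ∫ y, cutoff r x' y * F y ∂m = ∫ y in ball x (3 * r), cutoff r x' y * F y ∂m :=
    (setIntegral_eq_integral_of_forall_compl_eq_zero fun y hy => by simp [hz y hy]).symm
  have e2 : ∫ y, cutoff r x' y ∂m = ∫ y in ball x (3 * r), cutoff r x' y ∂m :=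
    (setIntegral_eq_integral_of_forall_compl_eq_zero fun y hy => hz y hy).symm
  rw [eq_div_iff hW.ne', smoothing, sub_mul, div_mul_cancel₀ _ hW.ne', e1, e2,
    ← integral_const_mul, ← integral_sub hcF (hcI.const_mul c)]
  congr 1; ext y; ring

/-- The two basic properties of the regularisation: its increments near `x` and its distance to
the function at `x` are controlled by the mean oscillation of the function around its value at
`x`. -/
lemma abs_smoothing_sub_le (hm : IsReferenceMeasure m) (hd : UniformlyLocallyDoubling m)
    {D : ℝ≥0} (hD : ∀ (x : X) (ρ : ℝ), 0 < ρ → ρ < 1 → m (ball x (4 * ρ)) ≤ D * m (ball x ρ))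
    {r : ℝ} (hr : 0 < r) (hr1 : r < 1) {F : X → ℝ} (hF : AEStronglyMeasurable F m) {N : ℝ}
    (hN : ∀ y, |F y| ≤ N) {x x' : X} (hxx : dist x' x < r) :
    |smoothing m r F x' - smoothing m r F x| ≤
        dist x' x / r * ((D + D ^ 2) * ⨍ y in ball x (3 * r), |F y - F x| ∂m) ∧
      |smoothing m r F x' - F x| ≤ D * ⨍ y in ball x (3 * r), |F y - F x| ∂m := by
  set B := ball x (3 * r) with hB
  set V := m.real B with hV
  set J := ∫ y in B, |F y - F x| ∂m with hJ
  set W : X → ℝ := fun z => ∫ y, cutoff r z y ∂m with hW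
  have hBfin : m B ≠ ∞ := (hm.measure_ball_lt_top _ _).ne
  have hVpos : 0 < V := ENNReal.toReal_pos (measure_ball_pos hm hd x (by positivity)).ne' hBfin
  have hcb : ∀ z y : X, ‖cutoff r z y‖ ≤ 1 := fun z y => by
    rw [Real.norm_eq_abs, abs_of_nonneg (cutoff_nonneg _ _ _)]; exact cutoff_le_one _ _ _
  have hcI : ∀ z, IntegrableOn (cutoff r z) B m := fun z =>
    integrableOn_ball_of_bounded hm (continuous_cutoff r z).aestronglyMeasurable (hcb z) x _
  have hWB : ∀ z, dist z x < r → W z = ∫ y in B, cutoff r z y ∂m := fun z hz =>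
    (setIntegral_eq_integral_of_forall_compl_eq_zero fun y hy => cutoff_eq_zero hr
      fun h => hy (ball_subset_ball' (by linarith) h)).symm
  -- the total weights are comparable to the mass of `B`
  have hVW : ∀ z, dist z x < r → V ≤ D * W z := by
    intro z hz
    have hsub : ball z r ⊆ B := ball_subset_ball' (by linarith)
    have h1 : m.real (ball z r) ≤ W z := by
      rw [hWB z hz, ← integral_indicator_one measurableSet_ball,
        ← setIntegral_eq_integral_of_forall_compl_eq_zero (s := B)
          (fun y hy => indicator_of_notMem (fun h => hy (hsub h)) _)]
      refine setIntegral_mono_on ((integrableOn_const hBfin).indicator measurableSet_ball) (hcI z)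
        measurableSet_ball fun y _ => ?_
      by_cases hy : y ∈ ball z r
      · rw [indicator_of_mem hy, cutoff_eq_one hr hy]; rfl
      · rw [indicator_of_notMem hy]; exact cutoff_nonneg _ _ _
    have h2 : m B ≤ D * m (ball z r) :=
      (measure_mono (ball_subset_ball' (by rw [dist_comm]; linarith))).trans (hD z r hr hr1)
    have h3 : V ≤ D * m.real (ball z r) := by
      have := ENNReal.toReal_mono (ENNReal.mul_ne_top ENNReal.coe_ne_top
        (hm.measure_ball_lt_top z r).ne) h2
      rwa [ENNReal.toReal_mul, ENNReal.coe_toReal] at this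
    exact h3.trans (by gcongr)
  have hWpos : ∀ z, dist z x < r → 0 < W z := fun z hz =>
    pos_of_mul_pos_right (hVpos.trans_le (hVW z hz)) D.coe_nonneg
  have hFI : IntegrableOn (fun y => F y - F x) B m :=
    (integrableOn_ball_of_bounded hm hF hN x _).sub (integrableOn_const hBfin)
  have hJ0 : 0 ≤ J := integral_nonneg fun y => abs_nonneg _
  have hcut : ∀ z, IntegrableOn (fun y => cutoff r z y * (F y - F x)) B m := fun z =>
    hFI.bdd_mul (continuous_cutoff r z).aestronglyMeasurable (.of_forall (hcb z))
  have hnum : ∀ z, |∫ y in B, cutoff r z y * (F y - F x) ∂m| ≤ J := by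
    intro z
    rw [← Real.norm_eq_abs]
    refine norm_integral_le_of_norm_le hFI.abs (.of_forall fun y => ?_)
    rw [norm_mul]
    exact mul_le_of_le_one_left (norm_nonneg _) (hcb z y)
  have hdiff : |(∫ y in B, cutoff r x' y * (F y - F x) ∂m) -
      ∫ y in B, cutoff r x y * (F y - F x) ∂m| ≤ dist x' x / r * J := by
    rw [← integral_sub (hcut x') (hcut x), hJ, ← integral_const_mul, ← Real.norm_eq_abs]
    refine norm_integral_le_of_norm_le (hFI.abs.const_mul _) (.of_forall fun y => ?_)
    rw [← sub_mul, norm_mul]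
    exact mul_le_mul_of_nonneg_right (abs_cutoff_sub_le hr x x' y) (norm_nonneg _)
  have hx : dist x x < r := by simpa using hr
  have hWdiff : |W x - W x'| ≤ dist x' x / r * V := by
    rw [hWB x' hxx, hWB x hx, ← integral_sub (hcI x) (hcI x'), ← Real.norm_eq_abs]
    refine (norm_setIntegral_le_of_norm_le_const hBfin.lt_top fun y _ => ?_)
    rw [norm_sub_rev]
    exact abs_cutoff_sub_le hr x x' y
  have havg : ⨍ y in B, |F y - F x| ∂m = J / V := by
    rw [setAverage_eq, smul_eq_mul, ← div_eq_inv_mul]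
  have e1 := smoothing_sub_eq hm hr hF hN hxx (hWpos x' hxx) (F x)
  have e2 := smoothing_sub_eq hm hr hF hN hx (hWpos x hx) (F x)
  set P := ∫ y in B, cutoff r x' y * (F y - F x) ∂m
  set Q := ∫ y in B, cutoff r x y * (F y - F x) ∂m
  have hw := hWpos x hx
  have hw' := hWpos x' hxx
  have hδ : 0 ≤ dist x' x / r := by positivity
  have hinv : ∀ z, dist z x < r → (W z)⁻¹ ≤ D / V := by
    intro z hz
    rw [inv_le_iff_one_le_mul₀ (hWpos z hz), div_mul_eq_mul_div, one_le_div hVpos]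
    exact hVW z hz
  rw [havg]
  constructor
  · have e3 : smoothing m r F x' - smoothing m r F x =
        (P - Q) * (W x')⁻¹ + Q * ((W x - W x') * ((W x)⁻¹ * (W x')⁻¹)) := by
      have : smoothing m r F x' - smoothing m r F x = P / W x' - Q / W x := by
        rw [← e1, ← e2]; ring
      rw [this]
      field_simp
      ring
    rw [e3]
    refine (abs_add_le _ _).trans ?_
    simp only [abs_mul, abs_inv, abs_of_pos hw, abs_of_pos hw']
    calc |P - Q| * (W x')⁻¹ + |Q| * (|W x - W x'| * ((W x)⁻¹ * (W x')⁻¹))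
        ≤ (dist x' x / r * J) * (D / V) +
          J * ((dist x' x / r * V) * ((D / V) * (D / V))) := by
          have h1 := hinv x' hxx
          have h2 := hinv x hx
          have h3 := hnum x
          gcongr
      _ = _ := by field_simp
  · rw [e1, abs_div, abs_of_pos hw', div_eq_mul_inv]
    calc |P| * (W x')⁻¹ ≤ J * (D / V) := by
          have h1 := hinv x' hxx
          have h3 := hnum x'
          gcongr
      _ = _ := by ring

end Smoothing

/-! ### Pointwise estimates by the densities at a positive scale -/

section Pointwise

variable {X : Type*} [MetricSpace X] [MeasurableSpace X] {m : Measure X}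
variable {Y : Type*} [MetricSpace Y] [OpensMeasurableSpace X]

omit [OpensMeasurableSpace X] in
lemma ofReal_average_abs_sub_le (hm : IsReferenceMeasure m) (hd : UniformlyLocallyDoubling m)
    {p : ℝ} (hp : 1 < p) {s : ℝ} (hs : 0 < s) {u : X → Y} (hu : AEStronglyMeasurable u m)
    {F : X → ℝ} {x : X} (hF : ∀ y, |F y - F x| ≤ dist (u x) (u y)) :
    ENNReal.ofReal (⨍ y in ball x s, |F y - F x| ∂m) ≤
      ENNReal.ofReal s * ksDensity m p s u x := by
  refine le_trans ?_ (lintegral_edist_div_le_ksDensity hm hd hp hs hu x)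
  rw [← setLAverage_eq]
  refine le_trans ?_ ((enorm_integral_le_lintegral_enorm fun y => |F y - F x|).trans (lintegral_mono
    (g :=
    fun y => edist (u x) (u y)) fun y => ?_))
  · rw [Real.enorm_eq_ofReal_abs]
    exact ENNReal.ofReal_le_ofReal (le_abs_self _)
  · dsimp only
    rw [Real.enorm_eq_ofReal_abs, abs_abs, edist_dist]
    exact ENNReal.ofReal_le_ofReal (hF y)

/-- Comparison of a map with its regularisations: the increments of `u` are bounded in terms of the
density at scale `s` and its maximal function, up to an error of order `s`. -/
lemma exists_edist_le_ksDensity (hm : IsReferenceMeasure m) (hd : UniformlyLocallyDoubling m)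
    (hpoinc : SupportsPoincare m) {p : ℝ} (hp : 1 < p) :
    ∃ (C : ℝ≥0) (R : ℝ), ∀ u : X → Y, AEStronglyMeasurable u m → ∀ s, 0 < s → s < 1 →
      ∀ x y, dist x y < 1 / 4 → edist (u x) (u y) ≤
        C * edist x y * (maximalFunction m R (ksDensity m p s u) x +
          maximalFunction m R (ksDensity m p s u) y) +
        C * ENNReal.ofReal s * (ksDensity m p s u x + ksDensity m p s u y) := by
  obtain ⟨C₀, R, hC₀⟩ := exists_edist_le_maximalFunction hm hd hpoinc
  obtain ⟨D, hD1, hD⟩ := hd.exists_measure_ball_mul_le 4 1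
  set c : ℝ≥0 := 3 * (D + D ^ 2) with hc
  refine ⟨C₀ * c + D, R, fun u hu s hs hs1 x y hxy => ?_⟩
  set g := ksDensity m p s u with hg
  set r := s / 3 with hr
  have hr0 : 0 < r := by positivity
  have h3r : 3 * r = s := by rw [hr]; ring
  set N := dist (u x) (u y) with hN
  -- the truncated distance from `u x`, which detects the distance between `u x` and `u y`
  set F : X → ℝ := fun z => min (dist (u z) (u x)) N with hF
  have hFx : F x = 0 := by simp [hF, hN]
  have hFy : F y = N := by simp [hF, hN, dist_comm]
  have hFmeas : AEStronglyMeasurable F m :=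
    ((hu.dist aestronglyMeasurable_const).inf aestronglyMeasurable_const)
  have hFN : ∀ z, |F z| ≤ N := fun z => by
    rw [abs_of_nonneg (le_min dist_nonneg dist_nonneg)]; exact min_le_right _ _
  have hFu : ∀ z z', |F z' - F z| ≤ dist (u z) (u z') := fun z z' => by
    refine (abs_inf_sub_inf_le_abs _ _ _).trans ?_
    rw [dist_comm (u z) (u z')]
    exact abs_dist_sub_le _ _ _
  set A : X → ℝ := fun z => ⨍ y in ball z s, |F y - F z| ∂m with hA
  have hA0 : ∀ z, 0 ≤ A z := fun z => integral_nonneg fun y => abs_nonneg _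
  have hAg : ∀ z, ENNReal.ofReal (A z) ≤ ENNReal.ofReal s * g z := fun z =>
    ofReal_average_abs_sub_le hm hd hp hs hu (hFu z)
  have hAN : ∀ z, A z ≤ 2 * N := by
    intro z
    have hfin := (hm.measure_ball_lt_top z s).ne
    have hpos : 0 < m.real (ball z s) :=
      ENNReal.toReal_pos (measure_ball_pos hm hd z hs).ne' hfin
    have h1 : ‖∫ y in ball z s, |F y - F z| ∂m‖ ≤ 2 * N * m.real (ball z s) := by
      refine norm_setIntegral_le_of_norm_le_const hfin.lt_top fun y _ => ?_
      rw [Real.norm_eq_abs, abs_abs, two_mul]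
      exact (abs_sub _ _).trans (add_le_add (hFN y) (hFN z))
    rw [hA]
    dsimp only
    rw [setAverage_eq, smul_eq_mul, ← div_eq_inv_mul, div_le_iff₀ hpos]
    exact (le_abs_self _).trans h1
  set S := smoothing m r F with hS
  have hS1 : ∀ z z', dist z' z < r → |S z' - S z| ≤ dist z' z / r * ((D + D ^ 2) * A z) := by
    intro z z' h
    have := (abs_smoothing_sub_le hm hd hD hr0 (by linarith) hFmeas hFN h).1
    rwa [h3r] at this
  have hS2 : ∀ z, |S z - F z| ≤ D * A z := by
    intro z
    have := (abs_smoothing_sub_le hm hd hD hr0 (by linarith) hFmeas hFN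
      (x := z) (x' := z) (by simpa using hr0)).2
    rwa [h3r] at this
  have hlip : localLip S ≤ fun z => c * g z := by
    intro z
    refine limsup_le_of_le (h := ?_)
    filter_upwards [nhdsWithin_le_nhds (ball_mem_nhds z hr0)] with z' hz'
    refine ENNReal.div_le_of_le_mul ?_
    rw [edist_dist, Real.dist_eq, edist_dist]
    refine (ENNReal.ofReal_le_ofReal (hS1 z z' hz')).trans ?_
    rw [ENNReal.ofReal_mul (by positivity), ENNReal.ofReal_mul (by positivity),
      ENNReal.ofReal_div_of_pos hr0]
    calc ENNReal.ofReal (dist z' z) / ENNReal.ofReal r *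
          (ENNReal.ofReal (D + D ^ 2) * ENNReal.ofReal (A z))
        ≤ ENNReal.ofReal (dist z' z) / ENNReal.ofReal r *
          (ENNReal.ofReal (D + D ^ 2) * (ENNReal.ofReal (3 * r) * g z)) := by
          rw [h3r]; gcongr; exact hAg z
      _ = ENNReal.ofReal (dist z' z) * (ENNReal.ofReal r / ENNReal.ofReal r) *
          (3 * ENNReal.ofReal (D + D ^ 2)) * g z := by
          rw [ENNReal.ofReal_mul (by norm_num), ENNReal.ofReal_ofNat]
          simp only [div_eq_mul_inv]; ring
      _ = c * g z * ENNReal.ofReal (dist z' z) := by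
          rw [ENNReal.div_self (by simpa using hr0) ENNReal.ofReal_ne_top, hc,
            show ((D : ℝ) + D ^ 2) = ((D + D ^ 2 : ℝ≥0) : ℝ) by push_cast; rfl,
            ENNReal.ofReal_coe_nnreal]
          push_cast; ring
  have hSb : ∀ z, |S z| ≤ (2 * D + 1) * N := by
    intro z
    have h1 := hS2 z
    have h2 : D * A z ≤ D * (2 * N) := mul_le_mul_of_nonneg_left (hAN z) D.coe_nonneg
    have h3 := hFN z
    have h4 := abs_sub_abs_le_abs_sub (S z) (F z)
    linarith
  have hN0 : 0 ≤ N := dist_nonneg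
  have hSlip : LipschitzWith (((D + D ^ 2) * (2 * N) + 2 * ((2 * D + 1) * N)) / r).toNNReal S := by
    refine LipschitzWith.of_dist_le_mul fun z' z => ?_
    rw [Real.coe_toNNReal _ (by positivity), Real.dist_eq, div_mul_eq_mul_div, le_div_iff₀ hr0]
    rcases lt_or_ge (dist z' z) r with h | h
    · have h1 := hS1 z z' h
      rw [div_mul_eq_mul_div, le_div_iff₀ hr0] at h1
      refine h1.trans ?_
      rw [mul_comm]
      gcongr
      refine le_trans ?_ (le_add_of_nonneg_right (by positivity))
      gcongr
      exact hAN z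
    · have h1 : |S z' - S z| ≤ 2 * ((2 * D + 1) * N) := by
        rw [two_mul]; exact (abs_sub _ _).trans (add_le_add (hSb z') (hSb z))
      gcongr
      refine h1.trans (le_add_of_nonneg_left (by positivity))
  have e1 := hC₀ S _ hSlip _ hlip x y hxy
  have e2 : ∀ z, edist (F z) (S z) ≤ D * ENNReal.ofReal s * g z := by
    intro z
    rw [edist_comm, edist_dist, Real.dist_eq]
    refine (ENNReal.ofReal_le_ofReal (hS2 z)).trans ?_
    rw [ENNReal.ofReal_mul D.coe_nonneg, ENNReal.ofReal_coe_nnreal, mul_assoc]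
    gcongr
    exact hAg z
  have e3 : edist (u x) (u y) = edist (F x) (F y) := by
    rw [hFx, hFy, edist_dist, edist_dist, Real.dist_eq, zero_sub, abs_neg, abs_of_nonneg hN0]
  have e4 : ∀ z, maximalFunction m R (fun z => c * g z) z ≤ c * maximalFunction m R g z :=
    fun z => maximalFunction_const_mul_le g c z
  calc edist (u x) (u y) ≤ edist (F x) (S x) + edist (S x) (S y) + edist (S y) (F y) := by
        rw [e3]; exact edist_triangle4 _ _ _ _
    _ ≤ D * ENNReal.ofReal s * g x + C₀ * edist x y *
          (c * maximalFunction m R g x + c * maximalFunction m R g y) +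
          D * ENNReal.ofReal s * g y := by
        refine add_le_add (add_le_add (e2 x) (e1.trans ?_)) ?_
        · exact mul_le_mul' le_rfl (add_le_add (e4 x) (e4 y))
        · rw [edist_comm]; exact e2 y
    _ = (C₀ * c : ℝ≥0) * edist x y * (maximalFunction m R g x + maximalFunction m R g y) +
          D * ENNReal.ofReal s * (g x + g y) := by push_cast; ring
    _ ≤ _ := by
        gcongr
        · exact le_self_add
        · exact le_add_self

end Pointwise

/-! ### A Komlós-type lemma -/

section Komlos

/-- Quantitative midpoint convexity of the bounded function `t ↦ (1 + t)⁻¹` on `[0, ∞]`. -/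
lemma toReal_inv_one_add_midpoint_le (a b : ℝ≥0∞) :
    ((1 + (a + b) / 2)⁻¹).toReal ≤ (((1 + a)⁻¹).toReal + ((1 + b)⁻¹).toReal) / 2 -
      (((1 + a)⁻¹).toReal - ((1 + b)⁻¹).toReal) ^ 2 / 4 := by
  have hle : ∀ t : ℝ≥0∞, ((1 + t)⁻¹).toReal ≤ 1 := fun t => by
    refine ENNReal.toReal_le_of_le_ofReal zero_le_one ?_
    rw [ENNReal.ofReal_one, ENNReal.inv_le_one]; exact le_self_add
  have h0 : ∀ t : ℝ≥0∞, 0 ≤ ((1 + t)⁻¹).toReal := fun t => ENNReal.toReal_nonneg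
  rcases eq_or_ne a ∞ with rfl | ha
  · simp only [top_add, add_top, ENNReal.top_div_of_ne_top ENNReal.ofNat_ne_top, ENNReal.inv_top,
      ENNReal.toReal_zero]
    nlinarith [hle b, h0 b]
  rcases eq_or_ne b ∞ with rfl | hb
  · simp only [add_top, ENNReal.top_div_of_ne_top ENNReal.ofNat_ne_top, ENNReal.inv_top,
      ENNReal.toReal_zero]
    nlinarith [hle a, h0 a]
  lift a to ℝ≥0 using ha
  lift b to ℝ≥0 using hb
  have e1 : ∀ t : ℝ≥0, ((1 + (t : ℝ≥0∞))⁻¹).toReal = (1 + (t : ℝ))⁻¹ := fun t => by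
    rw [ENNReal.toReal_inv, ENNReal.toReal_add ENNReal.one_ne_top ENNReal.coe_ne_top]; simp
  have e2 : ((a : ℝ≥0∞) + b) / 2 = (((a + b) / 2 : ℝ≥0) : ℝ≥0∞) := by
    rw [ENNReal.coe_div two_ne_zero]; push_cast; rfl
  rw [e2, e1, e1, e1]
  push_cast
  have hA : (1 : ℝ) ≤ 1 + a := by simp
  have hB : (1 : ℝ) ≤ 1 + b := by simp
  rw [show (1 : ℝ) + (a + b) / 2 = ((1 + a) + (1 + b)) / 2 by ring]
  set A : ℝ := 1 + a
  set B : ℝ := 1 + b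
  have hA0 : 0 < A := by linarith
  have hB0 : 0 < B := by linarith
  have key : (A⁻¹ + B⁻¹) / 2 - (A⁻¹ - B⁻¹) ^ 2 / 4 - ((A + B) / 2)⁻¹ =
      (A - B) ^ 2 * (2 * A * B - (A + B)) / (4 * (A * B) ^ 2 * (A + B)) := by
    field_simp; ring
  have : 0 ≤ (A - B) ^ 2 * (2 * A * B - (A + B)) / (4 * (A * B) ^ 2 * (A + B)) := by
    refine div_nonneg (mul_nonneg (sq_nonneg _) ?_) (by positivity)
    nlinarith [mul_nonneg (sub_nonneg.2 hA) hB0.le, mul_nonneg (sub_nonneg.2 hB) hA0.le]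
  linarith

/-- In a decreasing sequence of midpoint-convex sets of nonnegative functions one can choose
functions that converge almost everywhere. They are almost minimisers of the strictly convex
functional `h ↦ ∫ (1 + h)⁻¹`, whose convexity gap controls an `L²` distance. -/
lemma exists_tendsto_of_midpoint_convex {α : Type*} [MeasurableSpace α] (μ : Measure α) [SFinite μ]
    {𝒢 : ℕ → Set (α → ℝ≥0∞)} (hne : ∀ n, (𝒢 n).Nonempty) (hanti : Antitone 𝒢)
    (hmeas : ∀ n, ∀ h ∈ 𝒢 n, Measurable h)
    (hmid : ∀ n, ∀ h ∈ 𝒢 n, ∀ k ∈ 𝒢 n, (fun x => (h x + k x) / 2) ∈ 𝒢 n) :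
    ∃ (h : ℕ → α → ℝ≥0∞) (g : α → ℝ≥0∞), (∀ n, h n ∈ 𝒢 n) ∧ Measurable g ∧
      ∀ᵐ x ∂μ, Tendsto (fun n => h n x) atTop (𝓝 (g x)) := by
  set ρ := μ.toFinite with hρ
  set φ : (α → ℝ≥0∞) → α → ℝ := fun h x => ((1 + h x)⁻¹).toReal with hφ
  have hφ1 : ∀ h x, φ h x ≤ 1 := fun h x => by
    refine ENNReal.toReal_le_of_le_ofReal zero_le_one ?_
    rw [ENNReal.ofReal_one, ENNReal.inv_le_one]; exact le_self_add
  have hφ0 : ∀ h x, 0 ≤ φ h x := fun h x => ENNReal.toReal_nonneg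
  have hφm : ∀ h, Measurable h → Measurable (φ h) := fun h hh =>
    (measurable_const.add hh).inv.ennreal_toReal
  have hφL : ∀ h, Measurable h → MemLp (φ h) 2 ρ := fun h hh =>
    MemLp.of_bound (hφm h hh).aestronglyMeasurable 1 (.of_forall fun x => by
      rw [Real.norm_eq_abs, abs_of_nonneg (hφ0 h x)]; exact hφ1 h x)
  have hφI : ∀ h, Measurable h → Integrable (φ h) ρ := fun h hh =>
    (hφL h hh).integrable (by norm_num)
  set J : (α → ℝ≥0∞) → ℝ := fun h => ∫ x, φ h x ∂ρ with hJ
  have hJ0 : ∀ h, 0 ≤ J h := fun h => integral_nonneg (hφ0 h)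
  have hJ1 : ∀ h, J h ≤ ρ.real univ := fun h => by
    refine (le_abs_self _).trans ?_
    have := norm_integral_le_of_norm_le_const (μ := ρ) (f := φ h) (C := 1) (.of_forall fun x => by
      rw [Real.norm_eq_abs, abs_of_nonneg (hφ0 h x)]; exact hφ1 h x)
    simpa using this
  set I : ℕ → ℝ := fun n => sInf (J '' 𝒢 n) with hI
  have hbdd : ∀ n, BddBelow (J '' 𝒢 n) := fun n => ⟨0, by rintro _ ⟨h, -, rfl⟩; exact hJ0 h⟩
  have hImono : Monotone I := fun a b hab =>
    csInf_le_csInf (hbdd a) ((hne b).image J) (image_mono (hanti hab))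
  have hIle : ∀ n, ∀ h ∈ 𝒢 n, I n ≤ J h := fun n h hh => csInf_le (hbdd n) ⟨h, hh, rfl⟩
  have hIbdd : BddAbove (range I) := by
    refine ⟨ρ.real univ, ?_⟩
    rintro _ ⟨n, rfl⟩
    obtain ⟨h, hh⟩ := hne n
    exact (hIle n h hh).trans (hJ1 h)
  set L := ⨆ n, I n with hL
  have hIL : ∀ n, I n ≤ L := fun n => le_ciSup hIbdd n
  have hchoose : ∀ N : ℕ, ∃ (n : ℕ) (h : α → ℝ≥0∞), N ≤ n ∧ h ∈ 𝒢 n ∧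
      L - (1 / 4) ^ N / 10 < I n ∧ J h < I n + (1 / 4) ^ N / 10 := by
    intro N
    have hpos : (0 : ℝ) < (1 / 4) ^ N / 10 := by positivity
    obtain ⟨n, hn⟩ := exists_lt_of_lt_ciSup (show L - (1 / 4) ^ N / 10 < ⨆ n, I n by
      rw [← hL]; linarith)
    have hn' : L - (1 / 4) ^ N / 10 < I (max n N) := hn.trans_le (hImono (le_max_left _ _))
    obtain ⟨_, ⟨h, hh, rfl⟩, hlt⟩ := exists_lt_of_csInf_lt ((hne (max n N)).image J)
      (show sInf (J '' 𝒢 (max n N)) < I (max n N) + (1 / 4) ^ N / 10 by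
        change I (max n N) < _; linarith)
    exact ⟨max n N, h, le_max_right _ _, hh, hn', hlt⟩
  choose ν h hνN hmem hIν hJν using hchoose
  have hhm : ∀ n, Measurable (h n) := fun n => hmeas _ _ (hmem n)
  -- the convexity gap of the functional
  have hgap : ∀ N n k, N ≤ n → N ≤ k →
      ∫ x, (φ (h n) x - φ (h k) x) ^ 2 ∂ρ < (1 / 4) ^ N := by
    intro N n k hn hk
    have hpow : ∀ n, N ≤ n → ((1 : ℝ) / 4) ^ n ≤ (1 / 4) ^ N := fun n hn =>
      pow_le_pow_of_le_one (by norm_num) (by norm_num) hn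
    set q := min (ν n) (ν k)
    have h1 : h n ∈ 𝒢 q := hanti (min_le_left _ _) (hmem n)
    have h2 : h k ∈ 𝒢 q := hanti (min_le_right _ _) (hmem k)
    have h3 := hIle q _ (hmid q _ h1 _ h2)
    have hq : L - (1 / 4) ^ N / 10 < I q := by
      rcases min_choice (ν n) (ν k) with e | e
      · rw [show q = ν n from e]; linarith [hIν n, hpow n hn]
      · rw [show q = ν k from e]; linarith [hIν k, hpow k hk]
    have hsq : Integrable (fun x => (φ (h n) x - φ (h k) x) ^ 2) ρ :=
      ((hφL _ (hhm n)).sub (hφL _ (hhm k))).integrable_sq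
    have h4 : J (fun x => (h n x + h k x) / 2) ≤ (J (h n) + J (h k)) / 2 -
        (∫ x, (φ (h n) x - φ (h k) x) ^ 2 ∂ρ) / 4 := by
      have : (J (h n) + J (h k)) / 2 - (∫ x, (φ (h n) x - φ (h k) x) ^ 2 ∂ρ) / 4 =
          ∫ x, ((φ (h n) x + φ (h k) x) / 2 - (φ (h n) x - φ (h k) x) ^ 2 / 4) ∂ρ := by
        have hadd : Integrable (fun x => φ (h n) x + φ (h k) x) ρ :=
          (hφI _ (hhm n)).add (hφI _ (hhm k))
        rw [integral_sub (hadd.div_const 2) (hsq.div_const 4),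
          integral_div, integral_div, integral_add (hφI _ (hhm n)) (hφI _ (hhm k))]
      rw [this]
      exact integral_mono (hφI _ (((hhm n).add (hhm k)).div_const 2))
        ((((hφI _ (hhm n)).add (hφI _ (hhm k))).div_const 2).sub (hsq.div_const 4))
        fun x => toReal_inv_one_add_midpoint_le _ _
    have h5 := hJν n
    have h6 := hJν k
    linarith [hpow n hn, hpow k hk, hIL (ν n), hIL (ν k), show (0:ℝ) < (1/4)^N by positivity]
  have hcau : ∀ N n k, N ≤ n → N ≤ k →
      eLpNorm (φ (h n) - φ (h k)) 2 ρ < ((1 / 2) ^ N : ℝ≥0∞) := by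
    intro N n k hn hk
    have hM := (hφL _ (hhm n)).sub (hφL _ (hhm k))
    rw [hM.eLpNorm_eq_integral_rpow_norm two_ne_zero ENNReal.ofNat_ne_top]
    have h1 : ∫ x, ‖(φ (h n) - φ (h k)) x‖ ^ (2 : ℝ≥0∞).toReal ∂ρ =
        ∫ x, (φ (h n) x - φ (h k) x) ^ 2 ∂ρ := by
      congr 1; ext x
      simp
    rw [h1, show ((1 / 2) ^ N : ℝ≥0∞) = ENNReal.ofReal ((1 / 2) ^ N) by
      rw [ENNReal.ofReal_pow (by norm_num), one_div, one_div,
        ENNReal.ofReal_inv_of_pos (by norm_num), ENNReal.ofReal_ofNat],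
      ENNReal.ofReal_lt_ofReal_iff (by positivity)]
    have h2 := hgap N n k hn hk
    have h3 : ((1 : ℝ) / 4) ^ N = ((1 / 2) ^ N) ^ 2 := by
      rw [← pow_mul, mul_comm, pow_mul]; norm_num
    rw [h3] at h2
    rw [ENNReal.toReal_ofNat, ← one_div, ← Real.sqrt_eq_rpow, Real.sqrt_lt' (by positivity)]
    exact h2
  have hB : ∑' N : ℕ, ((1 / 2) ^ N : ℝ≥0∞) ≠ ∞ := by
    rw [ENNReal.tsum_geometric, one_div, ENNReal.one_sub_inv_two, inv_inv]; norm_num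
  have hae := Lp.ae_tendsto_of_cauchy_eLpNorm
    (fun n => (hφm _ (hhm n)).aestronglyMeasurable (μ := ρ)) (by norm_num) hB hcau
  have hconv : ∀ᵐ x ∂μ, ∃ l, Tendsto (fun n => h n x) atTop (𝓝 l) := by
    rw [← ae_toFinite]
    filter_upwards [hae] with x hx
    obtain ⟨l, hl⟩ := hx
    refine ⟨(ENNReal.ofReal l)⁻¹ - 1, ?_⟩
    have h1 : Tendsto (fun n => (ENNReal.ofReal (φ (h n) x))⁻¹ - 1) atTop
        (𝓝 ((ENNReal.ofReal l)⁻¹ - 1)) :=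
      ENNReal.Tendsto.sub (ENNReal.tendsto_ofReal hl).inv tendsto_const_nhds
        (Or.inr ENNReal.one_ne_top)
    refine h1.congr fun n => ?_
    rw [ENNReal.ofReal_toReal, inv_inv, ENNReal.add_sub_cancel_left ENNReal.one_ne_top]
    simp
  obtain ⟨g, hg, hgl⟩ := measurable_limit_of_tendsto_metrizable_ae
    (fun n => (hhm n).aemeasurable (μ := μ)) hconv
  exact ⟨h, g, fun n => hanti (hνN n) (hmem n), hg, hgl⟩

end Komlos

/-! ### Measurability of the densities -/

section Measurability

variable {X : Type*} [MetricSpace X] [MeasurableSpace X] {m : Measure X} [OpensMeasurableSpace X]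
  [SecondCountableTopology X] [SFinite m]

lemma measurable_lintegral_ball {f : X → X → ℝ≥0∞} (hf : Measurable (Function.uncurry f)) (s : ℝ) :
    Measurable fun x => ∫⁻ y in ball x s, f x y ∂m := by
  have hS : MeasurableSet {z : X × X | dist z.2 z.1 < s} :=
    (isOpen_lt (by fun_prop) continuous_const).measurableSet
  have h1 : ∀ x, ∫⁻ y in ball x s, f x y ∂m =
      ∫⁻ y, {z : X × X | dist z.2 z.1 < s}.indicator (Function.uncurry f) (x, y) ∂m := fun x => by
    rw [← lintegral_indicator measurableSet_ball]
    congr 1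
  simp only [h1]
  exact (hf.indicator hS).lintegral_prod_right'

lemma measurable_measure_ball (s : ℝ) : Measurable fun x => m (ball x s) := by
  simpa using measurable_lintegral_ball (m := m) (f := fun _ _ => 1) measurable_const s

variable {Y : Type*} [MetricSpace Y]

omit [OpensMeasurableSpace X] [SecondCountableTopology X] [SFinite m] in
lemma ksDensity_congr {u v : X → Y} (huv : u =ᵐ[m] v) (p s : ℝ) :
    ksDensity m p s u =ᵐ[m] ksDensity m p s v := by
  filter_upwards [huv] with x hx
  rw [ksDensity, ksDensity, hx]
  congr 1
  refine laverage_congr ?_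
  filter_upwards [ae_restrict_of_ae huv] with y hy
  rw [hy]

lemma aemeasurable_ksDensity {u : X → Y} (hu : AEStronglyMeasurable u m) (p s : ℝ) :
    AEMeasurable (ksDensity m p s u) m := by
  obtain ⟨v, hv, huv⟩ := hu
  refine AEMeasurable.congr (Measurable.aemeasurable ?_) (ksDensity_congr huv p s).symm
  have hE : Measurable (Function.uncurry fun x y => edist (v x) (v y)) :=
    ((hv.comp_measurable measurable_fst).edist (hv.comp_measurable measurable_snd)).measurable
  have h1 : Measurable (Function.uncurry fun x y =>
      edist (v x) (v y) ^ p / ENNReal.ofReal s ^ p) :=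
    (hE.pow_const p).div_const _
  unfold ksDensity
  simp only [setLAverage_eq]
  exact ((measurable_lintegral_ball h1 s).div (measurable_measure_ball s)).pow_const _

end Measurability

/-! ### Hajłasz-type inequality -/

section Hajlasz

variable {X : Type*} [MetricSpace X] [MeasurableSpace X] {m : Measure X}
variable {Y : Type*} [MetricSpace Y]

lemma tendsto_zero_of_tendsto_rpow {a : ℕ → ℝ≥0∞} {p : ℝ} (hp : 0 < p)
    (h : Tendsto (fun n => a n ^ p) atTop (𝓝 0)) : Tendsto a atTop (𝓝 0) := by
  have h1 := (ENNReal.continuous_rpow_const (y := p⁻¹)).tendsto 0 |>.comp h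
  rw [ENNReal.zero_rpow_of_pos (inv_pos.2 hp)] at h1
  refine h1.congr fun n => ?_
  simp [← ENNReal.rpow_mul, mul_inv_cancel₀ hp.ne']

lemma ae_tendsto_zero_of_tsum_lintegral_rpow {α : Type*} [MeasurableSpace α] {μ : Measure α}
    {a : ℕ → α → ℝ≥0∞} (ha : ∀ n, AEMeasurable (a n) μ) {p : ℝ} (hp : 0 < p)
    (h : ∑' n, ∫⁻ x, a n x ^ p ∂μ ≠ ∞) : ∀ᵐ x ∂μ, Tendsto (fun n => a n x) atTop (𝓝 0) := by
  rw [← lintegral_tsum fun n => (ha n).pow_const p] at h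
  filter_upwards [ae_lt_top' (AEMeasurable.tsum fun n => (ha n).pow_const p) h] with x hx
  exact tendsto_zero_of_tendsto_rpow hp (ENNReal.tendsto_atTop_zero_of_tsum_ne_top hx.ne)

lemma midpoint_rpow_le {p : ℝ} (hp : 1 ≤ p) (a b : ℝ≥0∞) :
    ((a + b) / 2) ^ p ≤ (a ^ p + b ^ p) / 2 := by
  have := ENNReal.rpow_arith_mean_le_arith_mean2_rpow (1 / 2) (1 / 2) a b
    (by simp [ENNReal.inv_two_add_inv_two]) hp
  calc ((a + b) / 2) ^ p = (1 / 2 * a + 1 / 2 * b) ^ p := by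
        congr 1; simp only [div_eq_mul_inv]; ring
    _ ≤ _ := this
    _ = _ := by simp only [div_eq_mul_inv]; ring

variable [OpensMeasurableSpace X] [SecondCountableTopology X]

/-- A map of finite energy satisfies a Hajłasz inequality: off a null set its increments at small
distances are bounded by `d(x,y) (G x + G y)` for some `G` in `L^p`.

The functions of bounded `L^p` norm which satisfy the inequality up to an error `τ N x + τ N y`,
with `τ N → 0` almost everywhere, form nonempty midpoint-convex sets decreasing in `N`. The
function `G` is the limit of a sequence of such functions, given by the Komlós-type lemma. -/
theorem exists_hajlasz_bound (hm : IsReferenceMeasure m) (hd : UniformlyLocallyDoubling m)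
    (hpoinc : SupportsPoincare m) {p : ℝ} (hp : 1 < p) {u : X → Y} (hu : AEStronglyMeasurable u m)
    (hE : ksEnergy m p u < ∞) :
    ∃ G : X → ℝ≥0∞, Measurable G ∧ ∫⁻ x, G x ^ p ∂m < ∞ ∧ ∃ N : Set X, MeasurableSet N ∧ m N = 0 ∧
      (∀ x ∉ N, G x < ∞) ∧
      ∀ x ∉ N, ∀ y ∉ N, dist x y < 1 / 4 → edist (u x) (u y) ≤ edist x y * (G x + G y) := by
  have hp0 : 0 < p := by linarith
  have : IsLocallyFiniteMeasure m := hm.isLocallyFiniteMeasure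
  obtain ⟨C, R, hC⟩ := exists_edist_le_ksDensity (Y := Y) hm hd hpoinc hp
  obtain ⟨C₂, hC₂⟩ := exists_lintegral_maximalFunction_rpow_le hm hd hp R
  set K : ℝ≥0∞ := ksEnergy m p u + 1 with hK
  have hKtop : K ≠ ∞ := ENNReal.add_ne_top.2 ⟨hE.ne, ENNReal.one_ne_top⟩
  have hfreq : ∃ᶠ r in 𝓝[>] (0 : ℝ), ksEnergyAtScale m p r u < K := by
    refine frequently_lt_of_liminf_lt (by isBoundedDefault) ?_
    exact ENNReal.lt_add_right hE.ne one_ne_zero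
  have hs : ∀ n : ℕ, ∃ s : ℝ, (0 < s ∧ s < (1 / 2) ^ (n + 1)) ∧ ksEnergyAtScale m p s u < K :=
    fun n => by
      obtain ⟨s, h1, h2⟩ := (hfreq.and_eventually
        (Ioo_mem_nhdsGT (show (0 : ℝ) < (1 / 2) ^ (n + 1) by positivity))).exists
      exact ⟨s, h2, h1⟩
  choose s hs hsK using hs
  have hs1 : ∀ n, s n < 1 := fun n =>
    (hs n).2.trans (pow_lt_one₀ (by norm_num) (by norm_num) (by omega))
  set g : ℕ → X → ℝ≥0∞ := fun n => ksDensity m p (s n) u with hg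
  have hgm : ∀ n, AEMeasurable (g n) m := fun n => aemeasurable_ksDensity hu p (s n)
  -- the errors `s n * g n` tend to zero almost everywhere
  have herr : ∀ᵐ x ∂m, Tendsto (fun n => ENNReal.ofReal (s n) * g n x) atTop (𝓝 0) := by
    refine ae_tendsto_zero_of_tsum_lintegral_rpow (fun n => (hgm n).const_mul _) hp0 ?_
    have h1 : ∀ n, ∫⁻ x, (ENNReal.ofReal (s n) * g n x) ^ p ∂m ≤ (1 / 2) ^ n * K := by
      intro n
      simp only [ENNReal.mul_rpow_of_nonneg _ _ hp0.le]
      rw [lintegral_const_mul' _ _ (ENNReal.rpow_ne_top_of_nonneg hp0.le ENNReal.ofReal_ne_top)]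
      refine mul_le_mul' ?_ (hsK n).le
      have h2 : s n ^ p ≤ (1 / 2) ^ n := by
        calc s n ^ p ≤ s n ^ (1 : ℝ) :=
              Real.rpow_le_rpow_of_exponent_ge (hs n).1 (hs1 n).le hp.le
          _ = s n := Real.rpow_one _
          _ ≤ (1 / 2) ^ (n + 1) := (hs n).2.le
          _ ≤ (1 / 2) ^ n := pow_le_pow_of_le_one (by norm_num) (by norm_num) (by omega)
      rw [ENNReal.ofReal_rpow_of_nonneg (hs n).1.le hp0.le]
      refine (ENNReal.ofReal_le_ofReal h2).trans_eq ?_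
      rw [ENNReal.ofReal_pow (by norm_num), one_div, one_div,
        ENNReal.ofReal_inv_of_pos (by norm_num), ENNReal.ofReal_ofNat]
    refine ne_top_of_le_ne_top ?_ (ENNReal.tsum_le_tsum h1)
    rw [ENNReal.tsum_mul_right, ENNReal.tsum_geometric, one_div, ENNReal.one_sub_inv_two, inv_inv]
    exact ENNReal.mul_ne_top (by norm_num) hKtop
  set τ : ℕ → X → ℝ≥0∞ := fun N x => ⨆ n ≥ N, C * (ENNReal.ofReal (s n) * g n x) with hτ
  have hτanti : ∀ x, Antitone fun N => τ N x := fun x a b hab =>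
    biSup_mono fun n hn => le_trans hab hn
  have hτlim : ∀ᵐ x ∂m, Tendsto (fun N => τ N x) atTop (𝓝 0) := by
    filter_upwards [herr] with x hx
    have h1 : Tendsto (fun n => (C : ℝ≥0∞) * (ENNReal.ofReal (s n) * g n x)) atTop (𝓝 0) := by
      simpa using ENNReal.Tendsto.const_mul hx (Or.inr ENNReal.coe_ne_top) (a := (C : ℝ≥0∞))
    have h2 := tendsto_atTop_iInf (hτanti x)
    have h3 : ⨅ N, τ N x = 0 := by
      rw [← h1.limsup_eq, limsup_eq_iInf_iSup_of_nat]
    rwa [h3] at h2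
  set K' : ℝ≥0∞ := (C : ℝ≥0∞) ^ p * (C₂ * K) with hK'
  have hK'top : K' ≠ ∞ := ENNReal.mul_ne_top
    (ENNReal.rpow_ne_top_of_nonneg hp0.le ENNReal.coe_ne_top)
    (ENNReal.mul_ne_top ENNReal.coe_ne_top hKtop)
  -- the functions `h` satisfying an approximate Hajłasz inequality
  set 𝒢 : ℕ → Set (X → ℝ≥0∞) := fun N => {h | Measurable h ∧ ∫⁻ x, h x ^ p ∂m ≤ K' ∧
    ∀ x y, dist x y < 1 / 4 → edist (u x) (u y) ≤ edist x y * (h x + h y) + (τ N x + τ N y)}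
    with h𝒢
  have hne : ∀ N, (𝒢 N).Nonempty := by
    intro N
    have hMm : Measurable (maximalFunction m R (g N)) := measurable_maximalFunction R (g N)
    refine ⟨fun x => C * maximalFunction m R (g N) x, hMm.const_mul _, ?_, fun x y hxy => ?_⟩
    · simp only [ENNReal.mul_rpow_of_nonneg _ _ hp0.le]
      rw [lintegral_const_mul _ (hMm.pow_const p)]
      refine mul_le_mul' le_rfl ((hC₂ (g N) (hgm N)).trans (mul_le_mul' le_rfl (hsK N).le))
    · refine (hC u hu (s N) (hs N).1 (hs1 N) x y hxy).trans ?_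
      have hτN : ∀ z, C * (ENNReal.ofReal (s N) * g N z) ≤ τ N z := fun z =>
        le_iSup₂_of_le N le_rfl le_rfl
      calc _ = edist x y * (C * maximalFunction m R (g N) x + C * maximalFunction m R (g N) y) +
            (C * (ENNReal.ofReal (s N) * g N x) + C * (ENNReal.ofReal (s N) * g N y)) := by
            ring
        _ ≤ _ := by gcongr <;> exact hτN _
  have hanti : Antitone 𝒢 := fun a b hab h hh =>
    ⟨hh.1, hh.2.1, fun x y hxy => (hh.2.2 x y hxy).trans
      (add_le_add le_rfl (add_le_add (hτanti x hab) (hτanti y hab)))⟩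
  have hmid : ∀ n, ∀ h ∈ 𝒢 n, ∀ k ∈ 𝒢 n, (fun x => (h x + k x) / 2) ∈ 𝒢 n := by
    rintro n h ⟨h1, h2, h3⟩ k ⟨k1, k2, k3⟩
    refine ⟨(h1.add k1).div_const 2, ?_, fun x y hxy => ?_⟩
    · calc ∫⁻ x, ((h x + k x) / 2) ^ p ∂m ≤ ∫⁻ x, (h x ^ p + k x ^ p) / 2 ∂m :=
            lintegral_mono fun x => midpoint_rpow_le hp.le _ _
        _ = (∫⁻ x, h x ^ p ∂m + ∫⁻ x, k x ^ p ∂m) / 2 := by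
            simp only [div_eq_mul_inv]
            rw [lintegral_mul_const' _ _ (by norm_num),
              lintegral_add_left (h1.pow_const p)]
        _ ≤ (K' + K') / 2 := by gcongr
        _ = K' := by rw [← two_mul, mul_div_assoc, mul_comm, ENNReal.div_mul_cancel] <;> norm_num
    · have e : ∀ a : ℝ≥0∞, a = (a + a) / 2 := fun a => by
        rw [ENNReal.add_div, ENNReal.add_halves]
      rw [e (edist (u x) (u y))]
      calc (edist (u x) (u y) + edist (u x) (u y)) / 2
          ≤ ((edist x y * (h x + h y) + (τ n x + τ n y)) +
            (edist x y * (k x + k y) + (τ n x + τ n y))) / 2 := by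
            gcongr
            · exact h3 x y hxy
            · exact k3 x y hxy
        _ = edist x y * ((h x + k x) / 2 + (h y + k y) / 2) +
            ((τ n x + τ n y) + (τ n x + τ n y)) / 2 := by
            simp only [div_eq_mul_inv]; ring
        _ = _ := by rw [← e]
  obtain ⟨h, G, hmem, hGm, hlim⟩ := exists_tendsto_of_midpoint_convex m hne hanti
    (fun n h hh => hh.1) hmid
  have hGint : ∫⁻ x, G x ^ p ∂m ≤ K' := by
    have h1 : ∀ᵐ x ∂m, G x ^ p = liminf (fun n => h n x ^ p) atTop := by
      filter_upwards [hlim] with x hx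
      exact (((ENNReal.continuous_rpow_const (y := p)).tendsto _).comp hx).liminf_eq.symm
    rw [lintegral_congr_ae h1]
    refine (lintegral_liminf_le fun n => (hmem n).1.pow_const p).trans ?_
    exact liminf_le_of_le (h := fun b hb => by
      obtain ⟨n, hn⟩ := hb.exists
      exact hn.trans (hmem n).2.1)
  have hGfin : ∀ᵐ x ∂m, G x < ∞ := by
    filter_upwards [ae_lt_top (hGm.pow_const p) (ne_top_of_le_ne_top hK'top hGint)] with x hx
    exact (ENNReal.rpow_lt_top_iff_of_pos hp0).1 hx
  set S : Set X := {x | Tendsto (fun n => h n x) atTop (𝓝 (G x)) ∧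
    Tendsto (fun N => τ N x) atTop (𝓝 0) ∧ G x < ∞} with hS
  have hSnull : m Sᶜ = 0 := by
    have : ∀ᵐ x ∂m, x ∈ S := by
      filter_upwards [hlim, hτlim, hGfin] with x h1 h2 h3 using ⟨h1, h2, h3⟩
    exact this
  have hmemS : ∀ x ∉ toMeasurable m Sᶜ, x ∈ S := fun x hx => by
    by_contra h; exact hx (subset_toMeasurable m _ h)
  refine ⟨G, hGm, hGint.trans_lt hK'top.lt_top, toMeasurable m Sᶜ, measurableSet_toMeasurable _ _,
    by rw [measure_toMeasurable, hSnull], fun x hx => (hmemS x hx).2.2, fun x hx y hy hxy => ?_⟩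
  obtain ⟨x1, x2, -⟩ := hmemS x hx
  obtain ⟨y1, y2, -⟩ := hmemS y hy
  have hlim2 : Tendsto (fun n => edist x y * (h n x + h n y) + (τ n x + τ n y)) atTop
      (𝓝 (edist x y * (G x + G y) + (0 + 0))) :=
    (ENNReal.Tendsto.const_mul (x1.add y1) (Or.inr (edist_ne_top x y))).add (x2.add y2)
  rw [add_zero, add_zero] at hlim2
  exact ge_of_tendsto' hlim2 fun n => (hmem n).2.2 x y hxy

end Hajlasz

/-! ### Convergence in `L^p` -/

section Convergence

variable {X : Type*} [MetricSpace X] [MeasurableSpace X] {m : Measure X} [OpensMeasurableSpace X]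
  [SecondCountableTopology X]

/-- Averaging over balls is bounded on `L¹`, uniformly in the radius, by Tonelli's theorem and the
doubling condition. -/
lemma exists_lintegral_average_le (hm : IsReferenceMeasure m) (hd : UniformlyLocallyDoubling m)
    (R : ℝ) : ∃ D : ℝ≥0, ∀ r, 0 < r → r < R → ∀ h : X → ℝ≥0∞, AEMeasurable h m →
      ∫⁻ x, (∫⁻ y in ball x r, h y ∂m) / m (ball x r) ∂m ≤ D * ∫⁻ y, h y ∂m := by
  have : IsLocallyFiniteMeasure m := hm.isLocallyFiniteMeasure
  obtain ⟨D, -, hD⟩ := hd.exists_measure_ball_mul_le 2 R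
  refine ⟨D, fun r hr hrR h hh => ?_⟩
  wlog hhm : Measurable h generalizing h
  · have h1 := this (hh.mk h) hh.measurable_mk.aemeasurable hh.measurable_mk
    have h2 : ∀ x, ∫⁻ y in ball x r, h y ∂m = ∫⁻ y in ball x r, hh.mk h y ∂m := fun x =>
      lintegral_congr_ae (ae_restrict_of_ae hh.ae_eq_mk)
    simp only [h2, lintegral_congr_ae hh.ae_eq_mk]
    exact h1
  have hS : MeasurableSet {z : X × X | dist z.2 z.1 < r} :=
    (isOpen_lt (by fun_prop) continuous_const).measurableSet
  set k : X → X → ℝ≥0∞ := fun x y =>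
    {z : X × X | dist z.2 z.1 < r}.indicator (fun z => h z.2 * (m (ball z.1 r))⁻¹) (x, y) with hk
  have hkm : Measurable (Function.uncurry k) :=
    ((hhm.comp measurable_snd).mul
      ((measurable_measure_ball r).comp measurable_fst).inv).indicator hS
  have e1 : ∀ x, (∫⁻ y in ball x r, h y ∂m) / m (ball x r) = ∫⁻ y, k x y ∂m := by
    intro x
    rw [div_eq_mul_inv, ← lintegral_mul_const _ hhm, ← lintegral_indicator measurableSet_ball]
    rfl
  simp only [e1]
  rw [lintegral_lintegral_swap hkm.aemeasurable, ← lintegral_const_mul _ hhm]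
  refine lintegral_mono fun y => ?_
  have e2 : ∫⁻ x, k x y ∂m = ∫⁻ x in ball y r, h y * (m (ball x r))⁻¹ ∂m := by
    rw [← lintegral_indicator measurableSet_ball]
    congr 1; ext x
    simp only [hk, indicator, mem_ofPred_eq, mem_ball, dist_comm y x]
  have hpos := measure_ball_pos hm hd y hr
  have hfin := (hm.measure_ball_lt_top y r).ne
  rw [e2]
  calc ∫⁻ x in ball y r, h y * (m (ball x r))⁻¹ ∂m
      ≤ ∫⁻ _ in ball y r, h y * (D * (m (ball y r))⁻¹) ∂m := by
        refine setLIntegral_mono measurable_const fun x hx => ?_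
        gcongr
        have hposx := measure_ball_pos hm hd x hr
        have h1 : m (ball y r) ≤ D * m (ball x r) :=
          (measure_mono (ball_subset_ball' (by
            rw [dist_comm]; linarith [mem_ball.1 hx]))).trans (hD x r hr hrR)
        rw [← div_eq_mul_inv, ENNReal.le_div_iff_mul_le (Or.inl hpos.ne') (Or.inl hfin), mul_comm,
          ← div_eq_mul_inv]
        exact ENNReal.div_le_of_le_mul h1
    _ = D * h y := by
        rw [setLIntegral_const, mul_assoc, mul_assoc, ENNReal.inv_mul_cancel hpos.ne' hfin, mul_one,
          mul_comm]

/-- A dominated convergence theorem in which the dominating functions are averages of a fixed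
integrable function over small balls. -/
lemma tendsto_lintegral_zero_of_le_average [Nonempty X] (hm : IsReferenceMeasure m)
    (hd : UniformlyLocallyDoubling m) {F : ℝ → X → ℝ≥0∞} {H h : X → ℝ≥0∞} {C : ℝ≥0}
    (hF : ∀ r, AEMeasurable (F r) m) (hHm : AEMeasurable H m) (hH : ∫⁻ x, H x ∂m ≠ ∞)
    (hh : Measurable h) (hhint : ∫⁻ x, h x ∂m ≠ ∞)
    (hdom : ∀ r, 0 < r → r < 1 / 4 → ∀ᵐ x ∂m,
      F r x ≤ H x + C * ((∫⁻ y in ball x r, h y ∂m) / m (ball x r)))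
    (hlim : ∀ᵐ x ∂m, Tendsto (fun r => F r x) (𝓝[>] 0) (𝓝 0)) :
    Tendsto (fun r => ∫⁻ x, F r x ∂m) (𝓝[>] 0) (𝓝 0) := by
  obtain ⟨D, hD⟩ := exists_lintegral_average_le hm hd 1
  obtain ⟨x₀⟩ := ‹Nonempty X›
  -- truncation of `h` in height and support, and the remainder
  set h₁ : ℕ → X → ℝ≥0∞ := fun N => (ball x₀ N).indicator fun x => min (h x) N with hh₁
  set h₂ : ℕ → X → ℝ≥0∞ := fun N x => h x - h₁ N x with hh₂
  have hh₁m : ∀ N, Measurable (h₁ N) := fun N =>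
    (hh.min measurable_const).indicator measurableSet_ball
  have hh₂m : ∀ N, Measurable (h₂ N) := fun N => hh.sub (hh₁m N)
  have hh₁le : ∀ N x, h₁ N x ≤ h x := fun N x =>
    (indicator_le_self _ _ x).trans (min_le_left _ _)
  have hrem : Tendsto (fun N => ∫⁻ x, h₂ N x ∂m) atTop (𝓝 0) := by
    rw [← lintegral_zero (μ := m)]
    refine tendsto_lintegral_of_dominated_convergence h hh₂m
      (fun N => .of_forall fun x => tsub_le_self) hhint ?_
    filter_upwards [ae_lt_top hh hhint] with x hx
    refine tendsto_const_nhds.congr' ?_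
    obtain ⟨n, hn⟩ := exists_nat_gt (dist x x₀)
    obtain ⟨k, hk⟩ := ENNReal.exists_nat_gt hx.ne
    filter_upwards [eventually_ge_atTop (max n k)] with N hN
    have h1 : x ∈ ball x₀ (N : ℝ) :=
      hn.trans_le (by exact_mod_cast (le_max_left _ _).trans hN)
    have h2 : h x ≤ N := hk.le.trans (by exact_mod_cast (le_max_right _ _).trans hN)
    simp only [hh₂, hh₁]
    rw [indicator_of_mem h1, min_eq_left h2, tsub_self]
  -- the dominating function at level `N`
  set a : ℕ → X → ℝ≥0∞ := fun N x => H x + C * (ball x₀ (N + 1)).indicator (fun _ => (N : ℝ≥0∞)) x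
    with ha
  have haint : ∀ N, ∫⁻ x, a N x ∂m ≠ ∞ := by
    intro N
    rw [lintegral_add_right _ ((measurable_const.indicator measurableSet_ball).const_mul _),
      lintegral_const_mul _ (measurable_const.indicator measurableSet_ball),
      lintegral_indicator measurableSet_ball, setLIntegral_const]
    exact ENNReal.add_ne_top.2 ⟨hH, ENNReal.mul_ne_top ENNReal.coe_ne_top
      (ENNReal.mul_ne_top (ENNReal.natCast_ne_top N) (hm.measure_ball_lt_top _ _).ne)⟩
  have hbound : ∀ (N : ℕ) r, 0 < r → r < 1 / 4 → ∀ᵐ x ∂m,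
      F r x ≤ min (F r x) (a N x) + C * ((∫⁻ y in ball x r, h₂ N y ∂m) / m (ball x r)) := by
    intro N r hr hr1
    filter_upwards [hdom r hr hr1] with x hx
    have hpos := measure_ball_pos hm hd x hr
    have hfin := (hm.measure_ball_lt_top x r).ne
    have h1 : ∀ y ∈ ball x r, h₁ N y ≤ (ball x₀ (N + 1)).indicator (fun _ => (N : ℝ≥0∞)) x := by
      intro y hy
      by_cases hy' : y ∈ ball x₀ (N : ℝ)
      · have hx' : x ∈ ball x₀ ((N : ℝ) + 1) := by
          rw [mem_ball] at hy hy' ⊢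
          linarith [dist_triangle x y x₀, dist_comm x y]
        rw [indicator_of_mem hx', hh₁]
        dsimp only
        rw [indicator_of_mem hy']
        exact min_le_right _ _
      · rw [hh₁]
        dsimp only
        rw [indicator_of_notMem hy']
        exact bot_le
    have h2 : (∫⁻ y in ball x r, h₁ N y ∂m) / m (ball x r) ≤
        (ball x₀ (N + 1)).indicator (fun _ => (N : ℝ≥0∞)) x := by
      refine ENNReal.div_le_of_le_mul ?_
      rw [← setLIntegral_const]
      exact setLIntegral_mono measurable_const h1
    have h3 : ∫⁻ y in ball x r, h y ∂m =
        ∫⁻ y in ball x r, h₁ N y ∂m + ∫⁻ y in ball x r, h₂ N y ∂m := by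
      rw [← lintegral_add_left (hh₁m N)]
      congr 1; ext y
      rw [hh₂]
      exact (add_tsub_cancel_of_le (hh₁le N y)).symm
    have h4 : F r x ≤ a N x + C * ((∫⁻ y in ball x r, h₂ N y ∂m) / m (ball x r)) := by
      refine hx.trans ?_
      rw [h3, ENNReal.add_div, mul_add, ← add_assoc]
      exact add_le_add (add_le_add le_rfl (mul_le_mul' le_rfl h2)) le_rfl
    rcases le_total (F r x) (a N x) with h5 | h5
    · rw [min_eq_left h5]; exact le_self_add
    · rw [min_eq_right h5]; exact h4
  have hmin : ∀ N, Tendsto (fun r => ∫⁻ x, min (F r x) (a N x) ∂m) (𝓝[>] 0) (𝓝 0) := by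
    intro N
    rw [← lintegral_zero (μ := m)]
    have ham : AEMeasurable (a N) m :=
      hHm.add ((measurable_const.indicator measurableSet_ball).const_mul _).aemeasurable
    refine tendsto_lintegral_filter_of_dominated_convergence' (a N)
      (.of_forall fun r => (hF r).min ham)
      (.of_forall fun r => .of_forall fun x => min_le_right _ _) (haint N) ?_
    filter_upwards [hlim] with x hx
    exact tendsto_of_tendsto_of_tendsto_of_le_of_le tendsto_const_nhds hx
      (fun _ => bot_le) (fun _ => min_le_left _ _)
  rw [ENNReal.tendsto_nhds_zero]
  intro ε hε
  have hCD : Tendsto (fun N => (C : ℝ≥0∞) * (D * ∫⁻ x, h₂ N x ∂m)) atTop (𝓝 0) := by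
    have := ENNReal.Tendsto.const_mul (ENNReal.Tendsto.const_mul hrem
      (Or.inr (ENNReal.coe_ne_top (r := D)))) (Or.inr (ENNReal.coe_ne_top (r := C)))
    simpa using this
  obtain ⟨N, hN⟩ := ((ENNReal.tendsto_nhds_zero.1 hCD) (ε / 2) (ENNReal.half_pos hε.ne')).exists
  filter_upwards [(ENNReal.tendsto_nhds_zero.1 (hmin N)) (ε / 2) (ENNReal.half_pos hε.ne'),
    Ioo_mem_nhdsGT (show (0 : ℝ) < 1 / 4 by norm_num)] with r hr hr'
  have hk : AEMeasurable (fun x => min (F r x) (a N x)) m :=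
    (hF r).min (hHm.add ((measurable_const.indicator measurableSet_ball).const_mul _).aemeasurable)
  calc ∫⁻ x, F r x ∂m
      ≤ ∫⁻ x, (min (F r x) (a N x) +
          C * ((∫⁻ y in ball x r, h₂ N y ∂m) / m (ball x r))) ∂m :=
        lintegral_mono_ae (hbound N r hr'.1 hr'.2)
    _ = ∫⁻ x, min (F r x) (a N x) ∂m +
          C * ∫⁻ x, (∫⁻ y in ball x r, h₂ N y ∂m) / m (ball x r) ∂m := by
        rw [lintegral_add_left' hk, lintegral_const_mul' _ _ ENNReal.coe_ne_top]
    _ ≤ ε / 2 + ε / 2 := by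
        refine add_le_add hr ((mul_le_mul' le_rfl ?_).trans hN)
        exact hD r hr'.1 (by linarith [hr'.2]) _ (hh₂m N).aemeasurable
    _ = ε := ENNReal.add_halves ε

end Convergence

section Domination

variable {X Y : Type*} [MetricSpace X] [MeasurableSpace X] {m : Measure X} [OpensMeasurableSpace X]
  [MetricSpace Y] {u : X → Y} {p : ℝ}

/-- A bound of the difference quotients at scale `r` by `a + A y` bounds the energy density. -/
lemma ksDensity_rpow_le (hm : IsReferenceMeasure m) (hd : UniformlyLocallyDoubling m) (hp : 1 < p)
    {r : ℝ} (hr : 0 < r) {x : X} {a : ℝ≥0∞} {A : X → ℝ≥0∞}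
    (h : ∀ᵐ y ∂m, y ∈ ball x r → edist (u x) (u y) / ENNReal.ofReal r ≤ a + A y) :
    ksDensity m p r u x ^ p ≤
      2 ^ (p - 1) * (a ^ p + (∫⁻ y in ball x r, A y ^ p ∂m) / m (ball x r)) := by
  have hp0 : 0 < p := by linarith
  have h2 : (2 : ℝ≥0∞) ^ (p - 1) ≠ ∞ :=
    ENNReal.rpow_ne_top_of_nonneg (by linarith) (by simp)
  have hpos := measure_ball_pos hm hd x hr
  have hfin := (hm.measure_ball_lt_top x r).ne
  rw [ksDensity_rpow hp0]
  refine ENNReal.div_le_of_le_mul ?_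
  calc ∫⁻ y in ball x r, (edist (u x) (u y) / ENNReal.ofReal r) ^ p ∂m
      ≤ ∫⁻ y in ball x r, 2 ^ (p - 1) * (a ^ p + A y ^ p) ∂m := by
        refine lintegral_mono_ae ((ae_restrict_iff' measurableSet_ball).2 ?_)
        filter_upwards [h] with y hy hyx
        exact (ENNReal.rpow_le_rpow (hy hyx) hp0.le).trans
          (ENNReal.rpow_add_le_mul_rpow_add_rpow _ _ hp.le)
    _ = 2 ^ (p - 1) * (a ^ p * m (ball x r) + ∫⁻ y in ball x r, A y ^ p ∂m) := by
        rw [lintegral_const_mul' _ _ h2, lintegral_add_left measurable_const, setLIntegral_const]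
    _ = _ := by
        rw [mul_assoc, add_mul, ENNReal.div_mul_cancel hpos.ne' hfin]

/-- The difference quotients at scale `r`, estimated through the base point. -/
lemma ksDensity_rpow_le_edist (hm : IsReferenceMeasure m) (hd : UniformlyLocallyDoubling m)
    (hp : 1 < p) {r : ℝ} (hr : 0 < r) (ybar : Y) (u : X → Y) (x : X) :
    ksDensity m p r u x ^ p ≤ 2 ^ (p - 1) * ((edist (u x) ybar / ENNReal.ofReal r) ^ p +
      (∫⁻ y in ball x r, (edist (u y) ybar / ENNReal.ofReal r) ^ p ∂m) / m (ball x r)) := by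
  refine ksDensity_rpow_le hm hd hp hr (.of_forall fun y _ => ?_)
  rw [← ENNReal.add_div]
  gcongr
  exact edist_triangle_right _ _ _

omit [OpensMeasurableSpace X] in
lemma MemLpPointed.lintegral_div_rpow_lt_top {ybar : Y} (hu : MemLpPointed m p ybar u) (hp : 0 < p)
    {r : ℝ} (hr : 0 < r) :
    ∫⁻ y, (edist (u y) ybar / ENNReal.ofReal r) ^ p ∂m < ∞ := by
  have hr' : 0 < ENNReal.ofReal r := ENNReal.ofReal_pos.2 hr
  simp only [fun a => ENNReal.div_rpow_of_nonneg a (ENNReal.ofReal r) hp.le]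
  simp only [div_eq_mul_inv]
  have h1 : ((ENNReal.ofReal r) ^ p)⁻¹ ≠ ∞ :=
    ENNReal.inv_ne_top.2 (ENNReal.rpow_pos hr' ENNReal.ofReal_ne_top).ne'
  rw [lintegral_mul_const' _ _ h1]
  exact ENNReal.mul_lt_top hu.lintegral_lt_top h1.lt_top

lemma MemLpPointed.ksDensity_lt_top {ybar : Y} (hu : MemLpPointed m p ybar u)
    (hm : IsReferenceMeasure m) (hd : UniformlyLocallyDoubling m) (hp : 1 < p) {r : ℝ} (hr : 0 < r)
    (x : X) : ksDensity m p r u x < ∞ := by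
  have hp0 : 0 < p := by linarith
  have hr' : 0 < ENNReal.ofReal r := ENNReal.ofReal_pos.2 hr
  rw [← ENNReal.rpow_lt_top_iff_of_pos hp0]
  refine (ksDensity_rpow_le_edist hm hd hp hr ybar u x).trans_lt ?_
  refine ENNReal.mul_lt_top
    (ENNReal.rpow_lt_top_of_nonneg (by linarith) (by simp)) (ENNReal.add_lt_top.2 ⟨?_, ?_⟩)
  · exact ENNReal.rpow_lt_top_of_nonneg hp0.le (ENNReal.div_lt_top (edist_ne_top _ _) hr'.ne').ne
  · exact ENNReal.div_lt_top ((setLIntegral_le_lintegral _ _).trans_lt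
      (hu.lintegral_div_rpow_lt_top hp0 hr)).ne (measure_ball_pos hm hd x hr).ne'

variable [SecondCountableTopology X]

lemma MemLpPointed.ksEnergyAtScale_lt_top {ybar : Y} (hu : MemLpPointed m p ybar u)
    (hm : IsReferenceMeasure m) (hd : UniformlyLocallyDoubling m) (hp : 1 < p) {r : ℝ}
    (hr : 0 < r) : ksEnergyAtScale m p r u < ∞ := by
  have hp0 : 0 < p := by linarith
  have h2 : (2 : ℝ≥0∞) ^ (p - 1) ≠ ∞ :=
    ENNReal.rpow_ne_top_of_nonneg (by linarith) (by simp)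
  obtain ⟨D, hD⟩ := exists_lintegral_average_le hm hd (r + 1)
  have hmeas : AEMeasurable (fun y => (edist (u y) ybar / ENNReal.ofReal r) ^ p) m :=
    ((hu.aestronglyMeasurable.edist aestronglyMeasurable_const).div_const _).pow_const _
  refine (lintegral_mono fun x =>
    ksDensity_rpow_le_edist hm hd hp hr ybar u x).trans_lt ?_
  rw [lintegral_const_mul' _ _ h2, lintegral_add_left' hmeas]
  have hfin := hu.lintegral_div_rpow_lt_top hp0 hr
  exact ENNReal.mul_lt_top h2.lt_top (ENNReal.add_lt_top.2 ⟨hfin,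
    (hD r hr (by linarith) _ hmeas).trans_lt (ENNReal.mul_lt_top ENNReal.coe_lt_top hfin)⟩)

omit [OpensMeasurableSpace X] [SecondCountableTopology X] in
/-- The energy at scale `r` is the `p`-th power of the `L^p` norm of the energy density. -/
lemma eLpNorm_toReal_ksDensity (hp : 1 < p) {r : ℝ} (h : ∀ x, ksDensity m p r u x < ∞) :
    eLpNorm (fun x => (ksDensity m p r u x).toReal) (ENNReal.ofReal p) m =
      ksEnergyAtScale m p r u ^ (1 / p) := by
  have hp0 : 0 < p := by linarith
  rw [eLpNorm_eq_lintegral_rpow_enorm_toReal (by simpa using hp0) ENNReal.ofReal_ne_top,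
    ENNReal.toReal_ofReal hp0.le, ksEnergyAtScale]
  simp_rw [Real.enorm_of_nonneg ENNReal.toReal_nonneg, ENNReal.ofReal_toReal (h _).ne]

lemma MemLpPointed.memLp_ksDensity {ybar : Y} (hu : MemLpPointed m p ybar u)
    (hm : IsReferenceMeasure m) (hd : UniformlyLocallyDoubling m) (hp : 1 < p) {r : ℝ}
    (hr : 0 < r) : MemLp (fun x => (ksDensity m p r u x).toReal) (ENNReal.ofReal p) m := by
  have : IsLocallyFiniteMeasure m := hm.isLocallyFiniteMeasure
  refine ⟨(aemeasurable_ksDensity hu.aestronglyMeasurable p r).ennreal_toReal.aestronglyMeasurable,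
    ?_⟩
  rw [eLpNorm_toReal_ksDensity hp (hu.ksDensity_lt_top hm hd hp hr)]
  exact ENNReal.rpow_lt_top_of_nonneg (by positivity)
    (hu.ksEnergyAtScale_lt_top hm hd hp hr).ne

/-- Under a pointwise bound of the difference quotients by `G x + G y` with `G ∈ L^p`, convergence
almost everywhere of the energy densities entails convergence in `L^p`, and of the energies. -/
lemma MemLpPointed.tendsto_eLpNorm_ksDensity {ybar : Y} (hu : MemLpPointed m p ybar u)
    (hm : IsReferenceMeasure m) (hd : UniformlyLocallyDoubling m) (hp : 1 < p) {G : X → ℝ≥0∞}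
    (hG : Measurable G) (hGp : ∫⁻ x, G x ^ p ∂m < ∞)
    (hH : ∀ᵐ x ∂m, ∀ᵐ y ∂m, dist x y < 1 / 4 → edist (u x) (u y) ≤ edist x y * (G x + G y))
    {e : X → ℝ}
    (he : ∀ᵐ x ∂m, Tendsto (fun r => (ksDensity m p r u x).toReal) (𝓝[>] 0) (𝓝 (e x))) :
    MemLp e (ENNReal.ofReal p) m ∧
      Tendsto (fun r => eLpNorm (fun x => (ksDensity m p r u x).toReal - e x) (ENNReal.ofReal p) m)
        (𝓝[>] 0) (𝓝 0) ∧
      Tendsto (fun r => ksEnergyAtScale m p r u) (𝓝[>] 0)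
        (𝓝 (eLpNorm e (ENNReal.ofReal p) m ^ p)) := by
  have : IsLocallyFiniteMeasure m := hm.isLocallyFiniteMeasure
  have : Nonempty X := by
    by_contra h
    rw [not_nonempty_iff] at h
    exact hm.ne_zero (Measure.eq_zero_of_isEmpty m)
  have hp0 : 0 < p := by linarith
  have hp1 : 1 ≤ ENNReal.ofReal p := by simpa using hp.le
  have h2 : (2 : ℝ≥0∞) ^ (p - 1) ≠ ∞ :=
    ENNReal.rpow_ne_top_of_nonneg (by linarith) (by simp)
  have hGpm : Measurable fun x => G x ^ p := hG.pow_const p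
  -- the pointwise domination
  have hdom : ∀ r, 0 < r → r < 1 / 4 → ∀ᵐ x ∂m, ksDensity m p r u x ^ p ≤
      2 ^ (p - 1) * (G x ^ p + (∫⁻ y in ball x r, G y ^ p ∂m) / m (ball x r)) := by
    intro r hr hr4
    filter_upwards [hH] with x hx
    refine ksDensity_rpow_le (A := G) hm hd hp hr ?_
    filter_upwards [hx] with y hy hyx
    have hxy : dist x y < r := by rwa [dist_comm]
    refine ENNReal.div_le_of_le_mul ((hy (hxy.trans hr4)).trans ?_)
    rw [mul_comm]
    gcongr
    rw [edist_dist]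
    exact ENNReal.ofReal_le_ofReal hxy.le
  have hksm : ∀ r, AEStronglyMeasurable (fun x => (ksDensity m p r u x).toReal) m := fun r =>
    (aemeasurable_ksDensity hu.aestronglyMeasurable p r).ennreal_toReal.aestronglyMeasurable
  -- a sequence of radii
  have hrn : Tendsto (fun n : ℕ => (1 / 8 : ℝ) * (1 / ((n : ℝ) + 1))) atTop (𝓝[>] 0) := by
    refine tendsto_nhdsWithin_iff.2 ⟨?_, .of_forall fun n => mem_Ioi.2 (by positivity)⟩
    simpa using tendsto_one_div_add_atTop_nhds_zero_nat.const_mul (1 / 8 : ℝ)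
  set ρ : ℕ → ℝ := fun n => (1 / 8 : ℝ) * (1 / ((n : ℝ) + 1)) with hρ
  have hρ0 : ∀ n, 0 < ρ n := fun n => by positivity
  have hρ4 : ∀ n, ρ n < 1 / 4 := fun n => by
    have h1 : 1 / ((n : ℝ) + 1) ≤ 1 := by
      rw [div_le_one (by positivity)]; linarith [(Nat.cast_nonneg n : (0 : ℝ) ≤ n)]
    simp only [hρ]; linarith
  have hem : AEStronglyMeasurable e m :=
    aestronglyMeasurable_of_tendsto_ae atTop (fun n => hksm (ρ n))
      (he.mono fun x hx => hx.comp hrn)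
  obtain ⟨D, hD⟩ := exists_lintegral_average_le hm hd 1
  set K : ℝ≥0∞ := 2 ^ (p - 1) * (∫⁻ x, G x ^ p ∂m + D * ∫⁻ x, G x ^ p ∂m) with hK
  have hKtop : K < ∞ := ENNReal.mul_lt_top h2.lt_top
    (ENNReal.add_lt_top.2 ⟨hGp, ENNReal.mul_lt_top ENNReal.coe_lt_top hGp⟩)
  have hEK : ∀ n, ksEnergyAtScale m p (ρ n) u ≤ K := by
    intro n
    refine (lintegral_mono_ae (hdom _ (hρ0 n) (hρ4 n))).trans ?_
    rw [lintegral_const_mul' _ _ h2, lintegral_add_left hGpm]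
    exact mul_le_mul' le_rfl (add_le_add le_rfl
      (hD _ (hρ0 n) (by linarith [hρ4 n]) _ hGpm.aemeasurable))
  have heLp : MemLp e (ENNReal.ofReal p) m := by
    refine ⟨hem, ?_⟩
    refine (Lp.eLpNorm_lim_le_liminf_eLpNorm (fun n => hksm (ρ n)) e
      (he.mono fun x hx => hx.comp hrn)).trans_lt ?_
    refine lt_of_le_of_lt (b := K ^ (1 / p)) ?_
      (ENNReal.rpow_lt_top_of_nonneg (by positivity) hKtop.ne)
    refine liminf_le_of_le (by isBoundedDefault) fun b hb => ?_
    obtain ⟨n, hn⟩ := hb.exists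
    refine hn.trans ?_
    rw [eLpNorm_toReal_ksDensity hp (hu.ksDensity_lt_top hm hd hp (hρ0 n))]
    exact ENNReal.rpow_le_rpow (hEK n) (by positivity)
  have hepint : ∫⁻ x, ‖e x‖ₑ ^ p ∂m < ∞ := by
    have := lintegral_rpow_enorm_lt_top_of_eLpNorm_lt_top (by simpa using hp0)
      ENNReal.ofReal_ne_top heLp.2
    rwa [ENNReal.toReal_ofReal hp0.le] at this
  have hconv : Tendsto (fun r => eLpNorm (fun x => (ksDensity m p r u x).toReal - e x)
      (ENNReal.ofReal p) m) (𝓝[>] 0) (𝓝 0) := by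
    have key : Tendsto (fun r => ∫⁻ x, ‖(ksDensity m p r u x).toReal - e x‖ₑ ^ p ∂m)
        (𝓝[>] 0) (𝓝 0) := by
      have hC : (((2 : ℝ≥0) ^ (p - 1) : ℝ≥0) : ℝ≥0∞) = 2 ^ (p - 1) := by
        rw [ENNReal.coe_rpow_of_nonneg _ (by linarith)]; rfl
      refine tendsto_lintegral_zero_of_le_average hm hd
        (C := (2 : ℝ≥0) ^ (p - 1) * (2 : ℝ≥0) ^ (p - 1)) (h := fun x => G x ^ p)
        (H := fun x => 2 ^ (p - 1) * (2 ^ (p - 1) * G x ^ p + ‖e x‖ₑ ^ p))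
        (fun r => ((hksm r).sub hem).enorm.pow_const p) ?_ ?_ hGpm hGp.ne ?_ ?_
      · exact ((hGpm.const_mul _).aemeasurable.add (hem.enorm.pow_const p)).const_mul _
      · rw [lintegral_const_mul' _ _ h2, lintegral_add_left (hGpm.const_mul _),
          lintegral_const_mul' _ _ h2]
        exact ENNReal.mul_ne_top h2 (ENNReal.add_ne_top.2
          ⟨ENNReal.mul_ne_top h2 hGp.ne, hepint.ne⟩)
      · intro r hr hr4
        filter_upwards [hdom r hr hr4] with x hx
        have h3 : ‖(ksDensity m p r u x).toReal‖ₑ = ksDensity m p r u x := by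
          rw [Real.enorm_of_nonneg ENNReal.toReal_nonneg,
            ENNReal.ofReal_toReal (hu.ksDensity_lt_top hm hd hp hr x).ne]
        calc ‖(ksDensity m p r u x).toReal - e x‖ₑ ^ p
            ≤ (ksDensity m p r u x + ‖e x‖ₑ) ^ p := by
              gcongr
              exact enorm_sub_le.trans_eq (by rw [h3])
          _ ≤ 2 ^ (p - 1) * (ksDensity m p r u x ^ p + ‖e x‖ₑ ^ p) :=
              ENNReal.rpow_add_le_mul_rpow_add_rpow _ _ hp.le
          _ ≤ 2 ^ (p - 1) * (2 ^ (p - 1) * (G x ^ p +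
                (∫⁻ y in ball x r, G y ^ p ∂m) / m (ball x r)) + ‖e x‖ₑ ^ p) := by gcongr
          _ = _ := by rw [ENNReal.coe_mul, hC]; ring
      · filter_upwards [he] with x hx
        have h4 : Tendsto (fun r => ‖(ksDensity m p r u x).toReal - e x‖ₑ) (𝓝[>] 0) (𝓝 0) := by
          have := (hx.sub_const (e x)).enorm
          simpa using this
        have h5 := h4.ennrpow_const p
        rwa [ENNReal.zero_rpow_of_pos hp0] at h5
    have h6 := key.ennrpow_const (1 / p)
    rw [ENNReal.zero_rpow_of_pos (by positivity)] at h6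
    refine h6.congr fun r => ?_
    rw [eLpNorm_eq_lintegral_rpow_enorm_toReal (by simpa using hp0) ENNReal.ofReal_ne_top,
      ENNReal.toReal_ofReal hp0.le]
  refine ⟨heLp, hconv, ?_⟩
  have hnorm : Tendsto (fun r => eLpNorm (fun x => (ksDensity m p r u x).toReal)
      (ENNReal.ofReal p) m) (𝓝[>] 0) (𝓝 (eLpNorm e (ENNReal.ofReal p) m)) := by
    rw [ENNReal.tendsto_nhds heLp.2.ne]
    intro δ hδ
    filter_upwards [(ENNReal.tendsto_nhds_zero.1 hconv) δ hδ] with r hr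
    constructor
    · rw [tsub_le_iff_right]
      calc eLpNorm e (ENNReal.ofReal p) m
          = eLpNorm ((fun x => (ksDensity m p r u x).toReal) -
              fun x => (ksDensity m p r u x).toReal - e x) (ENNReal.ofReal p) m := by
            congr 1; ext x; simp
        _ ≤ _ := eLpNorm_sub_le (hksm r) ((hksm r).sub hem) hp1
        _ ≤ _ := add_le_add le_rfl hr
    · calc eLpNorm (fun x => (ksDensity m p r u x).toReal) (ENNReal.ofReal p) m
          = eLpNorm (e + fun x => (ksDensity m p r u x).toReal - e x) (ENNReal.ofReal p) m := by
            congr 1; ext x; simp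
        _ ≤ _ := eLpNorm_add_le hem ((hksm r).sub hem) hp1
        _ ≤ _ := add_le_add le_rfl hr
  refine (hnorm.ennrpow_const p).congr' ?_
  filter_upwards [self_mem_nhdsWithin] with r hr
  rw [eLpNorm_toReal_ksDensity hp (hu.ksDensity_lt_top hm hd hp hr), one_div,
    ENNReal.rpow_inv_rpow hp0.ne']

end Domination

/-! ### Blow-up in a chart -/

section Charts

/-- One chart of an `ε`-atlas. The image of the measure under the chart is comparable to `c` times
the Lebesgue measure, up to the factor `1 + ε`. -/
structure IsChart {X : Type*} [MetricSpace X] [MeasurableSpace X] (m : Measure X) {d : ℕ}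
    (ε c : ℝ) (U : Set X) (φ : X → EuclideanSpace ℝ (Fin d)) : Prop where
  measurableSet : MeasurableSet U
  upper : ∀ x ∈ U, ∀ y ∈ U, dist (φ x) (φ y) ≤ (1 + ε) * dist x y
  lower : ∀ x ∈ U, ∀ y ∈ U, dist x y ≤ (1 + ε) * dist (φ x) (φ y)
  le_map : ENNReal.ofReal c • (volume : Measure (EuclideanSpace ℝ (Fin d))).restrict (φ '' U)
    ≤ (m.restrict U).map φ
  map_le : (m.restrict U).map φ ≤ ENNReal.ofReal ((1 + ε) * c) •
    (volume : Measure (EuclideanSpace ℝ (Fin d))).restrict (φ '' U)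

variable {X : Type*} [MetricSpace X] [MeasurableSpace X] {m : Measure X} {d : ℕ}

lemma IsAtlas.exists_isChart {ε : ℝ} {U : ℕ → Set X} {φ : ℕ → X → EuclideanSpace ℝ (Fin d)}
    (h : IsAtlas m d ε U φ) (i : ℕ) : ∃ c, IsChart m ε c (U i) (φ i) := by
  obtain ⟨c, -, h1, h2⟩ := h.measure i
  exact ⟨c, h.measurableSet i, h.upper i, h.lower i, h1, h2⟩

/-- Integrals over balls of positively homogeneous functions. -/
lemma lintegral_ball_of_homogeneous {g : EuclideanSpace ℝ (Fin d) → ℝ≥0∞} (hg : Measurable g)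
    {q : ℝ} (hom : ∀ t : ℝ, 0 < t → ∀ w, g (t • w) = ENNReal.ofReal t ^ q * g w)
    (a : EuclideanSpace ℝ (Fin d)) {s : ℝ} (hs : 0 < s) :
    ∫⁻ z in ball a s, g (z - a) =
      ENNReal.ofReal s ^ d * ENNReal.ofReal s ^ q * ∫⁻ w in ball 0 1, g w := by
  set H : EuclideanSpace ℝ (Fin d) → ℝ≥0∞ := (ball 0 s).indicator g with hH
  have hHm : Measurable H := hg.indicator measurableSet_ball
  have hs' : ENNReal.ofReal s ≠ 0 := (ENNReal.ofReal_pos.2 hs).ne'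
  have hq : ENNReal.ofReal s ^ q ≠ ∞ := ENNReal.rpow_ne_top_of_ne_zero hs' ENNReal.ofReal_ne_top
  have e1 : ∫⁻ z in ball a s, g (z - a) = ∫⁻ z, H z := by
    rw [← lintegral_indicator measurableSet_ball, ← lintegral_sub_right_eq_self H a]
    congr 1; ext z
    simp only [hH, indicator, mem_ball, dist_eq_norm, sub_zero]
  have e2 : ∫⁻ w, H (s • w) = ENNReal.ofReal s ^ q * ∫⁻ w in ball 0 1, g w := by
    rw [← lintegral_const_mul' _ _ hq, ← lintegral_indicator measurableSet_ball]
    congr 1; ext w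
    have h1 : s * ‖w‖ < s ↔ ‖w‖ < 1 := by
      constructor <;> intro h <;> nlinarith
    simp only [hH, indicator, mem_ball, dist_zero_right, norm_smul, Real.norm_of_nonneg hs.le, h1,
      hom s hs]
  have e3 : ∫⁻ w, H (s • w) = (ENNReal.ofReal s ^ d)⁻¹ * ∫⁻ z, H z := by
    rw [← lintegral_map hHm (measurable_const_smul s), Measure.map_addHaar_smul _ hs.ne',
      lintegral_smul_measure, finrank_euclideanSpace_fin, abs_of_pos (by positivity),
      ENNReal.ofReal_inv_of_pos (by positivity), ENNReal.ofReal_pow hs.le, smul_eq_mul]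
  rw [e1, mul_assoc, ← e2, e3, ← mul_assoc, ENNReal.mul_inv_cancel (pow_ne_zero _ hs')
    (ENNReal.pow_ne_top ENNReal.ofReal_ne_top), one_mul]

/-- The average over `B_r(x)` of the function `y ↦ g (φ y - φ x) / r ^ q`, set to zero outside the
chart. -/
def blowUpAverage (m : Measure X) (U : Set X) (φ : X → EuclideanSpace ℝ (Fin d))
    (g : EuclideanSpace ℝ (Fin d) → ℝ≥0∞) (q : ℝ) (x : X) (r : ℝ) : ℝ≥0∞ :=
  (∫⁻ y in ball x r ∩ U, g (φ y - φ x) ∂m) / (ENNReal.ofReal r ^ q * m (ball x r))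

/-- The factor by which averages in an `ε`-chart differ from averages in the Euclidean space. -/
def distortion (d : ℕ) (q ε : ℝ) : ℝ≥0∞ :=
  ENNReal.ofReal (1 + ε) * ENNReal.ofReal (1 + ε) ^ d * ENNReal.ofReal (1 + ε) ^ d *
    ENNReal.ofReal (1 + ε) ^ q

lemma distortion_ne_zero {d : ℕ} {q ε : ℝ} (hε : 0 < ε) : distortion d q ε ≠ 0 := by
  have h1 : ENNReal.ofReal (1 + ε) ≠ 0 := (ENNReal.ofReal_pos.2 (by linarith)).ne'
  exact mul_ne_zero (mul_ne_zero (mul_ne_zero h1 (pow_ne_zero _ h1)) (pow_ne_zero _ h1))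
    (ENNReal.rpow_pos (pos_iff_ne_zero.2 h1) ENNReal.ofReal_ne_top).ne'

lemma distortion_ne_top {d : ℕ} {q ε : ℝ} (hε : 0 < ε) : distortion d q ε ≠ ∞ := by
  have h1 : ENNReal.ofReal (1 + ε) ≠ 0 := (ENNReal.ofReal_pos.2 (by linarith)).ne'
  exact ENNReal.mul_ne_top (ENNReal.mul_ne_top (ENNReal.mul_ne_top ENNReal.ofReal_ne_top
    (ENNReal.pow_ne_top ENNReal.ofReal_ne_top)) (ENNReal.pow_ne_top ENNReal.ofReal_ne_top))
    (ENNReal.rpow_ne_top_of_ne_zero h1 ENNReal.ofReal_ne_top)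

lemma tendsto_div_nhdsGT_zero {θ : ℝ} (hθ : 0 < θ) :
    Tendsto (fun r : ℝ => r / θ) (𝓝[>] 0) (𝓝[>] 0) := by
  refine tendsto_nhdsWithin_iff.2 ⟨?_, ?_⟩
  · have : Tendsto (fun r : ℝ => r / θ) (𝓝 0) (𝓝 (0 / θ)) := tendsto_id.div_const θ
    rw [zero_div] at this
    exact this.mono_left nhdsWithin_le_nhds
  · filter_upwards [self_mem_nhdsWithin] with r hr
    exact div_pos hr hθ

namespace IsChart

variable {ε c : ℝ} {U : Set X} {φ : X → EuclideanSpace ℝ (Fin d)}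

lemma injOn (h : IsChart m ε c U φ) : InjOn φ U := fun x hx y hy hxy => by
  have := h.lower x hx y hy
  rw [hxy, dist_self, mul_zero] at this
  exact dist_le_zero.1 this

lemma continuousOn (h : IsChart m ε c U φ) (hε : 0 < ε) : ContinuousOn φ U := by
  have : LipschitzOnWith (Real.toNNReal (1 + ε)) φ U := by
    refine LipschitzOnWith.of_dist_le_mul fun x hx y hy => ?_
    rw [Real.coe_toNNReal _ (by linarith)]
    exact h.upper x hx y hy
  exact this.continuousOn

lemma aemeasurable [OpensMeasurableSpace X] (h : IsChart m ε c U φ) (hε : 0 < ε) :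
    AEMeasurable φ (m.restrict U) :=
  (h.continuousOn hε).aemeasurable h.measurableSet

lemma measurableSet_image [BorelSpace X] [PolishSpace X] (h : IsChart m ε c U φ) (hε : 0 < ε) :
    MeasurableSet (φ '' U) :=
  h.measurableSet.image_of_continuousOn_injOn (h.continuousOn hε) h.injOn

lemma lintegral_comp_le [OpensMeasurableSpace X] (h : IsChart m ε c U φ) (hε : 0 < ε)
    {g : EuclideanSpace ℝ (Fin d) → ℝ≥0∞} (hg : Measurable g) :
    ∫⁻ y in U, g (φ y) ∂m ≤ ENNReal.ofReal ((1 + ε) * c) * ∫⁻ z in φ '' U, g z := by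
  rw [← lintegral_map' hg.aemeasurable (h.aemeasurable hε), ← smul_eq_mul,
    ← lintegral_smul_measure]
  exact lintegral_mono' h.map_le le_rfl

lemma le_lintegral_comp [OpensMeasurableSpace X] (h : IsChart m ε c U φ) (hε : 0 < ε)
    {g : EuclideanSpace ℝ (Fin d) → ℝ≥0∞} (hg : Measurable g) :
    ENNReal.ofReal c * ∫⁻ z in φ '' U, g z ≤ ∫⁻ y in U, g (φ y) ∂m := by
  rw [← lintegral_map' hg.aemeasurable (h.aemeasurable hε), ← smul_eq_mul,
    ← lintegral_smul_measure]
  exact lintegral_mono' h.le_map le_rfl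

variable {g : EuclideanSpace ℝ (Fin d) → ℝ≥0∞} {q : ℝ} {x : X}

lemma lintegral_ball_le [OpensMeasurableSpace X] (h : IsChart m ε c U φ) (hε : 0 < ε)
    (hg : Measurable g)
    (hom : ∀ t : ℝ, 0 < t → ∀ w, g (t • w) = ENNReal.ofReal t ^ q * g w) (hx : x ∈ U)
    {r : ℝ} (hr : 0 < r) :
    ∫⁻ y in ball x r ∩ U, g (φ y - φ x) ∂m ≤ ENNReal.ofReal ((1 + ε) * c) *
      (ENNReal.ofReal ((1 + ε) * r) ^ d * ENNReal.ofReal ((1 + ε) * r) ^ q *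
        ∫⁻ w in ball 0 1, g w) := by
  have hθ : 0 < 1 + ε := by linarith
  have hgm : Measurable fun z => g (z - φ x) := hg.comp (measurable_id.sub_const _)
  rw [← lintegral_ball_of_homogeneous hg hom (φ x) (by positivity),
    ← lintegral_indicator measurableSet_ball, ← Measure.restrict_restrict measurableSet_ball,
    ← lintegral_indicator measurableSet_ball]
  refine le_trans ?_ ((h.lintegral_comp_le hε (hgm.indicator measurableSet_ball)).trans
    (mul_le_mul' le_rfl (setLIntegral_le_lintegral _ _)))
  refine lintegral_mono_ae ((ae_restrict_iff' h.measurableSet).2 (.of_forall fun y hy => ?_))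
  by_cases hyr : y ∈ ball x r
  · have : φ y ∈ ball (φ x) ((1 + ε) * r) :=
      (h.upper y hy x hx).trans_lt (mul_lt_mul_of_pos_left hyr hθ)
    rw [indicator_of_mem hyr, indicator_of_mem this]
  · rw [indicator_of_notMem hyr]
    exact bot_le

lemma le_lintegral_ball [BorelSpace X] [PolishSpace X] (h : IsChart m ε c U φ) (hε : 0 < ε)
    (hg : Measurable g)
    (hom : ∀ t : ℝ, 0 < t → ∀ w, g (t • w) = ENNReal.ofReal t ^ q * g w) (hx : x ∈ U)
    {M : ℝ≥0∞} (hM : ∀ w ∈ ball (0 : EuclideanSpace ℝ (Fin d)) 1, g w ≤ M)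
    {s : ℝ} (hs : 0 < s) :
    ENNReal.ofReal c * (ENNReal.ofReal s ^ d * ENNReal.ofReal s ^ q) * ((∫⁻ w in ball 0 1, g w) -
      M * volume (ball (0 : EuclideanSpace ℝ (Fin d)) 1) *
        (volume (ball (φ x) s ∩ (φ '' U)ᶜ) / volume (ball (φ x) s)))
      ≤ ∫⁻ y in ball x ((1 + ε) * s) ∩ U, g (φ y - φ x) ∂m := by
  have hθ : 0 < 1 + ε := by linarith
  have hgm : Measurable fun z => g (z - φ x) := hg.comp (measurable_id.sub_const _)
  set σ := ENNReal.ofReal s with hσ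
  have hσ0 : σ ≠ 0 := (ENNReal.ofReal_pos.2 hs).ne'
  have hσq : σ ^ d * σ ^ q ≠ ∞ := ENNReal.mul_ne_top (ENNReal.pow_ne_top ENNReal.ofReal_ne_top)
    (ENNReal.rpow_ne_top_of_ne_zero hσ0 ENNReal.ofReal_ne_top)
  have hvol : volume (ball (φ x) s) = σ ^ d * volume (ball (0 : EuclideanSpace ℝ (Fin d)) 1) := by
    have := lintegral_ball_of_homogeneous (d := d) (g := fun _ => 1) measurable_const (q := 0)
      (by simp) (φ x) hs
    simpa using this
  -- the part of the ball outside the image of the chart is negligible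
  have h1 : ∫⁻ z in ball (φ x) s, g (z - φ x) ≤ (∫⁻ z in ball (φ x) s ∩ φ '' U, g (z - φ x)) +
      σ ^ q * M * volume (ball (φ x) s ∩ (φ '' U)ᶜ) := by
    rw [← lintegral_inter_add_sdiff _ _ (h.measurableSet_image hε), ← sdiff_eq,
      ← setLIntegral_const]
    refine add_le_add le_rfl (setLIntegral_mono measurable_const fun z hz => ?_)
    have h2 : s⁻¹ • (z - φ x) ∈ ball (0 : EuclideanSpace ℝ (Fin d)) 1 := by
      have := hz.1
      rw [mem_ball, dist_eq_norm] at this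
      rw [mem_ball_zero_iff, norm_smul, norm_inv, Real.norm_of_nonneg hs.le,
        inv_mul_lt_iff₀ hs, mul_one]
      exact this
    calc g (z - φ x) = g (s • s⁻¹ • (z - φ x)) := by rw [smul_inv_smul₀ hs.ne']
      _ ≤ σ ^ q * M := by
        rw [hom s hs]
        exact mul_le_mul' le_rfl (hM _ h2)
  have h3 : ENNReal.ofReal c * ∫⁻ z in ball (φ x) s ∩ φ '' U, g (z - φ x)
      ≤ ∫⁻ y in ball x ((1 + ε) * s) ∩ U, g (φ y - φ x) ∂m := by
    rw [← Measure.restrict_restrict measurableSet_ball, ← lintegral_indicator measurableSet_ball,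
      ← Measure.restrict_restrict measurableSet_ball, ← lintegral_indicator measurableSet_ball]
    refine (h.le_lintegral_comp hε (hgm.indicator measurableSet_ball)).trans ?_
    refine lintegral_mono_ae ((ae_restrict_iff' h.measurableSet).2 (.of_forall fun y hy => ?_))
    by_cases hyr : φ y ∈ ball (φ x) s
    · have : y ∈ ball x ((1 + ε) * s) :=
        (h.lower y hy x hx).trans_lt (mul_lt_mul_of_pos_left hyr hθ)
      rw [indicator_of_mem hyr, indicator_of_mem this]
    · rw [indicator_of_notMem hyr]
      exact bot_le
  refine le_trans ?_ h3
  rw [mul_assoc]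
  refine mul_le_mul' le_rfl ?_
  rw [ENNReal.mul_sub (fun _ _ => hσq), tsub_le_iff_right,
    ← lintegral_ball_of_homogeneous hg hom (φ x) hs]
  refine h1.trans (add_le_add le_rfl (le_of_eq ?_))
  have hv0 : volume (ball (φ x) s) ≠ 0 := (Metric.measure_ball_pos volume _ hs).ne'
  calc σ ^ q * M * volume (ball (φ x) s ∩ (φ '' U)ᶜ)
      = σ ^ q * M * (volume (ball (φ x) s ∩ (φ '' U)ᶜ) / volume (ball (φ x) s) *
          volume (ball (φ x) s)) := by
        rw [ENNReal.div_mul_cancel hv0 measure_ball_lt_top.ne]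
    _ = _ := by
        set β := volume (ball (φ x) s ∩ (φ '' U)ᶜ) / volume (ball (φ x) s)
        rw [hvol]; ring

variable [BorelSpace X] [PolishSpace X]

/-- Blowing up a homogeneous function in a chart, at a point where both the chart and its image
have density one: upper bound. -/
lemma limsup_blowUpAverage_le (h : IsChart m ε c U φ) (hε : 0 < ε) (hg : Measurable g)
    (hom : ∀ t : ℝ, 0 < t → ∀ w, g (t • w) = ENNReal.ofReal t ^ q * g w) (hx : x ∈ U)
    (hφ : IsRarePoint volume (φ '' U)ᶜ (φ x)) :
    limsup (blowUpAverage m U φ g q x) (𝓝[>] 0) ≤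
      distortion d q ε *
        ((∫⁻ w in ball 0 1, g w) / volume (ball (0 : EuclideanSpace ℝ (Fin d)) 1)) := by
  have hθ : 0 < 1 + ε := by linarith
  set T := ENNReal.ofReal (1 + ε) with hT
  set k := ENNReal.ofReal c with hk
  set ω := volume (ball (0 : EuclideanSpace ℝ (Fin d)) 1) with hω
  set I := ∫⁻ w in ball (0 : EuclideanSpace ℝ (Fin d)) 1, g w with hI
  have hω0 : ω ≠ 0 := (Metric.measure_ball_pos volume _ one_pos).ne'
  have hωt : ω ≠ ∞ := measure_ball_lt_top.ne
  set β : ℝ → ℝ≥0∞ := fun r => volume (ball (φ x) (r / (1 + ε)) ∩ (φ '' U)ᶜ) /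
    volume (ball (φ x) (r / (1 + ε))) with hβ
  have hβ0 : Tendsto (fun r => ω - ω * β r) (𝓝[>] 0) (𝓝 ω) := by
    have h1 : Tendsto β (𝓝[>] 0) (𝓝 0) := hφ.comp (tendsto_div_nhdsGT_zero hθ)
    have h2 := ENNReal.Tendsto.sub (tendsto_const_nhds (x := ω))
      (ENNReal.Tendsto.const_mul h1 (Or.inr hωt)) (Or.inl hωt)
    simpa using h2
  have hlim : Tendsto (fun r => distortion d q ε * (I / (ω - ω * β r))) (𝓝[>] 0)
      (𝓝 (distortion d q ε * (I / ω))) :=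
    ENNReal.Tendsto.const_mul (ENNReal.Tendsto.const_div hβ0 (Or.inl hωt))
      (Or.inr (distortion_ne_top hε))
  rw [← hlim.limsup_eq]
  refine limsup_le_limsup ?_
  filter_upwards [self_mem_nhdsWithin, hβ0.eventually_ne hω0] with r hr hr0
  have hr : 0 < r := hr
  set ρ := ENNReal.ofReal r with hρ
  have hρ0 : ρ ≠ 0 := (ENNReal.ofReal_pos.2 hr).ne'
  have hTρ : ENNReal.ofReal ((1 + ε) * r) = T * ρ := ENNReal.ofReal_mul hθ.le
  set σ := ENNReal.ofReal (r / (1 + ε)) with hσ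
  have hρσ : ρ = T * σ := by
    rw [hρ, hT, hσ, ← ENNReal.ofReal_mul hθ.le, mul_div_cancel₀ _ hθ.ne']
  have hJ := h.lintegral_ball_le hε hg hom hx hr
  have hB := h.le_lintegral_ball (g := fun _ => 1) (q := 0) (M := 1) hε measurable_const
    (by simp) hx (fun _ _ => le_rfl) (s := r / (1 + ε)) (by positivity)
  rw [mul_div_cancel₀ _ hθ.ne'] at hB
  simp only [ENNReal.rpow_zero, mul_one, one_mul, setLIntegral_one] at hB
  have hB' : k * σ ^ d * (ω - ω * β r) ≤ m (ball x r) :=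
    hB.trans (measure_mono inter_subset_left)
  refine ENNReal.div_le_of_le_mul (hJ.trans ?_)
  have hsubt : ω - ω * β r ≠ ∞ := (tsub_le_self.trans_lt hωt.lt_top).ne
  calc ENNReal.ofReal ((1 + ε) * c) * (ENNReal.ofReal ((1 + ε) * r) ^ d *
        ENNReal.ofReal ((1 + ε) * r) ^ q * I)
      = T * k * (T ^ d * (T * σ) ^ d * (T ^ q * ρ ^ q) * I) := by
        rw [hTρ, ENNReal.mul_rpow_of_ne_top ENNReal.ofReal_ne_top ENNReal.ofReal_ne_top, mul_pow,
          ENNReal.ofReal_mul hθ.le, ← hρσ]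
    _ = distortion d q ε * I * ρ ^ q * (k * σ ^ d) := by
        rw [distortion, mul_pow]; ring
    _ = distortion d q ε * (I / (ω - ω * β r)) * (ρ ^ q * (k * σ ^ d * (ω - ω * β r))) := by
        rw [div_eq_mul_inv]
        have := ENNReal.inv_mul_cancel hr0 hsubt
        calc _ = distortion d q ε * I * ρ ^ q * (k * σ ^ d) *
              ((ω - ω * β r)⁻¹ * (ω - ω * β r)) := by rw [this, mul_one]
          _ = _ := by ring
    _ ≤ _ := by gcongr

/-- Blowing up a homogeneous function in a chart, at a point where both the chart and its image
have density one: lower bound. -/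
lemma le_liminf_blowUpAverage (hm : IsReferenceMeasure m) (hd : UniformlyLocallyDoubling m)
    (h : IsChart m ε c U φ) (hε : 0 < ε) (hg : Measurable g)
    (hom : ∀ t : ℝ, 0 < t → ∀ w, g (t • w) = ENNReal.ofReal t ^ q * g w)
    {M : ℝ≥0∞} (hMtop : M ≠ ∞) (hM : ∀ w ∈ ball (0 : EuclideanSpace ℝ (Fin d)) 1, g w ≤ M)
    (hx : x ∈ U)
    (hU : IsRarePoint m Uᶜ x) (hφ : IsRarePoint volume (φ '' U)ᶜ (φ x)) :
    ((∫⁻ w in ball 0 1, g w) / volume (ball (0 : EuclideanSpace ℝ (Fin d)) 1)) ≤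
      distortion d q ε * liminf (blowUpAverage m U φ g q x) (𝓝[>] 0) := by
  have hθ : 0 < 1 + ε := by linarith
  set T := ENNReal.ofReal (1 + ε) with hT
  set k := ENNReal.ofReal c with hk
  set ω := volume (ball (0 : EuclideanSpace ℝ (Fin d)) 1) with hω
  set I := ∫⁻ w in ball (0 : EuclideanSpace ℝ (Fin d)) 1, g w with hI
  have hω0 : ω ≠ 0 := (Metric.measure_ball_pos volume _ one_pos).ne'
  have hωt : ω ≠ ∞ := measure_ball_lt_top.ne
  have hIt : I ≠ ∞ := by
    refine ((setLIntegral_mono measurable_const hM).trans_lt ?_).ne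
    rw [setLIntegral_const]
    exact ENNReal.mul_lt_top hMtop.lt_top hωt.lt_top
  set β : ℝ → ℝ≥0∞ := fun r => volume (ball (φ x) (r / (1 + ε)) ∩ (φ '' U)ᶜ) /
    volume (ball (φ x) (r / (1 + ε))) with hβ
  set α : ℝ → ℝ≥0∞ := fun r => m (ball x r ∩ Uᶜ) / m (ball x r) with hα
  have hlim : Tendsto (fun r => (I - M * ω * β r) * (1 - α r) / (distortion d q ε * ω)) (𝓝[>] 0)
      (𝓝 (I / (distortion d q ε * ω))) := by
    have h1 : Tendsto β (𝓝[>] 0) (𝓝 0) := hφ.comp (tendsto_div_nhdsGT_zero hθ)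
    have h2 : Tendsto (fun r => I - M * ω * β r) (𝓝[>] 0) (𝓝 I) := by
      have h2 := ENNReal.Tendsto.sub (tendsto_const_nhds (x := I))
        (ENNReal.Tendsto.const_mul h1 (Or.inr (ENNReal.mul_ne_top hMtop hωt))) (Or.inl hIt)
      simpa using h2
    have h3 : Tendsto (fun r => 1 - α r) (𝓝[>] 0) (𝓝 1) := by
      have h3 := ENNReal.Tendsto.sub (tendsto_const_nhds (x := (1 : ℝ≥0∞))) hU
        (Or.inl ENNReal.one_ne_top)
      simpa using h3
    have h4 := ENNReal.Tendsto.mul h2 (Or.inr ENNReal.one_ne_top) h3 (Or.inr hIt)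
    rw [mul_one] at h4
    exact ENNReal.Tendsto.div_const h4 (Or.inr (mul_ne_zero (distortion_ne_zero hε) hω0))
  have hD0 := distortion_ne_zero (d := d) (q := q) hε
  have hDt := distortion_ne_top (d := d) (q := q) hε
  have key : I / (distortion d q ε * ω) ≤ liminf (blowUpAverage m U φ g q x) (𝓝[>] 0) := by
    rw [← hlim.liminf_eq]
    refine liminf_le_liminf ?_
    filter_upwards [self_mem_nhdsWithin] with r hr
    have hr : 0 < r := hr
    have hpos := measure_ball_pos hm hd x hr
    have hfin := (hm.measure_ball_lt_top x r).ne
    set ρ := ENNReal.ofReal r with hρ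
    have hρ0 : ρ ≠ 0 := (ENNReal.ofReal_pos.2 hr).ne'
    have hρq0 : ρ ^ q ≠ 0 := (ENNReal.rpow_pos (pos_iff_ne_zero.2 hρ0) ENNReal.ofReal_ne_top).ne'
    have hρqt : ρ ^ q ≠ ∞ := ENNReal.rpow_ne_top_of_ne_zero hρ0 ENNReal.ofReal_ne_top
    set σ := ENNReal.ofReal (r / (1 + ε)) with hσ
    have hρσ : ρ = T * σ := by
      rw [hρ, hT, hσ, ← ENNReal.ofReal_mul hθ.le, mul_div_cancel₀ _ hθ.ne']
    have hJ := h.le_lintegral_ball hε hg hom hx hM (s := r / (1 + ε)) (by positivity)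
    rw [mul_div_cancel₀ _ hθ.ne'] at hJ
    have hB := h.lintegral_ball_le (g := fun _ => 1) (q := 0) hε measurable_const
      (by simp) hx hr
    simp only [ENNReal.rpow_zero, mul_one, setLIntegral_one] at hB
    have hBU : (1 - α r) * m (ball x r) ≤ m (ball x r ∩ U) := by
      rw [ENNReal.sub_mul (fun _ _ => hfin), one_mul, hα]
      dsimp only
      rw [ENNReal.div_mul_cancel hpos.ne' hfin, tsub_le_iff_right,
        ← measure_inter_add_sdiff (ball x r) h.measurableSet, sdiff_eq]
    refine ENNReal.div_le_of_le_mul ?_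
    rw [blowUpAverage, ← ENNReal.mul_div_right_comm, ENNReal.le_div_iff_mul_le
      (Or.inl (mul_ne_zero hρq0 hpos.ne')) (Or.inl (ENNReal.mul_ne_top hρqt hfin))]
    calc (I - M * ω * β r) * (1 - α r) * (ρ ^ q * m (ball x r))
        = (I - M * ω * β r) * ρ ^ q * ((1 - α r) * m (ball x r)) := by ring
      _ ≤ (I - M * ω * β r) * ρ ^ q * (T * k * ((T * ρ) ^ d * ω)) := by
          refine mul_le_mul' le_rfl (hBU.trans (hB.trans_eq ?_))
          rw [ENNReal.ofReal_mul hθ.le, ENNReal.ofReal_mul hθ.le]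
      _ = k * (σ ^ d * σ ^ q) * (I - M * ω * β r) * (distortion d q ε * ω) := by
          rw [hρσ, distortion, ENNReal.mul_rpow_of_ne_top ENNReal.ofReal_ne_top
            ENNReal.ofReal_ne_top, mul_pow, mul_pow]
          ring
      _ ≤ _ := by gcongr
  calc I / ω = distortion d q ε * (I / (distortion d q ε * ω)) := by
        rw [div_eq_mul_inv, div_eq_mul_inv, ENNReal.mul_inv (Or.inl hD0) (Or.inl hDt)]
        calc _ = (distortion d q ε * (distortion d q ε)⁻¹) * (I * ω⁻¹) := by
              rw [ENNReal.mul_inv_cancel hD0 hDt, one_mul]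
          _ = _ := by ring
    _ ≤ _ := mul_le_mul' le_rfl key

end IsChart

end Charts

/-! ### Energy densities and differentials in a chart -/

section ChartDifferential

variable {X Y : Type*} [MetricSpace X] [MeasurableSpace X] {m : Measure X} [MetricSpace Y] {d : ℕ}

/-- In the chart `(U, φ)`, the seminorm `ν` is an approximate metric differential of `u` at `x`: for
every `η > 0` the points `y` of the chart with `|d (u y, u x) - ν (φ y - φ x)| > η d (y, x)` have
density zero at `x`. -/
def HasChartDifferentialAt (m : Measure X) (U : Set X) (φ : X → EuclideanSpace ℝ (Fin d))
    (u : X → Y) (ν : Seminorm ℝ (EuclideanSpace ℝ (Fin d))) (x : X) : Prop :=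
  ∀ η : ℝ, 0 < η →
    IsRarePoint m {y ∈ U | η * dist y x < |dist (u y) (u x) - ν (φ y - φ x)|} x

/-- The `p`-th power of the `p`-size of a seminorm, as an extended real. -/
def seminormMean (p : ℝ) (ν : Seminorm ℝ (EuclideanSpace ℝ (Fin d))) : ℝ≥0∞ :=
  (∫⁻ w in ball 0 1, ENNReal.ofReal (ν w) ^ p) /
    volume (ball (0 : EuclideanSpace ℝ (Fin d)) 1)

lemma exists_seminorm_le (ν : Seminorm ℝ (EuclideanSpace ℝ (Fin d))) :
    ∃ L : ℝ≥0, ∀ w, ν w ≤ L * ‖w‖ := by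
  set b := EuclideanSpace.basisFun (Fin d) ℝ with hb
  refine ⟨⟨∑ i, ν (b i), Finset.sum_nonneg fun i _ => apply_nonneg ν _⟩, fun w => ?_⟩
  calc ν w = ν (∑ i, b.repr w i • b i) := by rw [b.sum_repr]
    _ ≤ ∑ i, ν (b.repr w i • b i) :=
        Finset.le_sum_of_subadditive ν (map_zero ν).le (map_add_le_add ν) _ _
    _ ≤ ∑ i, ν (b i) * ‖w‖ := by
        refine Finset.sum_le_sum fun i _ => ?_
        rw [map_smul_eq_mul, mul_comm]
        gcongr
        exact (PiLp.norm_apply_le (b.repr w) i).trans_eq (b.repr.norm_map w)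
    _ = _ := by rw [← Finset.sum_mul]; rfl

lemma continuous_seminorm (ν : Seminorm ℝ (EuclideanSpace ℝ (Fin d))) : Continuous ν := by
  obtain ⟨L, hL⟩ := exists_seminorm_le ν
  refine (LipschitzWith.of_dist_le_mul (K := L) fun x y => ?_).continuous
  rw [Real.dist_eq, dist_eq_norm]
  exact (abs_sub_map_le_sub ν x y).trans (hL _)

lemma IsRarePoint.toMeasurable [OpensMeasurableSpace X] [SFinite m] {E : Set X} {x : X}
    (h : IsRarePoint m E x) : IsRarePoint m (MeasureTheory.toMeasurable m E) x := by
  refine h.congr fun r => ?_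
  rw [inter_comm _ (MeasureTheory.toMeasurable m E), Measure.measure_toMeasurable_inter_of_sFinite
    measurableSet_ball, inter_comm]

/-- A set of density zero does not contribute to averages of `(a + G) ^ p` over small balls around
a Lebesgue point of `G ^ p`. -/
lemma IsRarePoint.tendsto_average_indicator
    {E : Set X} (hE : MeasurableSet E) {x : X}
    (h : IsRarePoint m E x) {p : ℝ} (hp : 1 < p) {G : X → ℝ≥0} (a : ℝ≥0)
    (hL : Tendsto (fun r => (∫⁻ y in ball x r, ‖(G y : ℝ) ^ p - (G x : ℝ) ^ p‖ₑ ∂m) / m (ball x r))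
      (𝓝[>] 0) (𝓝 0)) :
    Tendsto (fun r => (∫⁻ y in ball x r, (E.indicator (fun y => (a + G y : ℝ≥0∞)) y) ^ p ∂m) /
      m (ball x r)) (𝓝[>] 0) (𝓝 0) := by
  have hp0 : 0 < p := by linarith
  have h2 : (2 : ℝ≥0∞) ^ (p - 1) ≠ ∞ :=
    ENNReal.rpow_ne_top_of_nonneg (by linarith) (by simp)
  set K : ℝ≥0∞ := (a : ℝ≥0∞) ^ p + (G x : ℝ≥0∞) ^ p with hK
  have hKt : K ≠ ∞ := ENNReal.add_ne_top.2
    ⟨ENNReal.rpow_ne_top_of_nonneg hp0.le ENNReal.coe_ne_top,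
      ENNReal.rpow_ne_top_of_nonneg hp0.le ENNReal.coe_ne_top⟩
  have hlim := ENNReal.Tendsto.const_mul
    ((ENNReal.Tendsto.const_mul h (Or.inr hKt)).add hL) (Or.inr h2)
  simp only [mul_zero, add_zero] at hlim
  refine tendsto_of_tendsto_of_tendsto_of_le_of_le tendsto_const_nhds hlim (fun _ => bot_le)
    fun r => ?_
  dsimp only
  have hGx : ∀ y, ENNReal.ofReal ((G y : ℝ) ^ p) = (G y : ℝ≥0∞) ^ p := fun y => by
    rw [← ENNReal.ofReal_rpow_of_nonneg (G y).coe_nonneg hp0.le,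
      ENNReal.ofReal_coe_nnreal]
  have hpt : ∀ y, (E.indicator (fun y => (a + G y : ℝ≥0∞)) y) ^ p ≤
      2 ^ (p - 1) * (K * E.indicator 1 y + ‖(G y : ℝ) ^ p - (G x : ℝ) ^ p‖ₑ) := by
    intro y
    by_cases hy : y ∈ E
    · rw [indicator_of_mem hy, indicator_of_mem hy, Pi.one_apply, mul_one, hK, add_assoc]
      refine (ENNReal.rpow_add_le_mul_rpow_add_rpow _ _ hp.le).trans ?_
      gcongr
      rw [← hGx y, ← hGx x, Real.enorm_eq_ofReal_abs, ← ENNReal.ofReal_add (by positivity)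
        (abs_nonneg _)]
      exact ENNReal.ofReal_le_ofReal (by linarith [le_abs_self ((G y : ℝ) ^ p - (G x : ℝ) ^ p)])
    · rw [indicator_of_notMem hy, ENNReal.zero_rpow_of_pos hp0]
      exact bot_le
  calc (∫⁻ y in ball x r, (E.indicator (fun y => (a + G y : ℝ≥0∞)) y) ^ p ∂m) / m (ball x r)
      ≤ (∫⁻ y in ball x r, 2 ^ (p - 1) * (K * E.indicator 1 y +
          ‖(G y : ℝ) ^ p - (G x : ℝ) ^ p‖ₑ) ∂m) / m (ball x r) := by
        gcongr with y
        exact hpt y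
    _ = _ := by
        rw [lintegral_const_mul' _ _ h2, lintegral_add_left
          ((measurable_one.indicator hE).const_mul _), lintegral_const_mul' _ _ hKt,
          lintegral_indicator_one hE, Measure.restrict_apply hE, inter_comm E, mul_div_assoc,
          ENNReal.add_div, mul_div_assoc]

omit [MetricSpace X] in
/-- Minkowski's inequality with a constant term, for measures of mass at most one. -/
lemma lintegral_rpow_le_of_le_add {μ : Measure X} (hμ : μ univ ≤ 1) {p : ℝ} (hp : 1 < p)
    {f a b : X → ℝ≥0∞} {η : ℝ≥0∞} (ha : AEMeasurable a μ) (hb : AEMeasurable b μ)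
    (h : ∀ᵐ y ∂μ, f y ≤ a y + b y + η) :
    (∫⁻ y, f y ^ p ∂μ) ^ (1 / p) ≤
      (∫⁻ y, a y ^ p ∂μ) ^ (1 / p) + (∫⁻ y, b y ^ p ∂μ) ^ (1 / p) + η := by
  have hp0 : 0 < p := by linarith
  have hη : (∫⁻ _, η ^ p ∂μ) ^ (1 / p) ≤ η := by
    rw [lintegral_const]
    calc (η ^ p * μ univ) ^ (1 / p) ≤ (η ^ p * 1) ^ (1 / p) := by gcongr
      _ = η := by rw [mul_one, one_div, ENNReal.rpow_rpow_inv hp0.ne']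
  calc (∫⁻ y, f y ^ p ∂μ) ^ (1 / p)
      ≤ (∫⁻ y, ((a + b) + (fun _ => η : X → ℝ≥0∞)) y ^ p ∂μ) ^ (1 / p) := by
        refine ENNReal.rpow_le_rpow (lintegral_mono_ae ?_) (by positivity)
        filter_upwards [h] with y hy
        exact ENNReal.rpow_le_rpow hy hp0.le
    _ ≤ (∫⁻ y, (a + b) y ^ p ∂μ) ^ (1 / p) + (∫⁻ _, η ^ p ∂μ) ^ (1 / p) :=
        ENNReal.lintegral_Lp_add_le (ha.add hb) aemeasurable_const hp.le
    _ ≤ _ := add_le_add (ENNReal.lintegral_Lp_add_le ha hb hp.le) hη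

variable [BorelSpace X] [PolishSpace X] {u : X → Y} {p : ℝ} {U : Set X}
  {φ : X → EuclideanSpace ℝ (Fin d)} {ν : Seminorm ℝ (EuclideanSpace ℝ (Fin d))} {x : X}
  {G : X → ℝ≥0} {ε c : ℝ}

/-- At a point of chart differentiability the energy densities are asymptotic to the averages of
the differential, blown up in the chart. -/
lemma HasChartDifferentialAt.eventually_ksDensity_le (hm : IsReferenceMeasure m)
    (hp : 1 < p) (hc : IsChart m ε c U φ) (hε : 0 < ε)
    (hu : AEStronglyMeasurable u m) (hG : Measurable G)
    (hν : HasChartDifferentialAt m U φ u ν x) (hx : x ∈ U) (hU : IsRarePoint m Uᶜ x)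
    (hH : ∀ᵐ y ∂m, dist x y < 1 / 4 → edist (u x) (u y) ≤ edist x y * (G x + G y))
    (hL : Tendsto (fun r => (∫⁻ y in ball x r, ‖(G y : ℝ) ^ p - (G x : ℝ) ^ p‖ₑ ∂m) / m (ball x r))
      (𝓝[>] 0) (𝓝 0)) {δ : ℝ≥0} (hδ : 0 < δ) :
    (∀ᶠ r in 𝓝[>] 0, ksDensity m p r u x ≤
      blowUpAverage m U φ (fun w => ENNReal.ofReal (ν w) ^ p) p x r ^ (1 / p) + δ) ∧
    (∀ᶠ r in 𝓝[>] 0, blowUpAverage m U φ (fun w => ENNReal.ofReal (ν w) ^ p) p x r ^ (1 / p) ≤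
      ksDensity m p r u x + δ) := by
  have : IsLocallyFiniteMeasure m := hm.isLocallyFiniteMeasure
  have hp0 : 0 < p := by linarith
  obtain ⟨L, hνL⟩ := exists_seminorm_le ν
  set η : ℝ := δ / 2 with hη
  have hη0 : 0 < η := by positivity
  have hηδ : ENNReal.ofReal η = δ / 2 := by
    rw [hη, ENNReal.ofReal_div_of_pos two_pos, ENNReal.ofReal_coe_nnreal]; norm_num
  -- the exceptional set
  set E : Set X := MeasureTheory.toMeasurable m
    ({y ∈ U | η * dist y x < |dist (u y) (u x) - ν (φ y - φ x)|} ∪ Uᶜ) with hE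
  have hEm : MeasurableSet E := measurableSet_toMeasurable _ _
  have hErare : IsRarePoint m E x := ((hν η hη0).union hU).toMeasurable
  have hEU : ∀ y ∉ E, y ∈ U ∧ |dist (u y) (u x) - ν (φ y - φ x)| ≤ η * dist y x := by
    intro y hy
    have h1 : y ∉ {y ∈ U | η * dist y x < |dist (u y) (u x) - ν (φ y - φ x)|} ∪ Uᶜ :=
      fun h => hy (subset_toMeasurable _ _ h)
    have h2 : y ∈ U := by
      by_contra h; exact h1 (Or.inr h)
    exact ⟨h2, not_lt.1 fun h => h1 (Or.inl ⟨h2, h⟩)⟩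
  set K : ℝ≥0 := L * (1 + ε).toNNReal with hK
  set b₁ : X → ℝ≥0∞ := E.indicator fun y => (G x + G y : ℝ≥0∞) with hb₁
  set b₂ : X → ℝ≥0∞ := E.indicator fun y => (K + (0 : ℝ≥0) : ℝ≥0∞) with hb₂
  set R₁ : ℝ → ℝ≥0∞ := fun r => ((∫⁻ y in ball x r, b₁ y ^ p ∂m) / m (ball x r)) ^ (1 / p) with hR₁
  set R₂ : ℝ → ℝ≥0∞ := fun r => ((∫⁻ y in ball x r, b₂ y ^ p ∂m) / m (ball x r)) ^ (1 / p) with hR₂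
  have hz : (0 : ℝ≥0∞) ^ (1 / p) = 0 := ENNReal.zero_rpow_of_pos (by positivity)
  have hR₁0 : Tendsto R₁ (𝓝[>] 0) (𝓝 0) := by
    have := (hErare.tendsto_average_indicator hEm hp (G x) hL).ennrpow_const (1 / p)
    rwa [hz] at this
  have hR₂0 : Tendsto R₂ (𝓝[>] 0) (𝓝 0) := by
    have := (hErare.tendsto_average_indicator (G := fun _ => 0) hEm hp K
      (by simp)).ennrpow_const (1 / p)
    rwa [hz] at this
  have hb₁m : Measurable b₁ := (hG.coe_nnreal_ennreal.const_add _).indicator hEm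
  have hb₂m : Measurable b₂ := measurable_const.indicator hEm
  -- the difference quotients of `u` and of its differential
  set f : ℝ → X → ℝ≥0∞ := fun r y => edist (u x) (u y) / ENNReal.ofReal r with hf
  set a : ℝ → X → ℝ≥0∞ := fun r =>
    U.indicator fun y => ENNReal.ofReal (ν (φ y - φ x)) / ENNReal.ofReal r with ha
  have hfm : ∀ r, AEMeasurable (f r) m := fun r =>
    (aestronglyMeasurable_const.edist hu).div_const _
  have ham : ∀ r, AEMeasurable (a r) m := fun r => by
    refine (aemeasurable_indicator_iff hc.measurableSet).2 (AEMeasurable.div_const ?_ _)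
    exact ((continuous_seminorm ν).measurable.comp_aemeasurable
      ((hc.aemeasurable hε).sub_const _)).ennreal_ofReal
  -- normalised measures on the balls
  set μ : ℝ → Measure X := fun r => (m (ball x r))⁻¹ • m.restrict (ball x r) with hμ
  have hμint : ∀ r (g : X → ℝ≥0∞), ∫⁻ y, g y ∂(μ r) =
      (∫⁻ y in ball x r, g y ∂m) / m (ball x r) := by
    intro r g
    rw [hμ, lintegral_smul_measure, smul_eq_mul, mul_comm, div_eq_mul_inv]
  have hμ1 : ∀ r, μ r univ ≤ 1 := by
    intro r
    simp only [hμ, Measure.smul_apply, Measure.restrict_apply_univ, smul_eq_mul]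
    exact ENNReal.inv_mul_le_one _
  have hμac : ∀ r {P : X → Prop}, (∀ᵐ y ∂m, y ∈ ball x r → P y) → ∀ᵐ y ∂(μ r), P y := by
    intro r P h
    exact Measure.ae_smul_measure ((ae_restrict_iff' measurableSet_ball).2 h) _
  have hμm : ∀ r {g : X → ℝ≥0∞}, AEMeasurable g m → AEMeasurable g (μ r) := fun r g h =>
    h.restrict.smul_measure _
  have hks : ∀ r, 0 < r → ksDensity m p r u x = (∫⁻ y, f r y ^ p ∂(μ r)) ^ (1 / p) := by
    intro r hr
    rw [hμint, ← ksDensity_rpow hp0, one_div, ENNReal.rpow_rpow_inv hp0.ne']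
  have hav : ∀ r, 0 < r → blowUpAverage m U φ (fun w => ENNReal.ofReal (ν w) ^ p) p x r =
      ∫⁻ y, a r y ^ p ∂(μ r) := by
    intro r hr
    have hr0 : ENNReal.ofReal r ≠ 0 := (ENNReal.ofReal_pos.2 hr).ne'
    have hrp0 : ENNReal.ofReal r ^ p ≠ 0 :=
      (ENNReal.rpow_pos (pos_iff_ne_zero.2 hr0) ENNReal.ofReal_ne_top).ne'
    have hrpt : ENNReal.ofReal r ^ p ≠ ∞ := ENNReal.rpow_ne_top_of_nonneg hp0.le
      ENNReal.ofReal_ne_top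
    have e1 : ∀ y, a r y ^ p = U.indicator (fun y => ENNReal.ofReal (ν (φ y - φ x)) ^ p) y *
        (ENNReal.ofReal r ^ p)⁻¹ := by
      intro y
      by_cases hy : y ∈ U
      · simp only [ha, indicator_of_mem hy]
        rw [ENNReal.div_rpow_of_nonneg _ _ hp0.le, div_eq_mul_inv]
      · simp only [ha, indicator_of_notMem hy, zero_mul]
        exact ENNReal.zero_rpow_of_pos hp0
    rw [hμint, blowUpAverage]
    simp only [e1]
    rw [lintegral_mul_const' _ _ (ENNReal.inv_ne_top.2 hrp0), lintegral_indicator hc.measurableSet,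
      Measure.restrict_restrict hc.measurableSet, inter_comm U, div_eq_mul_inv, div_eq_mul_inv,
      ENNReal.mul_inv (Or.inl hrp0) (Or.inl hrpt), mul_assoc]
  have hquot : ∀ r y, 0 < r → y ∈ ball x r →
      ENNReal.ofReal (η * dist y x) / ENNReal.ofReal r ≤ ENNReal.ofReal η := by
    intro r y hr hy
    refine ENNReal.div_le_of_le_mul ?_
    rw [← ENNReal.ofReal_mul hη0.le]
    exact ENNReal.ofReal_le_ofReal (mul_le_mul_of_nonneg_left (mem_ball.1 hy).le hη0.le)
  have hup : ∀ r, 0 < r → r < 1 / 4 → ksDensity m p r u x ≤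
      blowUpAverage m U φ (fun w => ENNReal.ofReal (ν w) ^ p) p x r ^ (1 / p) + R₁ r +
        ENNReal.ofReal η := by
    intro r hr hr4
    rw [hks r hr, hav r hr]
    simp only [hR₁]
    rw [← hμint]
    refine lintegral_rpow_le_of_le_add (hμ1 r) hp (hμm r (ham r)) (hμm r hb₁m.aemeasurable)
      (hμac r ?_)
    filter_upwards [hH] with y hy hyr
    by_cases hyE : y ∈ E
    · refine le_trans ?_ (le_self_add.trans' le_add_self)
      simp only [hf, hb₁, indicator_of_mem hyE]
      have hxy : dist x y < r := by rw [dist_comm]; exact hyr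
      refine ENNReal.div_le_of_le_mul ((hy (hxy.trans hr4)).trans ?_)
      rw [mul_comm]
      gcongr
      rw [edist_dist]
      exact ENNReal.ofReal_le_ofReal hxy.le
    · obtain ⟨hyU, h1⟩ := hEU y hyE
      simp only [hf, ha, hb₁, indicator_of_notMem hyE, indicator_of_mem hyU, add_zero]
      calc edist (u x) (u y) / ENNReal.ofReal r
          ≤ (ENNReal.ofReal (ν (φ y - φ x)) + ENNReal.ofReal (η * dist y x)) /
              ENNReal.ofReal r := by
            gcongr
            rw [edist_comm, edist_dist, ← ENNReal.ofReal_add (apply_nonneg ν _) (by positivity)]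
            exact ENNReal.ofReal_le_ofReal (by linarith [(abs_le.1 h1).2])
        _ ≤ _ := by
            rw [ENNReal.add_div]
            exact add_le_add le_rfl (hquot r y hr hyr)
  have hlo : ∀ r, 0 < r →
      blowUpAverage m U φ (fun w => ENNReal.ofReal (ν w) ^ p) p x r ^ (1 / p) ≤
        ksDensity m p r u x + R₂ r + ENNReal.ofReal η := by
    intro r hr
    rw [hks r hr, hav r hr]
    simp only [hR₂]
    rw [← hμint]
    refine lintegral_rpow_le_of_le_add (hμ1 r) hp (hμm r (hfm r)) (hμm r hb₂m.aemeasurable)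
      (hμac r (.of_forall fun y hyr => ?_))
    by_cases hyU : y ∈ U
    swap
    · simp only [ha, indicator_of_notMem hyU]
      exact bot_le
    by_cases hyE : y ∈ E
    · refine le_trans ?_ (le_self_add.trans' le_add_self)
      simp only [ha, hb₂, indicator_of_mem hyE, indicator_of_mem hyU, ENNReal.coe_zero, add_zero]
      refine ENNReal.div_le_of_le_mul ?_
      rw [← ENNReal.ofReal_coe_nnreal, ← ENNReal.ofReal_mul K.coe_nonneg]
      refine ENNReal.ofReal_le_ofReal ((hνL _).trans ?_)
      rw [hK, NNReal.coe_mul, Real.coe_toNNReal _ (by linarith), mul_assoc]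
      refine mul_le_mul_of_nonneg_left ?_ L.coe_nonneg
      rw [← dist_eq_norm]
      exact (hc.upper y hyU x hx).trans
        (mul_le_mul_of_nonneg_left (mem_ball.1 hyr).le (by linarith))
    · obtain ⟨-, h1⟩ := hEU y hyE
      simp only [hf, ha, hb₂, indicator_of_notMem hyE, indicator_of_mem hyU, add_zero]
      calc ENNReal.ofReal (ν (φ y - φ x)) / ENNReal.ofReal r
          ≤ (edist (u x) (u y) + ENNReal.ofReal (η * dist y x)) / ENNReal.ofReal r := by
            gcongr
            rw [edist_comm, edist_dist, ← ENNReal.ofReal_add dist_nonneg (by positivity)]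
            exact ENNReal.ofReal_le_ofReal (by linarith [(abs_le.1 h1).1])
        _ ≤ _ := by
            rw [ENNReal.add_div]
            exact add_le_add le_rfl (hquot r y hr hyr)
  have hδ2 : (0 : ℝ≥0∞) < δ / 2 := ENNReal.half_pos (by exact_mod_cast hδ.ne')
  constructor
  · filter_upwards [(ENNReal.tendsto_nhds_zero.1 hR₁0) _ hδ2,
      Ioo_mem_nhdsGT (show (0 : ℝ) < 1 / 4 by norm_num)] with r hr hr'
    refine (hup r hr'.1 hr'.2).trans ?_
    rw [hηδ, add_assoc]
    exact add_le_add le_rfl ((add_le_add hr le_rfl).trans_eq (ENNReal.add_halves _))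
  · filter_upwards [(ENNReal.tendsto_nhds_zero.1 hR₂0) _ hδ2, self_mem_nhdsWithin] with r hr hr'
    refine (hlo r hr').trans ?_
    rw [hηδ, add_assoc]
    exact add_le_add le_rfl ((add_le_add hr le_rfl).trans_eq (ENNReal.add_halves _))

lemma seminorm_rpow_homogeneous (ν : Seminorm ℝ (EuclideanSpace ℝ (Fin d))) {p : ℝ} (hp : 0 < p)
    (t : ℝ) (ht : 0 < t) (w : EuclideanSpace ℝ (Fin d)) :
    ENNReal.ofReal (ν (t • w)) ^ p = ENNReal.ofReal t ^ p * ENNReal.ofReal (ν w) ^ p := by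
  rw [map_smul_eq_mul, Real.norm_of_nonneg ht.le, ENNReal.ofReal_mul ht.le,
    ENNReal.mul_rpow_of_nonneg _ _ hp.le]

lemma measurable_seminorm_rpow (ν : Seminorm ℝ (EuclideanSpace ℝ (Fin d))) (p : ℝ) :
    Measurable fun w => ENNReal.ofReal (ν w) ^ p :=
  (continuous_seminorm ν).measurable.ennreal_ofReal.pow_const p

/-- At a point of chart differentiability, the energy densities at small scales agree with the
`p`-size of the differential up to the distortion of the chart. -/
lemma HasChartDifferentialAt.limsup_ksDensity_le (hm : IsReferenceMeasure m)
    (hd : UniformlyLocallyDoubling m) (hp : 1 < p) (hc : IsChart m ε c U φ) (hε : 0 < ε)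
    (hu : AEStronglyMeasurable u m) (hG : Measurable G)
    (hν : HasChartDifferentialAt m U φ u ν x) (hx : x ∈ U) (hU : IsRarePoint m Uᶜ x)
    (hφ : IsRarePoint volume (φ '' U)ᶜ (φ x))
    (hH : ∀ᵐ y ∂m, dist x y < 1 / 4 → edist (u x) (u y) ≤ edist x y * (G x + G y))
    (hL : Tendsto (fun r => (∫⁻ y in ball x r, ‖(G y : ℝ) ^ p - (G x : ℝ) ^ p‖ₑ ∂m) / m (ball x r))
      (𝓝[>] 0) (𝓝 0)) :
    limsup (fun r => ksDensity m p r u x) (𝓝[>] 0) ≤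
      (distortion d p ε * seminormMean p ν) ^ (1 / p) ∧
    seminormMean p ν ^ (1 / p) ≤
      distortion d p ε ^ (1 / p) * liminf (fun r => ksDensity m p r u x) (𝓝[>] 0) := by
  have hp0 : 0 < p := by linarith
  have hp' : 0 < 1 / p := by positivity
  set A := blowUpAverage m U φ (fun w => ENNReal.ofReal (ν w) ^ p) p x with hA
  have hev := fun {δ : ℝ≥0} (hδ : 0 < δ) =>
    hν.eventually_ksDensity_le hm hp hc hε hu hG hx hU hH hL hδ
  have hg := measurable_seminorm_rpow ν p
  have hom := seminorm_rpow_homogeneous ν hp0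
  obtain ⟨L, hνL⟩ := exists_seminorm_le ν
  have hup : limsup A (𝓝[>] 0) ≤ distortion d p ε * seminormMean p ν :=
    hc.limsup_blowUpAverage_le hε hg hom hx hφ
  have hlo : seminormMean p ν ≤ distortion d p ε * liminf A (𝓝[>] 0) := by
    refine hc.le_liminf_blowUpAverage hm hd hε hg hom (M := (L : ℝ≥0∞) ^ p)
      (ENNReal.rpow_ne_top_of_nonneg hp0.le ENNReal.coe_ne_top) (fun w hw => ?_) hx hU hφ
    rw [← ENNReal.ofReal_coe_nnreal]
    gcongr
    refine (hνL w).trans ?_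
    have : ‖w‖ ≤ 1 := (mem_ball_zero_iff.1 hw).le
    nlinarith [L.coe_nonneg]
  have hD0 : distortion d p ε ^ (1 / p) ≠ 0 := (ENNReal.rpow_pos
    (pos_iff_ne_zero.2 (distortion_ne_zero hε)) (distortion_ne_top hε)).ne'
  have hDt : distortion d p ε ^ (1 / p) ≠ ∞ :=
    ENNReal.rpow_ne_top_of_nonneg hp'.le (distortion_ne_top hε)
  have hmono : ∀ δ : ℝ≥0∞, Monotone fun t : ℝ≥0∞ => t ^ (1 / p) + δ := fun δ a b hab => by
    dsimp only; gcongr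
  have hcont : ∀ δ : ℝ≥0∞, Continuous fun t : ℝ≥0∞ => t ^ (1 / p) + δ := fun δ =>
    ENNReal.continuous_rpow_const.add continuous_const
  constructor
  · refine ENNReal.le_of_forall_pos_le_add fun δ hδ _ => ?_
    calc limsup (fun r => ksDensity m p r u x) (𝓝[>] 0)
        ≤ limsup ((fun t : ℝ≥0∞ => t ^ (1 / p) + δ) ∘ A) (𝓝[>] 0) :=
          limsup_le_limsup (hev hδ).1
      _ = limsup A (𝓝[>] 0) ^ (1 / p) + δ :=
          ((hmono δ).map_limsup_of_continuousAt A (hcont δ).continuousAt).symm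
      _ ≤ _ := by gcongr
  · rw [mul_comm, ← ENNReal.div_le_iff_le_mul (Or.inl hD0) (Or.inl hDt)]
    refine ENNReal.le_of_forall_pos_le_add fun δ hδ _ => ?_
    rw [ENNReal.div_le_iff_le_mul (Or.inl hD0) (Or.inl hDt)]
    calc seminormMean p ν ^ (1 / p)
        ≤ (distortion d p ε * liminf A (𝓝[>] 0)) ^ (1 / p) := by gcongr
      _ = liminf A (𝓝[>] 0) ^ (1 / p) * distortion d p ε ^ (1 / p) := by
          rw [ENNReal.mul_rpow_of_nonneg _ _ hp'.le, mul_comm]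
      _ ≤ _ := by
          gcongr
          have h1 : liminf A (𝓝[>] 0) ^ (1 / p) =
              liminf (fun r => A r ^ (1 / p)) (𝓝[>] 0) :=
            (ENNReal.monotone_rpow_of_nonneg hp'.le).map_liminf_of_continuousAt A
              ENNReal.continuous_rpow_const.continuousAt
          have h2 : liminf (fun r => ksDensity m p r u x) (𝓝[>] 0) + δ =
              liminf (fun r => ksDensity m p r u x + δ) (𝓝[>] 0) :=
            Monotone.map_liminf_of_continuousAt (f := fun t : ℝ≥0∞ => t + δ)
              (fun a b hab => by dsimp only; gcongr) _
              (continuous_id.add continuous_const).continuousAt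
          rw [h1, h2]
          exact liminf_le_liminf (hev hδ).2

end ChartDifferential

/-! ### Differentiability in a chart -/

section ChartDifferentiability

variable {X Y : Type*} [MetricSpace X] [MeasurableSpace X] {m : Measure X} [MetricSpace Y] {d : ℕ}
  {U : Set X} {φ : X → EuclideanSpace ℝ (Fin d)} {ε c : ℝ}

/-- Null sets of `ℝ^d` have null preimages under a chart. -/
lemma IsChart.ae_of_ae_volume [OpensMeasurableSpace X] (h : IsChart m ε c U φ) (hε : 0 < ε)
    {P : EuclideanSpace ℝ (Fin d) → Prop} (hP : ∀ᵐ z, P z) : ∀ᵐ x ∂m, x ∈ U → P (φ x) := by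
  have h1 : ∀ᵐ z ∂((m.restrict U).map φ), P z :=
    (Measure.absolutelyContinuous_of_le h.map_le).ae_le
      (Measure.ae_smul_measure (ae_restrict_of_ae hP) _)
  exact (ae_restrict_iff' h.measurableSet).1 (ae_of_ae_map (h.aemeasurable hε) h1)

variable [BorelSpace X] [PolishSpace X]

lemma IsChart.ae_isRarePoint_image (h : IsChart m ε c U φ) (hε : 0 < ε) :
    ∀ᵐ x ∂m, x ∈ U → IsRarePoint volume (φ '' U)ᶜ (φ x) := by
  filter_upwards [h.ae_of_ae_volume hε (ae_isRarePoint_compl isReferenceMeasure_volume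
    uniformlyLocallyDoubling_volume (h.measurableSet_image hε))] with x hx hxU
  exact hx hxU (mem_image_of_mem φ hxU)

/-- Differentiability of a map on a part `A` of a chart where it is Lipschitz. The map is described
by its distances to the points `y k` of a countable dense set; in the chart these are Lipschitz
functions on a subset of `ℝ^d`, which extend to `ℝ^d`. -/
lemma IsChart.ae_exists_hasChartDifferentialAt_of_dist_le (hm : IsReferenceMeasure m)
    (hd : UniformlyLocallyDoubling m) (hc : IsChart m ε c U φ) (hε : 0 < ε) {u : X → Y} {A : Set X}
    (hA : MeasurableSet A) (hAU : A ⊆ U) {K : ℝ≥0}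
    (hK : ∀ x ∈ A, ∀ y ∈ A, dist (u x) (u y) ≤ K * dist x y) {y : ℕ → Y}
    (hy : ∀ x ∈ A, u x ∈ closure (range y)) :
    ∀ᵐ x ∂m, x ∈ A → ∃ ν, HasChartDifferentialAt m U φ u ν x := by
  have hθ : 0 < 1 + ε := by linarith
  rcases isEmpty_or_nonempty X with hX | hX
  · exact .of_forall fun x => hX.elim x
  set L : ℝ≥0 := K * (1 + ε).toNNReal with hL
  have hLK : (L : ℝ) = K * (1 + ε) := by rw [hL, NNReal.coe_mul, Real.coe_toNNReal _ hθ.le]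
  have hext : ∀ k, ∃ f : EuclideanSpace ℝ (Fin d) → ℝ, LipschitzWith L f ∧
      ∀ x ∈ A, f (φ x) = dist (u x) (y k) := by
    intro k
    set g : EuclideanSpace ℝ (Fin d) → ℝ := fun z => dist (u (Function.invFunOn φ A z)) (y k)
      with hg
    have hinv : ∀ x ∈ A, Function.invFunOn φ A (φ x) = x := fun x hx =>
      (hc.injOn.mono hAU).leftInvOn_invFunOn hx
    have hgL : LipschitzOnWith L g (φ '' A) := by
      refine LipschitzOnWith.of_dist_le_mul ?_
      rintro _ ⟨a, ha, rfl⟩ _ ⟨b, hb, rfl⟩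
      have e1 : ∀ x ∈ A, g (φ x) = dist (u x) (y k) := fun x hx => by simp only [hg, hinv x hx]
      rw [e1 a ha, e1 b hb, Real.dist_eq, hLK, mul_assoc]
      exact (abs_dist_sub_le _ _ _).trans ((hK a ha b hb).trans
        (mul_le_mul_of_nonneg_left (hc.lower a (hAU ha) b (hAU hb)) K.coe_nonneg))
    obtain ⟨f, hf, hfg⟩ := hgL.extend_real
    refine ⟨f, hf, fun x hx => ?_⟩
    rw [← hfg (mem_image_of_mem φ hx), hg]
    simp only [hinv x hx]
  choose f hf hfA using hext
  filter_upwards [hc.ae_of_ae_volume hε (ae_sup_abs_sub_approx_supFDerivSeminorm volume hf),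
    ae_isRarePoint_compl hm hd hA] with x hx hxr hxA
  refine ⟨supFDerivSeminorm hf (φ x), fun η hη => ?_⟩
  obtain ⟨δ, hδ, h⟩ := hx (hAU hxA) (η / (1 + ε)) (by positivity)
  refine (hxr hxA).of_eventually (δ := δ / (1 + ε)) (by positivity) ?_
  rintro z ⟨⟨hzU, hz⟩, hzδ⟩ hzA
  have h0 : dist (φ z) (φ x) ≤ (1 + ε) * dist z x := hc.upper z hzU x (hAU hxA)
  have h1 : ‖φ z - φ x‖ < δ := by
    rw [← dist_eq_norm]
    refine h0.trans_lt ?_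
    rw [mul_comm, ← lt_div_iff₀ hθ]
    exact hzδ
  obtain ⟨h2, k, h3⟩ := h (φ z) h1
  have h4 : η / (1 + ε) * ‖φ z - φ x‖ ≤ η * dist z x := by
    rw [← dist_eq_norm, div_mul_eq_mul_div, div_le_iff₀ hθ]
    nlinarith
  have h5 : dist (u z) (u x) ≤ supFDerivSeminorm hf (φ x) (φ z - φ x) + η * dist z x := by
    refine le_of_forall_pos_le_add fun τ hτ => ?_
    obtain ⟨_, ⟨i, rfl⟩, hi⟩ := Metric.mem_closure_iff.1 (hy x hxA) (τ / 2) (by positivity)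
    have h6 := (le_abs_self _).trans (h2 i)
    rw [hfA i z hzA, hfA i x hxA] at h6
    linarith [dist_triangle (u z) (y i) (u x), dist_comm (y i) (u x)]
  have h7 : supFDerivSeminorm hf (φ x) (φ z - φ x) - η * dist z x ≤ dist (u z) (u x) := by
    rw [hfA k z hzA, hfA k x hxA] at h3
    linarith [abs_dist_sub_le (u z) (u x) (y k)]
  exact absurd hz (not_lt.2 (abs_le.2 ⟨by linarith, by linarith⟩))

/-- A map whose difference quotients are bounded by `G x + G y` is metrically differentiable almost
everywhere in a chart, since it is locally Lipschitz on the sets `{G ≤ k}`. -/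
lemma IsChart.ae_exists_hasChartDifferentialAt (hm : IsReferenceMeasure m)
    (hd : UniformlyLocallyDoubling m) (hc : IsChart m ε c U φ) (hε : 0 < ε) {u : X → Y}
    (hu : AEStronglyMeasurable u m) {G : X → ℝ≥0} (hG : Measurable G) {N : Set X}
    (hN : m N = 0)
    (hH : ∀ x ∉ N, ∀ y ∉ N, dist x y < 1 / 4 → edist (u x) (u y) ≤ edist x y * (G x + G y)) :
    ∀ᵐ x ∂m, x ∈ U → ∃ ν, HasChartDifferentialAt m U φ u ν x := by
  rcases isEmpty_or_nonempty X with hX | hX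
  · exact .of_forall fun x => hX.elim x
  obtain ⟨t, ⟨s, hs, hts⟩, htae⟩ := hu.isSeparable_ae_range
  have hsne : s.Nonempty := by
    rw [← closure_nonempty_iff]
    by_contra h
    rw [not_nonempty_iff_eq_empty] at h
    rw [h, subset_empty_iff] at hts
    have h1 : m univ = 0 := by
      refine measure_mono_null (fun x _ => ?_) (ae_iff.1 htae)
      simp [hts]
    exact hm.ne_zero (Measure.measure_univ_eq_zero.1 h1)
  obtain ⟨y, rfl⟩ := hs.exists_eq_range hsne
  -- a measurable null set outside of which everything is under control
  set N' := MeasureTheory.toMeasurable m (N ∪ {x | u x ∉ t}) with hN'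
  have hN'0 : m N' = 0 := by
    rw [hN', measure_toMeasurable]
    exact measure_union_null hN (ae_iff.1 htae)
  have hN'm : MeasurableSet N' := measurableSet_toMeasurable _ _
  have hsub : N ∪ {x | u x ∉ t} ⊆ N' := subset_toMeasurable _ _
  set A : ℕ → ℕ → Set X := fun j k =>
    (U ∩ ball (TopologicalSpace.denseSeq X j) (1 / 8) ∩ {x | G x ≤ k}) \ N' with hA
  have key : ∀ j k, ∀ᵐ x ∂m, x ∈ A j k → ∃ ν, HasChartDifferentialAt m U φ u ν x := by
    intro j k
    refine hc.ae_exists_hasChartDifferentialAt_of_dist_le hm hd hε (K := k + k) (y := y) ?_ ?_ ?_ ?_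
    · exact ((hc.measurableSet.inter measurableSet_ball).inter
        (measurableSet_le hG measurable_const)).diff hN'm
    · exact fun x hx => hx.1.1.1
    · rintro a ⟨⟨⟨-, ha1⟩, ha2⟩, ha3⟩ b ⟨⟨⟨-, hb1⟩, hb2⟩, hb3⟩
      have h1 : dist a b < 1 / 4 := by
        linarith [dist_triangle_right a b (TopologicalSpace.denseSeq X j), mem_ball.1 ha1,
          mem_ball.1 hb1]
      have h2 := hH a (fun h => ha3 (hsub (Or.inl h))) b (fun h => hb3 (hsub (Or.inl h))) h1
      have h3 : edist (u a) (u b) ≤ ((k + k : ℝ≥0) : ℝ≥0∞) * edist a b := by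
        refine h2.trans ?_
        rw [mul_comm, ← ENNReal.coe_add]
        gcongr
        exacts [ha2, hb2]
      rw [edist_nndist, edist_nndist, ← ENNReal.coe_mul, ENNReal.coe_le_coe] at h3
      exact_mod_cast h3
    · rintro a ⟨-, ha⟩
      refine hts ?_
      by_contra h
      exact ha (hsub (Or.inr h))
  filter_upwards [ae_all_iff.2 fun j => ae_all_iff.2 (key j), measure_eq_zero_iff_ae_notMem.1 hN'0]
    with x hx hxN hxU
  obtain ⟨j, hj⟩ := (TopologicalSpace.denseRange_denseSeq X).exists_dist_lt x
    (show (0 : ℝ) < 1 / 8 by norm_num)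
  obtain ⟨k, hk⟩ := exists_nat_ge (G x)
  exact hx j k ⟨⟨⟨hxU, hj⟩, hk⟩, hxN⟩

end ChartDifferentiability

/-! ### Existence of the energy density -/

section Limit

variable {X Y : Type*} [MetricSpace X] [MeasurableSpace X] {m : Measure X} [MetricSpace Y]
  {u : X → Y} {p : ℝ}

/-- The chart `(U, φ)` contains `x` and has density one there, and so does its image. -/
structure IsChartPoint (m : Measure X) {d : ℕ} (U : Set X) (φ : X → EuclideanSpace ℝ (Fin d))
    (x : X) : Prop where
  mem : x ∈ U
  isRarePoint : IsRarePoint m Uᶜ x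
  isRarePoint_image : IsRarePoint volume (φ '' U)ᶜ (φ x)

/-- The difference quotients of `u` at `x` are bounded by `G x + G y` for a.e. `y` nearby, and `x`
is a Lebesgue point of `G ^ p`. -/
structure IsHajlaszPoint (m : Measure X) (p : ℝ) (u : X → Y) (G : X → ℝ≥0) (x : X) : Prop where
  edist_le : ∀ᵐ y ∂m, dist x y < 1 / 4 → edist (u x) (u y) ≤ edist x y * (G x + G y)
  lebesgue : Tendsto (fun r =>
    (∫⁻ y in ball x r, ‖(G y : ℝ) ^ p - (G x : ℝ) ^ p‖ₑ ∂m) / m (ball x r)) (𝓝[>] 0) (𝓝 0)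

variable [BorelSpace X] [PolishSpace X]

/-- `exists_hajlasz_bound` with a finite function. -/
lemma exists_hajlasz_bound_nnreal (hm : IsReferenceMeasure m) (hd : UniformlyLocallyDoubling m)
    (hpoinc : SupportsPoincare m) (hp : 1 < p) (hu : AEStronglyMeasurable u m)
    (hE : ksEnergy m p u < ∞) : ∃ G : X → ℝ≥0, Measurable G ∧ ∫⁻ x, (G x : ℝ≥0∞) ^ p ∂m < ∞ ∧
      ∃ N, m N = 0 ∧
        ∀ x ∉ N, ∀ y ∉ N, dist x y < 1 / 4 → edist (u x) (u y) ≤ edist x y * (G x + G y) := by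
  obtain ⟨G, hG, hGp, N, -, hN, hfin, h⟩ := exists_hajlasz_bound hm hd hpoinc hp hu hE
  refine ⟨fun x => (G x).toNNReal, hG.ennreal_toNNReal, ?_, N, hN, fun x hx y hy hxy => ?_⟩
  · refine lt_of_le_of_lt (lintegral_mono fun x => ?_) hGp
    exact ENNReal.rpow_le_rpow ENNReal.coe_toNNReal_le_self (by linarith)
  · rw [ENNReal.coe_toNNReal (hfin x hx).ne, ENNReal.coe_toNNReal (hfin y hy).ne]
    exact h x hx y hy hxy

lemma ae_isHajlaszPoint (hm : IsReferenceMeasure m) (hd : UniformlyLocallyDoubling m) (hp : 1 < p)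
    {G : X → ℝ≥0} (hG : Measurable G) (hGp : ∫⁻ x, (G x : ℝ≥0∞) ^ p ∂m < ∞) {N : Set X}
    (hN : m N = 0)
    (hH : ∀ x ∉ N, ∀ y ∉ N, dist x y < 1 / 4 → edist (u x) (u y) ≤ edist x y * (G x + G y)) :
    ∀ᵐ x ∂m, IsHajlaszPoint m p u G x := by
  have hp0 : 0 < p := by linarith
  have hint : Integrable (fun y => (G y : ℝ) ^ p) m := by
    refine ⟨(hG.coe_nnreal_real.pow_const p).aestronglyMeasurable, ?_⟩
    refine lt_of_le_of_lt (lintegral_mono fun y => le_of_eq ?_) hGp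
    rw [Real.enorm_of_nonneg (by positivity), ← ENNReal.ofReal_rpow_of_nonneg (G y).coe_nonneg
      hp0.le, ENNReal.ofReal_coe_nnreal]
  have hNae := measure_eq_zero_iff_ae_notMem.1 hN
  filter_upwards [ae_tendsto_lintegral_enorm_sub_ball hm hd hint.locallyIntegrable, hNae]
    with x hx hxN
  exact ⟨hNae.mono fun y hy => hH x hxN y hy, hx⟩

/-- Almost every point lies in a chart of a given atlas, has density one in it, and is a point of
chart differentiability of a map with a bound on the difference quotients. -/
lemma IsAtlas.ae_exists_isChartPoint (hm : IsReferenceMeasure m) (hd : UniformlyLocallyDoubling m)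
    {d : ℕ} {ε : ℝ} (hε : 0 < ε) {U : ℕ → Set X} {φ : ℕ → X → EuclideanSpace ℝ (Fin d)}
    (h : IsAtlas m d ε U φ) (hu : AEStronglyMeasurable u m) {G : X → ℝ≥0} (hG : Measurable G)
    {N : Set X} (hN : m N = 0)
    (hH : ∀ x ∉ N, ∀ y ∉ N, dist x y < 1 / 4 → edist (u x) (u y) ≤ edist x y * (G x + G y)) :
    ∀ᵐ x ∂m, ∃ i ν, IsChartPoint m (U i) (φ i) x ∧ HasChartDifferentialAt m (U i) (φ i) u ν x := by
  have h1 : ∀ i, ∀ᵐ x ∂m, x ∈ U i →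
      ∃ ν, IsChartPoint m (U i) (φ i) x ∧ HasChartDifferentialAt m (U i) (φ i) u ν x := by
    intro i
    obtain ⟨c, hc⟩ := h.exists_isChart i
    filter_upwards [ae_isRarePoint_compl hm hd hc.measurableSet, hc.ae_isRarePoint_image hε,
      hc.ae_exists_hasChartDifferentialAt hm hd hε hu hG hN hH] with x hx1 hx2 hx3 hxU
    obtain ⟨ν, hν⟩ := hx3 hxU
    exact ⟨ν, ⟨hxU, hx1 hxU, hx2 hxU⟩, hν⟩
  filter_upwards [ae_all_iff.2 h1, measure_eq_zero_iff_ae_notMem.1 h.cover] with x hx hxU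
  obtain ⟨i, hi⟩ := mem_iUnion.1 (notMem_compl_iff.1 hxU)
  exact ⟨i, hx i hi⟩

/-- `HasChartDifferentialAt.limsup_ksDensity_le` for a chart of an atlas. -/
lemma IsAtlas.limsup_ksDensity_le (hm : IsReferenceMeasure m) (hd : UniformlyLocallyDoubling m)
    (hp : 1 < p) {d : ℕ} {ε : ℝ} (hε : 0 < ε) {U : ℕ → Set X}
    {φ : ℕ → X → EuclideanSpace ℝ (Fin d)}
    (h : IsAtlas m d ε U φ) (hu : AEStronglyMeasurable u m) {G : X → ℝ≥0} (hG : Measurable G)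
    {x : X} (hx : IsHajlaszPoint m p u G x) {i : ℕ} {ν : Seminorm ℝ (EuclideanSpace ℝ (Fin d))}
    (hxU : IsChartPoint m (U i) (φ i) x) (hν : HasChartDifferentialAt m (U i) (φ i) u ν x) :
    limsup (fun r => ksDensity m p r u x) (𝓝[>] 0) ≤
      (distortion d p ε * seminormMean p ν) ^ (1 / p) ∧
    seminormMean p ν ^ (1 / p) ≤
      distortion d p ε ^ (1 / p) * liminf (fun r => ksDensity m p r u x) (𝓝[>] 0) := by
  obtain ⟨c, hc⟩ := h.exists_isChart i
  exact hν.limsup_ksDensity_le hm hd hp hc hε hu hG hxU.mem hxU.isRarePoint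
    hxU.isRarePoint_image hx.edist_le hx.lebesgue

omit [BorelSpace X] [PolishSpace X] in
lemma seminormMean_ne_top {d : ℕ} (hp : 0 < p) (ν : Seminorm ℝ (EuclideanSpace ℝ (Fin d))) :
    seminormMean p ν ≠ ∞ := by
  obtain ⟨L, hL⟩ := exists_seminorm_le ν
  have hω0 : volume (ball (0 : EuclideanSpace ℝ (Fin d)) 1) ≠ 0 :=
    (Metric.measure_ball_pos volume _ one_pos).ne'
  refine ne_top_of_le_ne_top (b := (L : ℝ≥0∞) ^ p)
    (ENNReal.rpow_ne_top_of_nonneg hp.le ENNReal.coe_ne_top) ?_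
  refine ENNReal.div_le_of_le_mul ?_
  rw [← setLIntegral_const]
  refine setLIntegral_mono measurable_const fun w hw => ?_
  rw [← ENNReal.ofReal_coe_nnreal]
  gcongr
  refine (hL w).trans ?_
  have : ‖w‖ ≤ 1 := (mem_ball_zero_iff.1 hw).le
  nlinarith [L.coe_nonneg]

lemma tendsto_distortion (d : ℕ) (q : ℝ) {ε : ℕ → ℝ} (hε : Tendsto ε atTop (𝓝 0)) :
    Tendsto (fun n => distortion d q (ε n)) atTop (𝓝 1) := by
  have h1 : Tendsto (fun n => ENNReal.ofReal (1 + ε n)) atTop (𝓝 1) := by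
    have := ENNReal.tendsto_ofReal (hε.const_add 1)
    simpa using this
  have h2 : Tendsto (fun n => ENNReal.ofReal (1 + ε n) ^ d) atTop (𝓝 1) := by
    simpa using ENNReal.Tendsto.pow (n := d) h1
  have h3 : Tendsto (fun n => ENNReal.ofReal (1 + ε n) ^ q) atTop (𝓝 1) := by
    simpa using h1.ennrpow_const q
  simpa [distortion] using ENNReal.Tendsto.mul (ENNReal.Tendsto.mul (ENNReal.Tendsto.mul h1
    (by simp) h2 (by simp)) (by simp) h2 (by simp)) (by simp) h3 (by simp)

/-- The energy densities converge at almost every point: comparing with charts of arbitrarily small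
distortion, the upper and the lower limit agree. -/
lemma ae_exists_tendsto_ksDensity (hm : IsReferenceMeasure m) (hrect : StronglyRectifiable m)
    (hd : UniformlyLocallyDoubling m) (hp : 1 < p) (hu : AEStronglyMeasurable u m)
    {G : X → ℝ≥0} (hG : Measurable G) (hGp : ∫⁻ x, (G x : ℝ≥0∞) ^ p ∂m < ∞) {N : Set X}
    (hN : m N = 0)
    (hH : ∀ x ∉ N, ∀ y ∉ N, dist x y < 1 / 4 → edist (u x) (u y) ≤ edist x y * (G x + G y)) :
    ∀ᵐ x ∂m, ∃ l : ℝ≥0∞, l ≠ ∞ ∧ Tendsto (fun r => ksDensity m p r u x) (𝓝[>] 0) (𝓝 l) := by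
  have hp0 : 0 < p := by linarith
  obtain ⟨d, hat⟩ := hrect
  set ε : ℕ → ℝ := fun n => 1 / ((n : ℝ) + 1) with hε
  have hε0 : ∀ n, 0 < ε n := fun n => by positivity
  choose U φ h using fun n => hat (ε n) (hε0 n)
  filter_upwards [ae_all_iff.2 fun n => (h n).ae_exists_isChartPoint hm hd (hε0 n) hu hG hN hH,
    ae_isHajlaszPoint hm hd hp hG hGp hN hH] with x hx hxH
  choose i ν hxU hν using hx
  have hb := fun n => (h n).limsup_ksDensity_le hm hd hp (hε0 n) hu hG hxH (hxU n) (hν n)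
  have hD := ((tendsto_distortion d p (ε := ε)
    tendsto_one_div_add_atTop_nhds_zero_nat).ennrpow_const (1 / p))
  rw [ENNReal.one_rpow] at hD
  set l := limsup (fun r => ksDensity m p r u x) (𝓝[>] 0) with hl
  have hl1 : l ≠ ∞ := ne_top_of_le_ne_top (ENNReal.rpow_ne_top_of_nonneg (by positivity)
    (ENNReal.mul_ne_top (distortion_ne_top (hε0 0)) (seminormMean_ne_top hp0 _))) (hb 0).1
  refine ⟨l, hl1, tendsto_of_le_liminf_of_limsup_le ?_ le_rfl⟩
  have hlim := ENNReal.Tendsto.mul_const (b := liminf (fun r => ksDensity m p r u x) (𝓝[>] 0))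
    (ENNReal.Tendsto.mul hD (Or.inl one_ne_zero) hD (Or.inl one_ne_zero)) (Or.inl (by simp))
  rw [one_mul, one_mul] at hlim
  refine ge_of_tendsto' hlim fun n => (hb n).1.trans ?_
  rw [ENNReal.mul_rpow_of_nonneg _ _ (by positivity), mul_assoc]
  exact mul_le_mul' le_rfl (hb n).2

end Limit

/-! ### Metric differentials along aligned atlases -/

section Aligned

variable {X Y : Type*} [MetricSpace X] [MeasurableSpace X] {m : Measure X} [MetricSpace Y]
  [BorelSpace X] [PolishSpace X] {u : X → Y} {d : ℕ} {x : X}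
  {U V : Set X} {φ ψ : X → EuclideanSpace ℝ (Fin d)} {ε c : ℝ}
  {ν μ : Seminorm ℝ (EuclideanSpace ℝ (Fin d))}

/-- At a density point every direction of `ℝ^d` is approximated by directions `φ y - φ x` with `y`
in a given set of density one. The lower blow-up bound is applied to the indicator function of an
open cone around the direction, which is homogeneous of degree zero. -/
lemma IsChart.exists_norm_sub_lt (hm : IsReferenceMeasure m) (hd : UniformlyLocallyDoubling m)
    (hc : IsChart m ε c U φ) (hε : 0 < ε) (hx : IsChartPoint m U φ x) {B : Set X}
    (hB : IsRarePoint m B x) (w : EuclideanSpace ℝ (Fin d)) {δ : ℝ} (hδ : 0 < δ) :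
    ∃ t : ℝ, 0 < t ∧ ∃ y ∈ U, y ∉ B ∧ ‖φ y - φ x - t • w‖ < δ * t := by
  by_contra! hcon
  set K : Set (EuclideanSpace ℝ (Fin d)) := ⋃ t ∈ Ioi (0 : ℝ), ball (t • w) (δ * t) with hK
  have hKo : IsOpen K := isOpen_biUnion fun t _ => isOpen_ball
  have hmem : ∀ v, v ∈ K ↔ ∃ t : ℝ, 0 < t ∧ ‖v - t • w‖ < δ * t := by
    intro v
    simp only [hK, mem_iUnion, mem_Ioi, mem_ball, dist_eq_norm, exists_prop]
  have hsmul : ∀ s : ℝ, 0 < s → ∀ v ∈ K, s • v ∈ K := by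
    intro s hs v hv
    obtain ⟨t, ht, h⟩ := (hmem v).1 hv
    refine (hmem _).2 ⟨s * t, by positivity, ?_⟩
    rw [mul_smul, ← smul_sub, norm_smul, Real.norm_of_nonneg hs.le]
    nlinarith
  set g : EuclideanSpace ℝ (Fin d) → ℝ≥0∞ := K.indicator 1 with hg
  have hgm : Measurable g := measurable_one.indicator hKo.measurableSet
  have hom : ∀ t : ℝ, 0 < t → ∀ v, g (t • v) = ENNReal.ofReal t ^ (0 : ℝ) * g v := by
    intro t ht v
    have : t • v ∈ K ↔ v ∈ K := by
      refine ⟨fun h => ?_, hsmul t ht v⟩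
      have := hsmul t⁻¹ (by positivity) _ h
      rwa [inv_smul_smul₀ ht.ne'] at this
    by_cases hv : v ∈ K
    · rw [hg, indicator_of_mem hv, indicator_of_mem (this.2 hv), ENNReal.rpow_zero, one_mul]; rfl
    · rw [hg, indicator_of_notMem hv, indicator_of_notMem (mt this.1 hv), mul_zero]
  have hle := hc.le_liminf_blowUpAverage hm hd hε hgm hom ENNReal.one_ne_top
    (fun w _ => indicator_le_self' (fun _ _ => bot_le) w) hx.mem hx.isRarePoint
    hx.isRarePoint_image
  have hzero : Tendsto (blowUpAverage m U φ g 0 x) (𝓝[>] 0) (𝓝 0) := by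
    refine tendsto_of_tendsto_of_tendsto_of_le_of_le tendsto_const_nhds hB (fun _ => bot_le)
      fun r => ?_
    simp only [blowUpAverage, ENNReal.rpow_zero, one_mul]
    gcongr
    have h1 : ∀ y ∈ ball x r ∩ U, g (φ y - φ x) ≤ B.indicator 1 y := by
      rintro y ⟨-, hyU⟩
      by_cases hyB : y ∈ B
      · rw [indicator_of_mem hyB]
        exact indicator_le_self' (fun _ _ => bot_le) _
      · have : φ y - φ x ∉ K := fun h => by
          obtain ⟨t, ht, h'⟩ := (hmem _).1 h
          exact absurd h' (not_lt.2 (hcon t ht y hyU hyB))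
        rw [hg, indicator_of_notMem this]
        exact bot_le
    calc ∫⁻ y in ball x r ∩ U, g (φ y - φ x) ∂m
        ≤ ∫⁻ y in ball x r ∩ U, B.indicator 1 y ∂m :=
          setLIntegral_mono' (measurableSet_ball.inter hc.measurableSet) h1
      _ ≤ ∫⁻ y in ball x r, B.indicator 1 y ∂m := lintegral_mono_set inter_subset_left
      _ ≤ (m.restrict (ball x r)) B := lintegral_indicator_one_le _
      _ = m (ball x r ∩ B) := by rw [Measure.restrict_apply' measurableSet_ball, inter_comm]
  rw [hzero.liminf_eq, mul_zero, nonpos_iff_eq_zero, ENNReal.div_eq_zero_iff] at hle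
  rcases hle with h | h
  · rw [hg, lintegral_indicator_one hKo.measurableSet, Measure.restrict_apply hKo.measurableSet]
      at h
    have hne : (K ∩ ball 0 1).Nonempty := by
      refine ⟨(1 / (‖w‖ + 1)) • w, (hmem _).2 ⟨1 / (‖w‖ + 1), by positivity, ?_⟩, ?_⟩
      · rw [sub_self, norm_zero]; positivity
      · rw [mem_ball_zero_iff, norm_smul, Real.norm_of_nonneg (by positivity), div_mul_eq_mul_div,
          one_mul, div_lt_one (by positivity)]
        linarith
    exact (hKo.inter isOpen_ball).measure_pos volume hne |>.ne' h
  · exact measure_ball_lt_top.ne h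

/-- An inequality between seminorms, with a linear error, has to be checked only on the directions
`φ y - φ x` with `y` in a set of density one. -/
lemma IsChart.seminorm_le_add (hm : IsReferenceMeasure m) (hd : UniformlyLocallyDoubling m)
    (hc : IsChart m ε c U φ) (hε : 0 < ε) (hx : IsChartPoint m U φ x) {B : Set X}
    (hB : IsRarePoint m B x) {C : ℝ} (hC : 0 ≤ C)
    (h : ∀ y ∈ U, y ∉ B → ν (φ y - φ x) ≤ μ (φ y - φ x) + C * ‖φ y - φ x‖)
    (w : EuclideanSpace ℝ (Fin d)) : ν w ≤ μ w + C * ‖w‖ := by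
  obtain ⟨L, hL⟩ := exists_seminorm_le ν
  obtain ⟨M, hM⟩ := exists_seminorm_le μ
  refine le_of_forall_pos_le_add fun τ hτ => ?_
  have hS : 0 < (L : ℝ) + M + C + 1 := by positivity
  obtain ⟨t, ht, y, hyU, hyB, hy⟩ := hc.exists_norm_sub_lt hm hd hε hx hB w
    (δ := τ / (L + M + C + 1)) (by positivity)
  set v := φ y - φ x with hv
  have h1 := h y hyU hyB
  have hνt : ν (t • w) = t * ν w := by rw [map_smul_eq_mul, Real.norm_of_nonneg ht.le]
  have hμt : μ (t • w) = t * μ w := by rw [map_smul_eq_mul, Real.norm_of_nonneg ht.le]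
  have h2 : ν (t • w) ≤ ν v + L * ‖v - t • w‖ := by
    have := (abs_le.1 ((abs_sub_map_le_sub ν v (t • w)).trans (hL _))).1
    linarith
  have h3 : μ v ≤ μ (t • w) + M * ‖v - t • w‖ := by
    have := (abs_le.1 ((abs_sub_map_le_sub μ v (t • w)).trans (hM _))).2
    linarith
  have h4 : ‖v‖ ≤ t * ‖w‖ + ‖v - t • w‖ := by
    have := norm_add_le (t • w) (v - t • w)
    rwa [add_sub_cancel, norm_smul, Real.norm_of_nonneg ht.le] at this
  have h5 : (L + M + C) * ‖v - t • w‖ ≤ τ * t := by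
    calc (L + M + C) * ‖v - t • w‖ ≤ (L + M + C + 1) * (τ / (L + M + C + 1) * t) := by
          have := norm_nonneg (v - t • w)
          have h0 : (0 : ℝ) ≤ L + M + C := by positivity
          nlinarith
      _ = τ * t := by field_simp
  have h6 : t * ν w ≤ t * (μ w + C * ‖w‖ + τ) := by
    have := mul_le_mul_of_nonneg_left h4 hC
    nlinarith
  exact le_of_mul_le_mul_left h6 ht

/-- Two chart differentials of the same map at the same point differ by at most the Lipschitz
constant of the difference of the charts. -/
lemma HasChartDifferentialAt.abs_sub_le (hm : IsReferenceMeasure m)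
    (hd : UniformlyLocallyDoubling m)
    (hc : IsChart m ε c U φ) (hε : 0 < ε) (hx : IsChartPoint m U φ x)
    (hxV : IsChartPoint m V ψ x)
    (hν : HasChartDifferentialAt m U φ u ν x) (hμ : HasChartDifferentialAt m V ψ u μ x)
    {α : ℝ} (hα : 0 ≤ α) (hal : ∀ y ∈ U ∩ V, ‖(φ y - ψ y) - (φ x - ψ x)‖ ≤ α * dist y x)
    {M : ℝ} (hM0 : 0 ≤ M) (hM : ∀ w, μ w ≤ M * ‖w‖) (w : EuclideanSpace ℝ (Fin d)) :
    |ν w - μ w| ≤ M * α * (1 + ε) * ‖w‖ := by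
  have hθ : 0 < 1 + ε := by linarith
  -- the estimate on a set of density one
  have key : ∀ η : ℝ, 0 < η → ∃ B, IsRarePoint m B x ∧ ∀ y ∈ U, y ∉ B →
      |ν (φ y - φ x) - μ (φ y - φ x)| ≤ (M * α + 2 * η) * (1 + ε) * ‖φ y - φ x‖ := by
    intro η hη
    refine ⟨_, ((hν η hη).union (hμ η hη)).union hxV.isRarePoint, fun y hyU hyB => ?_⟩
    simp only [mem_union, mem_ofPred_eq, mem_compl_iff, not_or, not_not, not_and, not_lt] at hyB
    obtain ⟨⟨h1, h2⟩, hyV⟩ := hyB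
    have h1 := abs_le.1 (h1 hyU)
    have h2 := abs_le.1 (h2 hyV)
    have h3 : |μ (φ y - φ x) - μ (ψ y - ψ x)| ≤ M * (α * dist y x) := by
      refine (abs_sub_map_le_sub μ _ _).trans ((hM _).trans ?_)
      refine mul_le_mul_of_nonneg_left ?_ hM0
      have := hal y ⟨hyU, hyV⟩
      rwa [show φ y - φ x - (ψ y - ψ x) = φ y - ψ y - (φ x - ψ x) by abel]
    have h3 := abs_le.1 h3
    have h4 : dist y x ≤ (1 + ε) * ‖φ y - φ x‖ := by
      rw [← dist_eq_norm]; exact hc.lower y hyU x hx.mem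
    have h5 : (M * α + 2 * η) * dist y x ≤ (M * α + 2 * η) * (1 + ε) * ‖φ y - φ x‖ := by
      rw [mul_assoc]; gcongr
    refine le_trans (abs_le.2 ⟨?_, ?_⟩) h5 <;> linarith [h1.1, h1.2, h2.1, h2.2, h3.1, h3.2]
  have hlim : ∀ η : ℝ, 0 < η → |ν w - μ w| ≤ (M * α + 2 * η) * (1 + ε) * ‖w‖ := by
    intro η hη
    obtain ⟨B, hB, h⟩ := key η hη
    have hC : 0 ≤ (M * α + 2 * η) * (1 + ε) := by positivity
    have h1 := hc.seminorm_le_add (ν := ν) (μ := μ) hm hd hε hx hB hC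
      (fun y hyU hyB => by linarith [(abs_le.1 (h y hyU hyB)).2]) w
    have h2 := hc.seminorm_le_add (ν := μ) (μ := ν) hm hd hε hx hB hC
      (fun y hyU hyB => by linarith [(abs_le.1 (h y hyU hyB)).1]) w
    exact abs_le.2 ⟨by linarith, by linarith⟩
  have ht : Tendsto (fun η : ℝ => (M * α + 2 * η) * (1 + ε) * ‖w‖) (𝓝[>] 0)
      (𝓝 ((M * α + 2 * 0) * (1 + ε) * ‖w‖)) := by
    refine Tendsto.mono_left ?_ nhdsWithin_le_nhds
    exact (Continuous.tendsto (by fun_prop) 0)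
  rw [mul_zero, add_zero] at ht
  exact ge_of_tendsto ht (by filter_upwards [self_mem_nhdsWithin] with η hη using hlim η hη)

/-- A sequence of seminorms that is uniformly Cauchy on bounded sets converges to a seminorm. -/
lemma exists_seminorm_of_abs_sub_le {ν : ℕ → Seminorm ℝ (EuclideanSpace ℝ (Fin d))} {ε : ℕ → ℝ}
    (hε : Tendsto ε atTop (𝓝 0)) {C : ℝ}
    (h : ∀ n k w, |ν n w - ν k w| ≤ C * (ε n + ε k) * ‖w‖) :
    ∃ μ : Seminorm ℝ (EuclideanSpace ℝ (Fin d)), ∀ n w, |ν n w - μ w| ≤ C * ε n * ‖w‖ := by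
  have hconv : ∀ w, ∃ l, Tendsto (fun n => ν n w) atTop (𝓝 l) := by
    intro w
    refine cauchySeq_tendsto_of_complete ?_
    rw [Metric.cauchySeq_iff']
    intro τ hτ
    have h1 : Tendsto (fun z : ℕ × ℕ => C * (ε z.1 + ε z.2) * ‖w‖) (atTop ×ˢ atTop)
        (𝓝 (C * (0 + 0) * ‖w‖)) :=
      (((hε.comp tendsto_fst).add (hε.comp tendsto_snd)).const_mul C).mul_const _
    rw [add_zero, mul_zero, zero_mul, prod_atTop_atTop_eq] at h1
    obtain ⟨⟨a, b⟩, hab⟩ := (h1.eventually (gt_mem_nhds hτ)).exists_forall_of_atTop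
    refine ⟨max a b, fun n hn => ?_⟩
    rw [Real.dist_eq]
    exact (h n _ w).trans_lt (hab (n, max a b)
      ⟨(le_max_left a b).trans hn, le_max_right a b⟩)
  choose l hl using hconv
  refine ⟨Seminorm.of l (fun v w => ?_) (fun a w => ?_), fun n w => ?_⟩
  · exact le_of_tendsto_of_tendsto' (hl (v + w)) ((hl v).add (hl w))
      fun n => map_add_le_add (ν n) v w
  · refine tendsto_nhds_unique (hl (a • w)) (((hl w).const_mul ‖a‖).congr fun n => ?_)
    rw [map_smul_eq_mul]
  · have h1 : Tendsto (fun k => |ν n w - ν k w|) atTop (𝓝 |ν n w - l w|) :=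
      ((hl w).const_sub (ν n w)).abs
    have h2 : Tendsto (fun k => C * (ε n + ε k) * ‖w‖) atTop (𝓝 (C * (ε n + 0) * ‖w‖)) :=
      ((hε.const_add (ε n)).const_mul C).mul_const _
    rw [add_zero] at h2
    exact le_of_tendsto_of_tendsto' h1 h2 fun k => h n k w

omit [BorelSpace X] [PolishSpace X] in
/-- Points with a small difference quotient lie in the sublevel set that defines `apLimsup`. -/
lemma ofReal_abs_sub_div_le {a b r t : ℝ} (hr : 0 ≤ r) (ht : 0 ≤ t) (h : |a - b| ≤ t * r) :
    ENNReal.ofReal (|a - b| / r) ≤ ENNReal.ofReal t := by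
  refine ENNReal.ofReal_le_ofReal ?_
  rcases hr.eq_or_lt with rfl | hr
  · simpa using ht
  · rwa [div_le_iff₀ hr]

/-- The chart differentials at a point along an aligned family converge to an approximate metric
differential. -/
lemma IsAlignedFamily.exists_isApproxMetricDifferentialAt (hm : IsReferenceMeasure m)
    (hd : UniformlyLocallyDoubling m) {ε : ℕ → ℝ} {U : ℕ → ℕ → Set X}
    {φ : ℕ → ℕ → X → EuclideanSpace ℝ (Fin d)} (hε0 : ∀ n, 0 < ε n) (hanti : Antitone ε)
    (hε : Tendsto ε atTop (𝓝 0)) (h : IsAlignedFamily m d ε U φ) {i : ℕ → ℕ}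
    {ν : ℕ → Seminorm ℝ (EuclideanSpace ℝ (Fin d))}
    (hx : ∀ n, IsChartPoint m (U n (i n)) (φ n (i n)) x)
    (hν : ∀ n, HasChartDifferentialAt m (U n (i n)) (φ n (i n)) u (ν n) x) :
    ∃ μ, IsApproxMetricDifferentialAt m U φ u x μ := by
  choose c hc using fun n => (h.atlas n).exists_isChart (i n)
  have hεle : ∀ n, ε n ≤ ε 0 := fun n => hanti (Nat.zero_le n)
  have hal : ∀ n k, ∀ y ∈ U n (i n) ∩ U k (i k),
      ‖(φ n (i n) y - φ k (i k) y) - (φ n (i n) x - φ k (i k) x)‖ ≤ (ε n + ε k) * dist y x :=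
    fun n k y hy => h.aligned n k (i n) (i k) y hy x ⟨(hx n).mem, (hx k).mem⟩
  have hcmp : ∀ n k {M : ℝ}, 0 ≤ M → (∀ w, ν k w ≤ M * ‖w‖) → ∀ w,
      |ν n w - ν k w| ≤ M * (ε n + ε k) * (1 + ε n) * ‖w‖ := fun n k M hM0 hM w =>
    (hν n).abs_sub_le hm hd (hc n) (hε0 n) (hx n) (hx k) (hν k)
      (by linarith [hε0 n, hε0 k]) (hal n k) hM0 hM w
  -- a uniform bound of the chart differentials
  obtain ⟨L, hL⟩ := exists_seminorm_le (ν 0)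
  set M : ℝ := L + L * (ε 0 + ε 0) * (1 + ε 0) with hMdef
  have h0 := hε0 0
  have hM0 : 0 ≤ M := by positivity
  have hM : ∀ n w, ν n w ≤ M * ‖w‖ := by
    intro n w
    have h1 := (abs_le.1 (hcmp n 0 L.coe_nonneg hL w)).2
    have h2 : L * (ε n + ε 0) * (1 + ε n) * ‖w‖ ≤ L * (ε 0 + ε 0) * (1 + ε 0) * ‖w‖ := by
      have := hεle n
      have := hε0 n
      gcongr
    have h3 := hL w
    rw [hMdef, add_mul]
    linarith
  obtain ⟨μ, hμ⟩ := exists_seminorm_of_abs_sub_le hε (C := M * (1 + ε 0)) (ν := ν) fun n k w => by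
    refine (hcmp n k hM0 (hM k) w).trans ?_
    have := hεle n
    have h1 := hε0 n
    have h2 := hε0 k
    calc M * (ε n + ε k) * (1 + ε n) * ‖w‖ ≤ M * (ε n + ε k) * (1 + ε 0) * ‖w‖ := by gcongr
      _ = M * (1 + ε 0) * (ε n + ε k) * ‖w‖ := by ring
  refine ⟨μ, i, fun n => ⟨(hx n).mem, (hx n).isRarePoint.isDensityPoint hm hd,
    (hx n).isRarePoint_image.isDensityPoint isReferenceMeasure_volume
      uniformlyLocallyDoubling_volume⟩, ?_⟩
  set T : ℝ := M * (1 + ε 0) * (1 + ε 0) + 1 with hT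
  have hT0 : 0 ≤ T := by positivity
  have hap : ∀ n, apLimsup m (U n (i n)) (fun y => ENNReal.ofReal
      (|dist (u y) (u x) - μ (φ n (i n) y - φ n (i n) x)| / dist y x)) x ≤
        ENNReal.ofReal (T * ε n) := by
    intro n
    have hn := hε0 n
    refine sInf_le (IsRarePoint.isDensityPoint hm hd ?_)
    refine ((hν n (ε n) hn).union (hx n).isRarePoint).mono fun y hy => ?_
    by_contra hcon
    simp only [mem_union, mem_ofPred_eq, mem_compl_iff, not_or, not_not, not_and, not_lt] at hcon
    obtain ⟨h1, hyU⟩ := hcon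
    refine hy ⟨hyU, ofReal_abs_sub_div_le dist_nonneg (by positivity) ?_⟩
    have h1 := abs_le.1 (h1 hyU)
    have h2 := abs_le.1 (hμ n (φ n (i n) y - φ n (i n) x))
    have h3 : ‖φ n (i n) y - φ n (i n) x‖ ≤ (1 + ε 0) * dist y x := by
      rw [← dist_eq_norm]
      refine ((hc n).upper y hyU x (hx n).mem).trans ?_
      have := hεle n
      gcongr
    have h4 : M * (1 + ε 0) * ε n * ‖φ n (i n) y - φ n (i n) x‖ ≤
        M * (1 + ε 0) * ε n * ((1 + ε 0) * dist y x) := by gcongr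
    have h5 : T * ε n * dist y x =
        M * (1 + ε 0) * ε n * ((1 + ε 0) * dist y x) + ε n * dist y x := by
      rw [hT]; ring
    exact abs_le.2 ⟨by linarith [h1.1, h2.1, h2.2], by linarith [h1.2, h2.1, h2.2]⟩
  refine Tendsto.limsup_eq (tendsto_of_tendsto_of_tendsto_of_le_of_le tendsto_const_nhds
    (h := fun n => ENNReal.ofReal (T * ε n)) ?_ (fun _ => bot_le) hap)
  have := ENNReal.tendsto_ofReal (hε.const_mul T)
  rwa [mul_zero, ENNReal.ofReal_zero] at this

/-- Any approximate metric differential is the limit of the chart differentials. -/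
lemma IsApproxMetricDifferentialAt.eventually_abs_sub_le (hm : IsReferenceMeasure m)
    (hd : UniformlyLocallyDoubling m) {ε : ℕ → ℝ} {U : ℕ → ℕ → Set X}
    {φ : ℕ → ℕ → X → EuclideanSpace ℝ (Fin d)} (hε0 : ∀ n, 0 < ε n) (hanti : Antitone ε)
    (h : ∀ n, IsAtlas m d (ε n) (U n) (φ n)) (hu : AEStronglyMeasurable u m) {i : ℕ → ℕ}
    {ν : ℕ → Seminorm ℝ (EuclideanSpace ℝ (Fin d))}
    (hx : ∀ n, IsChartPoint m (U n (i n)) (φ n (i n)) x)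
    (hν : ∀ n, HasChartDifferentialAt m (U n (i n)) (φ n (i n)) u (ν n) x)
    (hμ : IsApproxMetricDifferentialAt m U φ u x μ) {τ : ℝ} (hτ : 0 < τ) :
    ∀ᶠ n in atTop, ∀ w, |ν n w - μ w| ≤ τ * ‖w‖ := by
  obtain ⟨j, hj, hlim⟩ := hμ
  have hji : ∀ n, j n = i n := by
    intro n
    by_contra hne
    exact disjoint_left.1 ((h n).disjoint hne) (hj n).1 (hx n).mem
  obtain rfl : j = i := funext hji
  have h0 := hε0 0
  set η : ℝ := τ / (2 * (1 + ε 0)) with hη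
  have hη0 : 0 < η := by positivity
  have hev := eventually_lt_of_limsup_lt
    (hlim.trans_lt (ENNReal.ofReal_pos.2 hη0) : limsup _ atTop < ENNReal.ofReal η)
  filter_upwards [hev] with n hn
  obtain ⟨c, hc⟩ := (h n).exists_isChart (j n)
  obtain ⟨t, ht, htη⟩ := sInf_lt_iff.1 hn
  set f : X → ℝ≥0∞ := fun y => ENNReal.ofReal
    (|dist (u y) (u x) - μ (φ n (j n) y - φ n (j n) x)| / dist y x) with hf
  have hfm : AEMeasurable ((U n (j n)).indicator f) m := by
    refine (aemeasurable_indicator_iff hc.measurableSet).2 (AEMeasurable.ennreal_ofReal ?_)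
    refine AEMeasurable.div (AEMeasurable.abs ?_) (by fun_prop)
    refine ((hu.dist aestronglyMeasurable_const).aemeasurable.restrict).sub ?_
    exact (continuous_seminorm μ).measurable.comp_aemeasurable
      ((hc.aemeasurable (hε0 n)).sub_const _)
  have hnull : NullMeasurableSet {y ∈ U n (j n) | f y ≤ t} m := by
    have h1 : {y ∈ U n (j n) | f y ≤ t} =
        U n (j n) ∩ {y | (U n (j n)).indicator f y ≤ t} := by
      ext y
      constructor
      · rintro ⟨hy1, hy2⟩
        exact ⟨hy1, by rw [mem_ofPred_eq, indicator_of_mem hy1]; exact hy2⟩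
      · rintro ⟨hy1, hy2⟩
        rw [mem_ofPred_eq, indicator_of_mem hy1] at hy2
        exact ⟨hy1, hy2⟩
    rw [h1]
    exact hc.measurableSet.nullMeasurableSet.inter (nullMeasurableSet_le hfm aemeasurable_const)
  have hrare := (IsDensityPoint.isRarePoint hm hd hnull ht).union (hν n η hη0)
  have hθ : 0 < 1 + ε n := by linarith [hε0 n]
  have key : ∀ y ∈ U n (j n), y ∉ {y ∈ U n (j n) | f y ≤ t}ᶜ ∪ {y ∈ U n (j n) | η * dist y x <
      |dist (u y) (u x) - ν n (φ n (j n) y - φ n (j n) x)|} →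
      |ν n (φ n (j n) y - φ n (j n) x) - μ (φ n (j n) y - φ n (j n) x)| ≤
        τ * ‖φ n (j n) y - φ n (j n) x‖ := by
    intro y hyU hyB
    have h1 : f y ≤ t := by_contra fun hcon => hyB (Or.inl fun hy => hcon hy.2)
    have h2 := abs_le.1 (not_lt.1 fun hcon => hyB (Or.inr ⟨hyU, hcon⟩))
    rcases eq_or_ne y x with rfl | hyx
    · simp
    have hdist : 0 < dist y x := dist_pos.2 hyx
    have h3 : |dist (u y) (u x) - μ (φ n (j n) y - φ n (j n) x)| ≤ η * dist y x := by
      rw [← div_le_iff₀ hdist]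
      exact (ENNReal.ofReal_le_ofReal_iff hη0.le).1 (h1.trans htη.le)
    have h3 := abs_le.1 h3
    have h4 : dist y x ≤ (1 + ε 0) * ‖φ n (j n) y - φ n (j n) x‖ := by
      rw [← dist_eq_norm]
      refine (hc.lower y hyU x (hx n).mem).trans ?_
      have := hanti (Nat.zero_le n)
      gcongr
    have h5 : 2 * η * dist y x ≤ τ * ‖φ n (j n) y - φ n (j n) x‖ := by
      calc 2 * η * dist y x ≤ 2 * η * ((1 + ε 0) * ‖φ n (j n) y - φ n (j n) x‖) := by gcongr
        _ = τ * ‖φ n (j n) y - φ n (j n) x‖ := by rw [hη]; field_simp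
    refine le_trans (abs_le.2 ⟨?_, ?_⟩) h5 <;> linarith [h2.1, h2.2, h3.1, h3.2]
  intro w
  have h1 := hc.seminorm_le_add (ν := ν n) (μ := μ) hm hd (hε0 n) (hx n) hrare hτ.le
    (fun y hyU hyB => by linarith [(abs_le.1 (key y hyU hyB)).2]) w
  have h2 := hc.seminorm_le_add (ν := μ) (μ := ν n) hm hd (hε0 n) (hx n) hrare hτ.le
    (fun y hyU hyB => by linarith [(abs_le.1 (key y hyU hyB)).1]) w
  exact abs_le.2 ⟨by linarith, by linarith⟩

end Aligned

/-! ### Identification of the limit -/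

section Identification

variable {d : ℕ} {p : ℝ}

lemma pSize_eq (hp : 1 < p) (ν : Seminorm ℝ (EuclideanSpace ℝ (Fin d))) :
    pSize p ν = (seminormMean p ν ^ (1 / p)).toReal := by
  have hp0 : 0 < p := by linarith
  rw [pSize, seminormMean, ← ENNReal.toReal_rpow, ENNReal.toReal_div, setAverage_eq, smul_eq_mul,
    integral_eq_lintegral_of_nonneg_ae (.of_forall fun w => by positivity)
      ((continuous_seminorm ν).rpow_const fun _ => Or.inr hp0.le).aestronglyMeasurable,
    inv_mul_eq_div]
  simp_rw [ENNReal.ofReal_rpow_of_nonneg (apply_nonneg ν _) hp0.le]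
  rfl

/-- The `p`-size is continuous for uniform convergence on bounded sets. -/
lemma tendsto_seminormMean (hp : 0 < p) {ν : ℕ → Seminorm ℝ (EuclideanSpace ℝ (Fin d))}
    {μ : Seminorm ℝ (EuclideanSpace ℝ (Fin d))}
    (h : ∀ τ : ℝ, 0 < τ → ∀ᶠ n in atTop, ∀ w, |ν n w - μ w| ≤ τ * ‖w‖) :
    Tendsto (fun n => seminormMean p (ν n)) atTop (𝓝 (seminormMean p μ)) := by
  obtain ⟨L, hL⟩ := exists_seminorm_le μ
  have hω0 : volume (ball (0 : EuclideanSpace ℝ (Fin d)) 1) ≠ 0 :=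
    (Metric.measure_ball_pos volume _ one_pos).ne'
  refine ENNReal.Tendsto.div_const ?_ (Or.inr hω0)
  refine tendsto_lintegral_filter_of_dominated_convergence
    (fun _ => ENNReal.ofReal (L + 1) ^ p) (.of_forall fun n => measurable_seminorm_rpow (ν n) p)
    ?_ ?_ (.of_forall fun w => ?_)
  · filter_upwards [h 1 one_pos] with n hn
    refine (ae_restrict_iff' measurableSet_ball).2 (.of_forall fun w hw => ?_)
    gcongr
    have h1 : ‖w‖ ≤ 1 := (mem_ball_zero_iff.1 hw).le
    have h2 := (abs_le.1 (hn w)).2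
    have h3 := hL w
    nlinarith [L.coe_nonneg]
  · rw [setLIntegral_const]
    exact ENNReal.mul_ne_top (ENNReal.rpow_ne_top_of_nonneg hp.le ENNReal.ofReal_ne_top)
      measure_ball_lt_top.ne
  · refine (ENNReal.tendsto_ofReal ?_).ennrpow_const p
    rw [Metric.tendsto_nhds]
    intro τ hτ
    filter_upwards [h (τ / (‖w‖ + 1)) (by positivity)] with n hn
    rw [Real.dist_eq]
    refine (hn w).trans_lt ?_
    rw [div_mul_eq_mul_div, div_lt_iff₀ (by positivity)]
    nlinarith [norm_nonneg w]

variable {X Y : Type*} [MetricSpace X] [MeasurableSpace X] {m : Measure X} [MetricSpace Y]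
  [BorelSpace X] [PolishSpace X] {u : X → Y}

/-- Along an aligned family the map is metrically differentiable almost everywhere, and the limit
of the energy densities is the `p`-size of any metric differential. -/
lemma IsAlignedFamily.ae_eq_pSize (hm : IsReferenceMeasure m)
    (hd : UniformlyLocallyDoubling m) (hp : 1 < p) {ε : ℕ → ℝ} {U : ℕ → ℕ → Set X}
    {φ : ℕ → ℕ → X → EuclideanSpace ℝ (Fin d)} (hε0 : ∀ n, 0 < ε n) (hanti : Antitone ε)
    (hε : Tendsto ε atTop (𝓝 0)) (h : IsAlignedFamily m d ε U φ) (hu : AEStronglyMeasurable u m)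
    {G : X → ℝ≥0} (hG : Measurable G) (hGp : ∫⁻ x, (G x : ℝ≥0∞) ^ p ∂m < ∞) {N : Set X}
    (hN : m N = 0)
    (hH : ∀ x ∉ N, ∀ y ∉ N, dist x y < 1 / 4 → edist (u x) (u y) ≤ edist x y * (G x + G y)) :
    ∀ᵐ x ∂m, (∃ μ, IsApproxMetricDifferentialAt m U φ u x μ) ∧
      ∀ μ, IsApproxMetricDifferentialAt m U φ u x μ → ∀ l : ℝ≥0∞,
        Tendsto (fun r => ksDensity m p r u x) (𝓝[>] 0) (𝓝 l) → l.toReal = pSize p μ := by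
  have hp0 : 0 < p := by linarith
  filter_upwards [ae_all_iff.2 fun n =>
    (h.atlas n).ae_exists_isChartPoint hm hd (hε0 n) hu hG hN hH,
    ae_isHajlaszPoint hm hd hp hG hGp hN hH] with x hx hxH
  choose i ν hxU hν using hx
  refine ⟨h.exists_isApproxMetricDifferentialAt hm hd hε0 hanti hε hxU hν, fun μ hμ l hl => ?_⟩
  have hS := (tendsto_seminormMean hp0 fun τ hτ =>
    hμ.eventually_abs_sub_le hm hd hε0 hanti h.atlas hu hxU hν hτ)
  have hb := fun n => (h.atlas n).limsup_ksDensity_le hm hd hp (hε0 n) hu hG hxH (hxU n) (hν n)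
  rw [hl.limsup_eq, hl.liminf_eq] at hb
  have hD := tendsto_distortion d p hε
  have h1 : l ≤ seminormMean p μ ^ (1 / p) := by
    have := (ENNReal.Tendsto.mul hD (Or.inl one_ne_zero) hS (Or.inr (by simp))).ennrpow_const
      (1 / p)
    rw [one_mul] at this
    exact ge_of_tendsto' this fun n => (hb n).1
  have h2 : seminormMean p μ ^ (1 / p) ≤ l := by
    have := ENNReal.Tendsto.mul_const (b := l) (hD.ennrpow_const (1 / p)) (Or.inl (by simp))
    rw [ENNReal.one_rpow, one_mul] at this
    exact le_of_tendsto_of_tendsto' (hS.ennrpow_const (1 / p)) this fun n => (hb n).2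
  rw [pSize_eq hp, le_antisymm h1 h2]

/-- The energy density exists, with all its properties. -/
lemma MemKS.exists_energyDensity (hm : IsReferenceMeasure m) (hrect : StronglyRectifiable m)
    (hd : UniformlyLocallyDoubling m) (hpoinc : SupportsPoincare m) (hp : 1 < p) {ybar : Y}
    (hu : MemKS m p ybar u) :
    ∃ e : X → ℝ, MemLp e (ENNReal.ofReal p) m ∧
      (∀ᵐ x ∂m, Tendsto (fun r : ℝ => (ksDensity m p r u x).toReal) (𝓝[>] 0) (𝓝 (e x))) ∧
      Tendsto (fun r : ℝ =>
        eLpNorm (fun x => (ksDensity m p r u x).toReal - e x) (ENNReal.ofReal p) m)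
        (𝓝[>] 0) (𝓝 0) ∧
      Tendsto (fun r : ℝ => ksEnergyAtScale m p r u) (𝓝[>] 0)
        (𝓝 (eLpNorm e (ENNReal.ofReal p) m ^ p)) ∧
      ∀ (d : ℕ) (ε : ℕ → ℝ) (U : ℕ → ℕ → Set X) (φ : ℕ → ℕ → X → EuclideanSpace ℝ (Fin d)),
        (∀ n, 0 < ε n) → Antitone ε → Tendsto ε atTop (𝓝 0) → IsAlignedFamily m d ε U φ →
        ∀ᵐ x ∂m, (∃ ν, IsApproxMetricDifferentialAt m U φ u x ν) ∧
          ∀ ν, IsApproxMetricDifferentialAt m U φ u x ν → e x = pSize p ν := by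
  have hum := hu.memLpPointed.aestronglyMeasurable
  obtain ⟨G, hG, hGp, N, hN, hH⟩ :=
    exists_hajlasz_bound_nnreal hm hd hpoinc hp hum hu.energy_lt_top
  have hlim := ae_exists_tendsto_ksDensity hm hrect hd hp hum hG hGp hN hH
  set e : X → ℝ := fun x => (limsup (fun r => ksDensity m p r u x) (𝓝[>] 0)).toReal with he
  have hconv : ∀ᵐ x ∂m,
      Tendsto (fun r : ℝ => (ksDensity m p r u x).toReal) (𝓝[>] 0) (𝓝 (e x)) := by
    filter_upwards [hlim] with x ⟨l, hl, hx⟩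
    rw [he]
    dsimp only
    rw [hx.limsup_eq]
    exact (ENNReal.tendsto_toReal hl).comp hx
  have hNae := measure_eq_zero_iff_ae_notMem.1 hN
  obtain ⟨h1, h2, h3⟩ := hu.memLpPointed.tendsto_eLpNorm_ksDensity hm hd hp
    hG.coe_nnreal_ennreal hGp
    (hNae.mono fun x hx => hNae.mono fun y hy hxy => hH x hx y hy hxy) hconv
  refine ⟨e, h1, hconv, h2, h3, fun d ε U φ hε0 hanti hε h => ?_⟩
  filter_upwards [h.ae_eq_pSize hm hd hp hε0 hanti hε hum hG hGp hN hH, hlim]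
    with x ⟨hx1, hx2⟩ ⟨l, hl, hx⟩
  refine ⟨hx1, fun ν hν => ?_⟩
  rw [← hx2 ν hν l hx, he]
  dsimp only
  rw [hx.limsup_eq]

end Identification

end KorevaarSchoen

end

theorem theorem3p8 {X : Type*} [MetricSpace X] [CompleteSpace X]
    [TopologicalSpace.SeparableSpace X] [MeasurableSpace X] [BorelSpace X]
    (m : Measure X) (hm : IsReferenceMeasure m)
    (hrect : StronglyRectifiable m) (hdoub : UniformlyLocallyDoubling m)
    (hpoinc : SupportsPoincare m)
    {Y : Type*} [MetricSpace Y] [CompleteSpace Y] (ybar : Y)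
    (p : ℝ) (hp : 1 < p) :
    (∀ u : X → Y, MemKS m p ybar u →
      ∃ e : X → ℝ,
        MemLp e (ENNReal.ofReal p) m ∧
        -- the densities at positive scale are finite and belong to `L^p`
        (∀ r : ℝ, 0 < r → (∀ x, ksDensity m p r u x < ∞) ∧
          MemLp (fun x => (ksDensity m p r u x).toReal) (ENNReal.ofReal p) m) ∧
        -- convergence almost everywhere and in `L^p`
        (∀ᵐ x ∂m, Tendsto (fun r : ℝ => (ksDensity m p r u x).toReal) (𝓝[>] 0) (𝓝 (e x))) ∧
        Tendsto (fun r : ℝ =>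
          eLpNorm (fun x => (ksDensity m p r u x).toReal - e x) (ENNReal.ofReal p) m)
          (𝓝[>] 0) (𝓝 0) ∧
        -- the limit is the `p`-size of the metric differential, for every aligned family
        (∀ (d : ℕ) (ε : ℕ → ℝ) (U : ℕ → ℕ → Set X) (φ : ℕ → ℕ → X → EuclideanSpace ℝ (Fin d)),
          (∀ n, 0 < ε n) → Antitone ε → Tendsto ε atTop (𝓝 0) →
          IsAlignedFamily m d ε U φ →
          ∀ᵐ x ∂m,
            (∃ ν, IsApproxMetricDifferentialAt m U φ u x ν) ∧
            ∀ ν, IsApproxMetricDifferentialAt m U φ u x ν → e x = pSize p ν)) ∧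
    -- the limit defining the energy exists in `[0, ∞]`
    (∀ u : X → Y, MemLpPointed m p ybar u →
      Tendsto (fun r : ℝ => ksEnergyAtScale m p r u) (𝓝[>] 0) (𝓝 (ksEnergy m p u))) := by
  have : SecondCountableTopology X := UniformSpace.secondCountable_of_separable X
  have : PolishSpace X := ⟨⟩
  refine ⟨fun u hu => ?_, fun u hu => ?_⟩
  · obtain ⟨e, h1, h2, h3, -, h4⟩ := hu.exists_energyDensity hm hrect hdoub hpoinc hp
    exact ⟨e, h1, fun r hr => ⟨hu.memLpPointed.ksDensity_lt_top hm hdoub hp hr,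
      hu.memLpPointed.memLp_ksDensity hm hdoub hp hr⟩, h2, h3, h4⟩
  · rcases eq_or_ne (ksEnergy m p u) ∞ with h | h
    · refine tendsto_of_le_liminf_of_limsup_le le_rfl ?_
      rw [h]
      exact le_top
    · obtain ⟨e, -, -, -, h1, -⟩ :=
        MemKS.exists_energyDensity hm hrect hdoub hpoinc hp ⟨hu, h.lt_top⟩
      have h2 : ksEnergy m p u = _ := h1.liminf_eq
      rwa [h2]
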